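/- Fix $p>2$. A single-knot metric graph consists of $H\ge 1$ half-lines, $P\ge 0$ pendants and $L\ge 0$ loops, all attached at one vertex $\mathbf 0$; it is regular of length $\ell>0$ if every pendant has length $\ell$ and every loop has length $2\ell$. Each edge is parametrized by $[0,\ell_e]$ (by $[0,\infty)$ for a half-line), with $\mathbf 0$ at $x=0$ (and also at $x=\ell_e$ on a loop). Let $H^1(\mathcal G)$ be the space of continuous $u:\mathcal G\to\mathbb R$ such that the restriction $u_e$ belongs to $H^1$ for every edge $e$. A bound-state is a function $u\in H^1(\mathcal G)\setminus\{0\}$ such that $$\int_{\mathcal G} \big(u'\eta'+u\eta-|u|^{p-2}u\,\eta\big)\,dx=0\quad\text{for all }\eta\in H^1(\mathcal G),$$ and an action ground-state is a bound-state with the least action $$S(u)=\frac12\int_{\mathcal G}\big(|u'|^2+|u|^2\big)\,dx-\frac1p\int_{\mathcal G}|u|^p\,dx$$ among all bound-states. On a regular graph of length $\ell$, split every loop at its midpoint into two compact edges of length $\ell$, each parametrized by the distance to $\mathbf 0$; a function $u$ is symmetric if its restrictions to any two compact edges coincide and its restrictions to any two half-lines coincide. Theorem. Let $p>2$, $H\ge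 2$ and $P,L\ge 0$ with $P+L=1$. There exists $\ell_0>0$ such that, for every $\ell\ge \ell_0$, the regular single-knot graph of length $\ell$ with $H$ half-lines, $P$ pendants and $L$ loops admits an action ground-state, and every action ground-state on it is symmetric. -/

import Mathlib

open MeasureTheory Set
open scoped ContDiff

/-- A single-knot metric graph: `H ≥ 1` half-lines, `P` pendants and `L` loops, all attached at one
vertex `0`. -/
structure SingleKnotGraph (H P L : ℕ) where
  one_le_halfLines : 1 ≤ H
  pendantLength : Fin P → ℝ
  pendantLength_pos : ∀ i, 0 < pendantLength i
  loopLength : Fin L → ℝ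
  loopLength_pos : ∀ j, 0 < loopLength j

namespace SingleKnotGraph

variable {H P L : ℕ}

/-- The graph is regular of length `ℓ`: pendants have length `ℓ` and loops have length `2 * ℓ`. -/
def IsRegular (G : SingleKnotGraph H P L) (ℓ : ℝ) : Prop :=
  (∀ i, G.pendantLength i = ℓ) ∧ (∀ j, G.loopLength j = 2 * ℓ)

/-- The edges: pendants, loops and half-lines. -/
abbrev Edge (H P L : ℕ) : Type := Fin P ⊕ (Fin L ⊕ Fin H)

abbrev pendant (i : Fin P) : Edge H P L := Sum.inl i

abbrev loop (j : Fin L) : Edge H P L := Sum.inr (Sum.inl j)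

abbrev halfLine (h : Fin H) : Edge H P L := Sum.inr (Sum.inr h)

/-- The interval with which an edge is identified, `[0, length]` or `[0, ∞)`. The vertex `0` is the
point `x = 0` of every edge, and also the point `x = length` of every loop. -/
def closedEdge (G : SingleKnotGraph H P L) : Edge H P L → Set ℝ
  | Sum.inl i => Icc 0 (G.pendantLength i)
  | Sum.inr (Sum.inl j) => Icc 0 (G.loopLength j)
  | Sum.inr (Sum.inr _) => Ici 0

/-- The interior of the interval with which an edge is identified. -/
def openEdge (G : SingleKnotGraph H P L) : Edge H P L → Set ℝ
  | Sum.inl i => Ioo 0 (G.pendantLength i)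
  | Sum.inr (Sum.inl j) => Ioo 0 (G.loopLength j)
  | Sum.inr (Sum.inr _) => Ioi 0

/-- The integral over the graph of a function given edge by edge. -/
noncomputable def integral (G : SingleKnotGraph H P L) (f : Edge H P L → ℝ → ℝ) : ℝ :=
  ∑ e, ∫ x in G.openEdge e, f e x

/-- `g` is a weak derivative of `u` on the open set `I`. -/
def IsWeakDeriv (I : Set ℝ) (u g : ℝ → ℝ) : Prop :=
  ∀ ψ : ℝ → ℝ, ContDiff ℝ ∞ ψ → HasCompactSupport ψ → tsupport ψ ⊆ I →
    ∫ x in I, u x * deriv ψ x = -∫ x in I, g x * ψ x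

/-- An element of `H¹(G)`: a continuous real function on the graph whose restriction to each edge is
in `H¹`. It is given by its restrictions `toFun e` to the edges, of which only the values on
`G.closedEdge e` are meaningful, and it comes with a representative `deriv e` of the weak derivative
on each edge, which is determined almost everywhere on `G.openEdge e` by `toFun e`. -/
structure H1Function (G : SingleKnotGraph H P L) where
  toFun : Edge H P L → ℝ → ℝ
  deriv : Edge H P L → ℝ → ℝ
  continuousOn : ∀ e, ContinuousOn (toFun e) (G.closedEdge e)
  continuous_vertex : ∃ c : ℝ, (∀ e, toFun e 0 = c) ∧
    ∀ j : Fin L, toFun (loop j) (G.loopLength j) = c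
  memLp : ∀ e, MemLp (toFun e) 2 (volume.restrict (G.openEdge e))
  deriv_memLp : ∀ e, MemLp (deriv e) 2 (volume.restrict (G.openEdge e))
  isWeakDeriv : ∀ e, IsWeakDeriv (G.openEdge e) (toFun e) (deriv e)

variable {G : SingleKnotGraph H P L}

/-- The action
`S(u) = (1/2) ∫_G (|u'|² + |u|²) - (1/p) ∫_G |u|^p`. -/
noncomputable def action (p : ℝ) (u : H1Function G) : ℝ :=
  1 / 2 * G.integral (fun e x => (u.deriv e x) ^ 2 + (u.toFun e x) ^ 2)
    - 1 / p * G.integral (fun e x => |u.toFun e x| ^ p)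

/-- A bound-state: a nontrivial weak solution in `H¹(G)` of `-u'' + u = |u|^(p-2) u`. -/
def IsBoundState (p : ℝ) (u : H1Function G) : Prop :=
  (∃ e, ∃ x ∈ G.closedEdge e, u.toFun e x ≠ 0) ∧
  ∀ η : H1Function G,
    G.integral (fun e x => u.deriv e x * η.deriv e x + u.toFun e x * η.toFun e x
      - |u.toFun e x| ^ (p - 2) * u.toFun e x * η.toFun e x) = 0

/-- An action ground-state: a bound-state whose action is the least among all bound-states. -/
def IsActionGroundState (p : ℝ) (u : H1Function G) : Prop :=
  IsBoundState p u ∧ IsLeast {s : ℝ | ∃ v : H1Function G, IsBoundState p v ∧ action p v = s}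
    (action p u)

/-- The compact edges of a regular graph after a dummy vertex has been put at the midpoint of every
loop: the pendants and, for each loop, its first and its second half. -/
abbrev CoreEdge (P L : ℕ) : Type := Fin P ⊕ (Fin L ⊕ Fin L)

/-- The restriction of `u` to a compact edge, as a function of the distance `x ∈ [0, ℓ]` to the
vertex `0` along that edge. -/
def coreRestriction (ℓ : ℝ) (u : H1Function G) : CoreEdge P L → ℝ → ℝ
  | Sum.inl i => u.toFun (pendant i)
  | Sum.inr (Sum.inl j) => u.toFun (loop j)
  | Sum.inr (Sum.inr j) => fun x => u.toFun (loop j) (2 * ℓ - x)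

/-- Core-symmetry of a function on a regular graph of length `ℓ`. -/
def IsCoreSymmetric (ℓ : ℝ) (u : H1Function G) : Prop :=
  ∀ k₁ k₂ : CoreEdge P L, EqOn (coreRestriction ℓ u k₁) (coreRestriction ℓ u k₂) (Icc 0 ℓ)

/-- Symmetry of a function on a regular graph of length `ℓ`. -/
def IsSymmetric (ℓ : ℝ) (u : H1Function G) : Prop :=
  IsCoreSymmetric ℓ u ∧
  ∀ h₁ h₂ : Fin H, EqOn (u.toFun (halfLine h₁)) (u.toFun (halfLine h₂)) (Ici 0)

end SingleKnotGraph

/-! A bound-state solves `u'' = u - |u|^(p-2) u` classically on each edge, with zero slope at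
pendant tips and Kirchhoff's condition at the vertex. Testing the equation with `u` itself shows
that its action is `κ ∫ |u|^p` with `κ = 1/2 - 1/p`, so actions are compared through the masses `∫
|u|^p`.

On a half-line, the energy `u'^2/2 - u^2/2 + |u|^p/p` is constant and integrable, hence zero, so a
nontrivial `u` there is a piece `σ φ(x + t)` of the soliton `φ`, with `σ = ±1`. If the vertex value
`c` is nonzero, `|c| = φ(a)` fixes `a ≥ 0`, and each half-line can only choose `t = a` or `t = -a`.
Write `m` for the mass of half a soliton. One half-line with shift `-a` and any other one together
have mass at least `2m`. So either the half-lines alone carry a full soliton, or all shifts equal `a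
> 0` and `u` coincides on all half-lines. In the second case, Kirchhoff's condition makes `u`, up to
sign, on each compact edge the solution `U a` with data `φ(a)`, `-N φ'(a)`, where `N = H / (P +
2L)`, and with zero slope at distance `ℓ`; on a loop, energy conservation and uniqueness give the
reflection symmetry (`pendant_alternative`, `loop_alternative`). If `c = 0`, a pendant admits only
the zero solution, and a loop must carry two full arcs, of mass at least `4m`.

It remains to find a shooting solution strictly below all the asymmetric bound-states. Here `H ≥ 2`
gives `N ≥ 1`, so shooting solutions have nonnegative energy. For long edges there is a large `a`
with `U a` increasing up to a Neumann point at `ℓ` and mass on `[0, ℓ]` close to `m`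
(`IsShooting.exists_small_action`). For a pendant the total is near `m < 2m`. For a loop it is near
`2m`, and a gap is needed: for `H ≥ 3` asymmetric bound-states have mass at least `2m + min (1/2)
m`; for `H = 2` the weight is `1`, the competitor is made of exact soliton pieces with total mass
`2m`, and asymmetric bound-states are strictly above.

Ground-states then exist because the admissible shooting parameters form a compact set on which the
mass is continuous (`IsShooting.exists_min_mass`), and they are symmetric because every other
bound-state is beaten (`IsShooting.exists_groundState_and_isSymmetric`). -/

open Filter Topology

namespace SingleKnotGraph

/-! ### The nonlinearity and its solutions on an interval -/

/-- The right-hand side of `u'' = u - |u|^(p-2) u`. -/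
noncomputable def force (p u : ℝ) : ℝ := u - |u| ^ (p - 2) * u

/-- `u` is a classical solution of `u'' = u - |u|^(p-2) u` on `s`, with derivative `v`. -/
def IsSol (p : ℝ) (s : Set ℝ) (u v : ℝ → ℝ) : Prop :=
  ∀ x ∈ s, HasDerivWithinAt u (v x) s x ∧ HasDerivWithinAt v (force p (u x)) s x

/-- The conserved energy of the equation. -/
noncomputable def energy (p u v : ℝ) : ℝ := v ^ 2 / 2 - u ^ 2 / 2 + |u| ^ p / p

variable {p : ℝ}

lemma force_neg (p u : ℝ) : force p (-u) = -force p u := by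
  simp only [force, abs_neg]; ring

lemma force_zero (p : ℝ) : force p 0 = 0 := by simp [force]

/-- Splitting into positive and negative parts exhibits the nonlinearity as the C¹ function `x ^ (p
- 1)` composed with 1-Lipschitz maps, which yields local Lipschitz continuity for every `p > 2`. -/
lemma abs_rpow_sub_two_mul_self (hp : 2 < p) (u : ℝ) :
    |u| ^ (p - 2) * u = max u 0 ^ (p - 1) - max (-u) 0 ^ (p - 1) := by
  have h1 : p - 1 ≠ 0 := by linarith
  rcases le_total 0 u with h | h
  · rw [max_eq_left h, max_eq_right (by linarith), Real.zero_rpow h1, abs_of_nonneg h, sub_zero,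
      show p - 1 = (p - 2) + 1 by ring, Real.rpow_add_one' h (by linarith)]
  · rw [max_eq_right h, max_eq_left (by linarith), Real.zero_rpow h1, abs_of_nonpos h, zero_sub,
      show p - 1 = (p - 2) + 1 by ring, Real.rpow_add_one' (by linarith) (by linarith)]
    ring

lemma abs_rpow_sub_two_mul_sq (hp : 2 < p) (u : ℝ) : |u| ^ (p - 2) * u * u = |u| ^ p := by
  rw [mul_assoc, ← abs_mul_abs_self u, ← mul_assoc, ← Real.rpow_add_one' (abs_nonneg u) (by linarith),
    ← Real.rpow_add_one' (abs_nonneg u) (by linarith)]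
  ring_nf

lemma force_mul_self (hp : 2 < p) (u : ℝ) : force p u * u = u ^ 2 - |u| ^ p := by
  rw [← abs_rpow_sub_two_mul_sq hp, force]; ring

lemma exists_lipschitzOnWith_force (hp : 2 < p) (R : ℝ) :
    ∃ K, LipschitzOnWith K (force p) (Icc (-R) R) := by
  have hc : ContDiff ℝ 1 (fun x : ℝ => x ^ (p - 1)) := by
    have := Real.contDiff_rpow_const_of_le (p := p - 1) (n := 1) (by norm_num; linarith)
    simpa using this
  obtain ⟨K, hK⟩ := hc.contDiffOn.exists_lipschitzOnWith (s := Icc (-R) R) one_ne_zero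
    (convex_Icc _ _) isCompact_Icc
  have hmax : LipschitzWith 1 (fun x : ℝ => max x 0) := LipschitzWith.id.max_const 0
  have hmax' : LipschitzWith 1 (fun x : ℝ => max (-x) 0) := by
    simpa using LipschitzWith.id.neg.max_const 0
  have h1 : LipschitzOnWith (K * 1) ((fun x : ℝ => x ^ (p - 1)) ∘ fun x => max x 0) (Icc (-R) R) :=
    hK.comp hmax.lipschitzOnWith (fun x hx => ⟨by have := le_max_right x 0; grind,
      max_le hx.2 (by grind)⟩)
  have h2 : LipschitzOnWith (K * 1) ((fun x : ℝ => x ^ (p - 1)) ∘ fun x => max (-x) 0)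
      (Icc (-R) R) :=
    hK.comp hmax'.lipschitzOnWith (fun x hx => ⟨by have := le_max_right (-x) 0; grind,
      max_le (by grind) (by grind)⟩)
  refine ⟨1 + (K * 1 + K * 1), ?_⟩
  have h3 := (LipschitzWith.id.lipschitzOnWith (s := Icc (-R) R)).sub (h1.sub h2)
  have h4 : force p = fun x => id x - (((fun x : ℝ => x ^ (p - 1)) ∘ fun x => max x 0) x -
      ((fun x : ℝ => x ^ (p - 1)) ∘ fun x => max (-x) 0) x) :=
    funext fun x => by simp [force, abs_rpow_sub_two_mul_self hp]
  rw [h4]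
  exact h3

lemma exists_lipschitzOnWith_field (hp : 2 < p) (R : ℝ) :
    ∃ K : NNReal, LipschitzOnWith K (fun z : ℝ × ℝ => (z.2, force p z.1)) (Icc (-R) R ×ˢ univ) := by
  obtain ⟨K, hK⟩ := exists_lipschitzOnWith_force hp R
  refine ⟨max 1 K, ?_⟩
  have h1 : LipschitzOnWith 1 (fun z : ℝ × ℝ => z.2) (Icc (-R) R ×ˢ univ) :=
    LipschitzWith.prod_snd.lipschitzOnWith
  have h2 : LipschitzOnWith K (fun z : ℝ × ℝ => force p z.1) (Icc (-R) R ×ˢ univ) := by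
    have := hK.comp (f := fun z : ℝ × ℝ => z.1) (s := Icc (-R) R ×ˢ univ)
      LipschitzWith.prod_fst.lipschitzOnWith (fun z hz => hz.1)
    simpa [Function.comp_def] using this
  exact h1.prodMk h2

lemma continuous_abs_rpow (hp : 0 ≤ p) : Continuous fun u : ℝ => |u| ^ p :=
  continuous_abs.rpow_const fun _ => Or.inr hp

lemma continuous_force (hp : 2 < p) : Continuous (force p) :=
  continuous_id.sub ((continuous_abs_rpow (by linarith)).mul continuous_id)

lemma hasDerivAt_potential (hp : 2 < p) (u : ℝ) :
    HasDerivAt (fun u : ℝ => u ^ 2 / 2 - |u| ^ p / p) (force p u) u := by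
  have h1 := ((hasDerivAt_pow 2 u).div_const 2).sub
    ((hasDerivAt_abs_rpow u (by linarith : 1 < p)).div_const p)
  refine h1.congr_deriv ?_
  rw [force]; field_simp; simp; ring

lemma eq_of_hasDerivWithinAt_zero {s : Set ℝ} (hs : Convex ℝ s) {F : ℝ → ℝ}
    (h : ∀ x ∈ s, HasDerivWithinAt F 0 s x) {x y : ℝ} (hx : x ∈ s) (hy : y ∈ s) : F x = F y := by
  have := hs.norm_image_sub_le_of_norm_hasDerivWithin_le (f := F) (f' := fun _ => 0) (C := 0)
    (fun x hx => h x hx) (by simp) hy hx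
  simpa [sub_eq_zero] using this

namespace IsSol

variable {s t : Set ℝ} {u v u' v' : ℝ → ℝ}

lemma mono (h : IsSol p s u v) (hts : t ⊆ s) : IsSol p t u v :=
  fun x hx => ⟨(h x (hts hx)).1.mono hts, (h x (hts hx)).2.mono hts⟩

lemma continuousOn (h : IsSol p s u v) : ContinuousOn u s := fun x hx => (h x hx).1.continuousWithinAt

lemma continuousOn_deriv (h : IsSol p s u v) : ContinuousOn v s :=
  fun x hx => (h x hx).2.continuousWithinAt

lemma neg (h : IsSol p s u v) : IsSol p s (fun x => -u x) (fun x => -v x) :=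
  fun x hx => ⟨(h x hx).1.neg, by rw [force_neg]; exact (h x hx).2.neg⟩

lemma const_mul (h : IsSol p s u v) {σ : ℝ} (hσ : σ = 1 ∨ σ = -1) :
    IsSol p s (fun x => σ * u x) (fun x => σ * v x) := by
  rcases hσ with rfl | rfl
  · simpa using h
  · simpa using h.neg

lemma reflect {b : ℝ} (h : IsSol p (Icc 0 b) u v) :
    IsSol p (Icc 0 b) (fun x => u (b - x)) (fun x => -v (b - x)) := by
  intro x hx
  have hx' : b - x ∈ Icc 0 b := ⟨by linarith [hx.2], by linarith [hx.1]⟩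
  have hm : MapsTo (fun x => b - x) (Icc 0 b) (Icc 0 b) :=
    fun y hy => ⟨by linarith [hy.2], by linarith [hy.1]⟩
  have hd : HasDerivWithinAt (fun x => b - x) (-1) (Icc 0 b) x :=
    ((hasDerivAt_id x).const_sub b).hasDerivWithinAt
  refine ⟨?_, ?_⟩
  · exact ((h _ hx').1.comp x hd hm).congr_deriv (by ring)
  · exact ((h _ hx').2.comp x hd hm).neg.congr_deriv (by ring)

lemma energy_eq (hp : 2 < p) (h : IsSol p s u v) (hs : Convex ℝ s) {x y : ℝ} (hx : x ∈ s)
    (hy : y ∈ s) : energy p (u x) (v x) = energy p (u y) (v y) := by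
  refine eq_of_hasDerivWithinAt_zero (F := fun x => energy p (u x) (v x)) hs (fun z hz => ?_) hx hy
  have h1 := (((h z hz).2.pow 2).div_const 2).sub
    ((hasDerivAt_potential hp (u z)).comp_hasDerivWithinAt z (h z hz).1)
  refine (h1.congr_deriv ?_).congr_of_mem (fun y _ => ?_) hz
  · simp; ring
  · simp [energy]; ring

lemma hasDerivWithinAt_Ici {a b : ℝ} (h : IsSol p (Icc a b) u v) {t : ℝ} (ht : t ∈ Ico a b) :
    HasDerivWithinAt (fun t => (u t, v t)) (v t, force p (u t)) (Ici t) t := by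
  have hmem : Icc a b ∈ 𝓝[≥] t := Icc_mem_nhdsGE_of_mem ht
  have := h t ⟨ht.1, ht.2.le⟩
  exact (this.1.mono_of_mem_nhdsWithin hmem).prodMk (this.2.mono_of_mem_nhdsWithin hmem)

/-- A solution on a compact interval is determined by its initial data. -/
lemma eqOn_Icc (hp : 2 < p) {a b : ℝ} (h : IsSol p (Icc a b) u v) (h' : IsSol p (Icc a b) u' v')
    (hu : u a = u' a) (hv : v a = v' a) : EqOn u u' (Icc a b) ∧ EqOn v v' (Icc a b) := by
  obtain ⟨R₁, hR₁⟩ := isCompact_Icc.exists_bound_of_continuousOn h.continuousOn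
  obtain ⟨R₂, hR₂⟩ := isCompact_Icc.exists_bound_of_continuousOn h'.continuousOn
  set R := max R₁ R₂
  obtain ⟨K, hlip⟩ := exists_lipschitzOnWith_field hp R
  have key := ODE_solution_unique_of_mem_Icc_right (K := K)
    (v := fun _ z => (z.2, force p z.1)) (s := fun _ => Icc (-R) R ×ˢ univ)
    (f := fun t => (u t, v t)) (g := fun t => (u' t, v' t)) (a := a) (b := b)
    (fun _ _ => hlip) (h.continuousOn.prodMk h.continuousOn_deriv) (fun _ => h.hasDerivWithinAt_Ici)
    (fun t ht => ⟨abs_le.1 ((hR₁ t ⟨ht.1, ht.2.le⟩).trans (le_max_left _ _)), trivial⟩)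
    (h'.continuousOn.prodMk h'.continuousOn_deriv) (fun _ => h'.hasDerivWithinAt_Ici)
    (fun t ht => ⟨abs_le.1 ((hR₂ t ⟨ht.1, ht.2.le⟩).trans (le_max_right _ _)), trivial⟩)
    (by simp [hu, hv])
  exact ⟨fun x hx => congrArg Prod.fst (key hx), fun x hx => congrArg Prod.snd (key hx)⟩

lemma eqOn_Ici (hp : 2 < p) {a : ℝ} (h : IsSol p (Ici a) u v) (h' : IsSol p (Ici a) u' v')
    (hu : u a = u' a) (hv : v a = v' a) : EqOn u u' (Ici a) ∧ EqOn v v' (Ici a) := by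
  refine ⟨fun x hx => ?_, fun x hx => ?_⟩
  · exact (eqOn_Icc hp (h.mono Icc_subset_Ici_self) (h'.mono Icc_subset_Ici_self) hu hv).1
      ⟨hx, le_rfl⟩
  · exact (eqOn_Icc hp (h.mono Icc_subset_Ici_self) (h'.mono Icc_subset_Ici_self) hu hv).2
      ⟨hx, le_rfl⟩

lemma zero (p : ℝ) (s : Set ℝ) : IsSol p s (fun _ => 0) (fun _ => 0) :=
  fun x _ => ⟨hasDerivWithinAt_const _ _ _, by
    rw [force_zero]; exact hasDerivWithinAt_const _ _ _⟩

end IsSol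

end SingleKnotGraph

namespace SingleKnotGraph

/-! ### Weak derivatives on an interval starting at `0` -/

/-- `I` and `C` are the open and the closed version of an interval with left endpoint `0`. -/
structure IsEdgePair (I C : Set ℝ) : Prop where
  isOpen : IsOpen I
  ordConnected : OrdConnected I
  subset : I ⊆ C
  subset_closure : C ⊆ closure I
  convex : Convex ℝ C
  zero_mem : (0 : ℝ) ∈ C
  nonneg : ∀ x ∈ C, 0 ≤ x
  Ioo_subset : ∀ x ∈ C, Ioo 0 x ⊆ I
  exists_subset_Ioo : ∀ K ⊆ I, IsCompact K → ∃ M ∈ C, K ⊆ Ioo 0 M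
  exists_retraction : ∃ r : ℝ → ℝ, Continuous r ∧ (∀ x, r x ∈ C) ∧ ∀ x ∈ C, r x = x
  exists_nhdsWithin : ∀ x ∈ C, ∃ M ∈ C, Icc 0 M ∈ 𝓝[C] x

lemma isEdgePair_Icc {b : ℝ} (hb : 0 < b) : IsEdgePair (Ioo 0 b) (Icc 0 b) where
  isOpen := isOpen_Ioo
  ordConnected := ordConnected_Ioo
  subset := Ioo_subset_Icc_self
  subset_closure := by rw [closure_Ioo hb.ne]
  convex := convex_Icc _ _
  zero_mem := ⟨le_rfl, hb.le⟩
  nonneg := fun x hx => hx.1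
  Ioo_subset := fun x hx => Ioo_subset_Ioo_right hx.2
  exists_subset_Ioo := fun K hK _ => ⟨b, ⟨hb.le, le_rfl⟩, hK⟩
  exists_retraction := ⟨fun x => max 0 (min x b), by fun_prop,
    fun x => ⟨le_max_left _ _, max_le hb.le (min_le_right _ _)⟩,
    fun x hx => by simp [min_eq_left hx.2, max_eq_right hx.1]⟩
  exists_nhdsWithin := fun _ _ => ⟨b, ⟨hb.le, le_rfl⟩, self_mem_nhdsWithin⟩

lemma isEdgePair_Ici : IsEdgePair (Ioi 0) (Ici 0) where
  isOpen := isOpen_Ioi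
  ordConnected := ordConnected_Ioi
  subset := Ioi_subset_Ici_self
  subset_closure := by rw [closure_Ioi]
  convex := convex_Ici _
  zero_mem := self_mem_Ici
  nonneg := fun x hx => hx
  Ioo_subset := fun x _ y hy => hy.1
  exists_subset_Ioo := fun K hK hc => by
    obtain ⟨M, hM⟩ := hc.bddAbove
    refine ⟨max M 0 + 1, ?_, fun x hx => ⟨hK hx, ?_⟩⟩
    · have := le_max_right M 0
      simp only [mem_Ici]; linarith
    · have := hM hx
      have := le_max_left M 0
      linarith
  exists_retraction := ⟨fun x => max 0 x, by fun_prop, fun x => mem_Ici.2 (le_max_left _ _),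
    fun x hx => max_eq_right hx⟩
  exists_nhdsWithin := fun x hx => ⟨x + 1, by have := mem_Ici.1 hx; simp only [mem_Ici]; linarith, by
    rw [← Ici_inter_Iic]
    exact inter_mem self_mem_nhdsWithin
      (mem_nhdsWithin_of_mem_nhds (Iic_mem_nhds (by linarith)))⟩

lemma isEdgePair (G : SingleKnotGraph H P L) (e : Edge H P L) :
    IsEdgePair (G.openEdge e) (G.closedEdge e) := by
  rcases e with i | j | h
  · exact isEdgePair_Icc (G.pendantLength_pos i)
  · exact isEdgePair_Icc (G.loopLength_pos j)
  · exact isEdgePair_Ici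

/-- Integration by parts for two primitives of integrable functions. -/
lemma integral_mul_add_mul_of_primitive {F G f g : ℝ → ℝ} {b : ℝ} (hb : 0 ≤ b)
    (hf : IntervalIntegrable f volume 0 b) (hg : IntervalIntegrable g volume 0 b)
    (hF : ∀ x ∈ Icc 0 b, F x = F 0 + ∫ t in (0 : ℝ)..x, f t)
    (hG : ∀ x ∈ Icc 0 b, G x = G 0 + ∫ t in (0 : ℝ)..x, g t) :
    ∫ x in (0 : ℝ)..b, (f x * G x + F x * g x) = F b * G b - F 0 * G 0 := by
  have hac : ∀ {F f : ℝ → ℝ}, IntervalIntegrable f volume 0 b →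
      AbsolutelyContinuousOnInterval (fun x => F 0 + ∫ t in (0 : ℝ)..x, f t) 0 b := by
    intro F f hf
    have h1 : AbsolutelyContinuousOnInterval (fun _ : ℝ => F 0) 0 b :=
      ((LipschitzWith.const (F 0)).lipschitzOnWith (s := uIcc 0 b)).absolutelyContinuousOnInterval
    exact h1.add (hf.absolutelyContinuousOnInterval_intervalIntegral (by simp))
  have key := (hac (F := F) hf).integral_deriv_mul_eq_sub (hac (F := G) hg)
  rw [hF b ⟨hb, le_rfl⟩, hG b ⟨hb, le_rfl⟩]
  simp only [intervalIntegral.integral_same, add_zero] at key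
  rw [← key]
  apply intervalIntegral.integral_congr_ae
  filter_upwards [hf.ae_hasDerivAt_integral, hg.ae_hasDerivAt_integral] with x h1 h2 hx
  have hx' : x ∈ uIcc 0 b := uIoc_subset_uIcc hx
  have e1 := ((h1 hx' 0 (by simp)).const_add (F 0)).deriv
  have e2 := ((h2 hx' 0 (by simp)).const_add (G 0)).deriv
  rw [e1, e2]
  rw [uIcc_of_le hb] at hx'
  rw [← hF x hx', ← hG x hx']

lemma integrableOn_mul_of_hasCompactSupport {I : Set ℝ} {h φ : ℝ → ℝ}
    (hh : LocallyIntegrableOn h I) (hφ : Continuous φ)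
    (hc : HasCompactSupport φ) (hs : tsupport φ ⊆ I) :
    IntegrableOn (fun x => h x * φ x) I := by
  have h1 : IntegrableOn h (tsupport φ) := hh.integrableOn_compact_subset hs hc
  have h2 : IntegrableOn (fun x => h x * φ x) (tsupport φ) :=
    h1.mul_continuousOn hφ.continuousOn hc
  have h3 : Integrable (fun x => h x * φ x) :=
    (integrableOn_iff_integrable_of_support_subset
      (fun x hx => subset_tsupport φ (by
        simp only [Function.mem_support, ne_eq, mul_eq_zero, not_or] at hx
        exact hx.2))).1 h2
  exact h3.integrableOn

/-- The du Bois-Reymond lemma: a function with vanishing weak derivative on an open interval is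
almost everywhere constant. -/
lemma ae_eq_const_of_integral_mul_deriv_eq_zero {I : Set ℝ} (hI : IsOpen I) (hord : OrdConnected I)
    {h : ℝ → ℝ} (hh : LocallyIntegrableOn h I)
    (hz : ∀ ψ : ℝ → ℝ, ContDiff ℝ ∞ ψ → HasCompactSupport ψ → tsupport ψ ⊆ I →
      ∫ x in I, h x * deriv ψ x = 0) :
    ∃ c : ℝ, ∀ᵐ x, x ∈ I → h x = c := by
  rcases I.eq_empty_or_nonempty with rfl | ⟨x₀, hx₀⟩
  · exact ⟨0, by simp⟩
  obtain ⟨ε, hε, hball⟩ := Metric.isOpen_iff.1 hI x₀ hx₀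
  let bump : ContDiffBump x₀ := ⟨ε / 4, ε / 2, by positivity, by linarith⟩
  set ρ : ℝ → ℝ := bump.normed volume with hρdef
  have hρ : ContDiff ℝ ∞ ρ := bump.contDiff_normed
  have hρc : HasCompactSupport ρ := bump.hasCompactSupport_normed
  have hρs : tsupport ρ ⊆ I := by
    rw [hρdef, bump.tsupport_normed_eq]
    exact (Metric.closedBall_subset_ball (by show ε / 2 < ε; linarith)).trans hball
  have hρ1 : ∫ x, ρ x = 1 := bump.integral_normed
  set c := ∫ x in I, h x * ρ x
  refine ⟨c, ?_⟩
  have hloc : LocallyIntegrableOn (fun x => h x - c) I :=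
    hh.sub ((locallyIntegrable_const c).locallyIntegrableOn I)
  have := hI.ae_eq_zero_of_integral_contDiff_smul_eq_zero hloc (μ := volume) ?_
  · filter_upwards [this] with x hx hxI
    linarith [hx hxI]
  intro φ hφ hφc hφs
  set k := ∫ x, φ x
  -- Subtracting the right multiple of `ρ` makes the mean vanish, so the primitive of `ζ` has
  -- compact support in `I` and is an admissible test function.
  set ζ : ℝ → ℝ := fun x => φ x - k * ρ x with hζdef
  have hζ : ContDiff ℝ ∞ ζ := hφ.sub (contDiff_const.mul hρ)
  have hφi : Integrable φ := hφ.continuous.integrable_of_hasCompactSupport hφc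
  have hρi : Integrable ρ := hρ.continuous.integrable_of_hasCompactSupport hρc
  have hζ0 : ∫ x, ζ x = 0 := by
    rw [hζdef, integral_sub hφi (hρi.const_mul k), integral_const_mul, hρ1]; simp [k]
  set K := tsupport φ ∪ tsupport ρ
  have hK : IsCompact K := hφc.isCompact.union hρc.isCompact
  have hKI : K ⊆ I := union_subset hφs hρs
  have hKne : K.Nonempty := by
    refine ⟨x₀, Or.inr ?_⟩
    rw [hρdef, bump.tsupport_normed_eq]
    exact Metric.mem_closedBall_self bump.rOut_pos.le
  obtain ⟨m, hm⟩ := hK.exists_isLeast hKne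
  obtain ⟨M, hM⟩ := hK.exists_isGreatest hKne
  have hIcc : Icc m M ⊆ I := hord.out (hKI hm.1) (hKI hM.1)
  have hmM : m ≤ M := hm.2 hM.1
  have hζout : ∀ x, x ∉ Icc m M → ζ x = 0 := by
    intro x hx
    have hxK : x ∉ K := fun hxK => hx ⟨hm.2 hxK, hM.2 hxK⟩
    have h1 : φ x = 0 := image_eq_zero_of_notMem_tsupport fun h => hxK (Or.inl h)
    have h2 : ρ x = 0 := image_eq_zero_of_notMem_tsupport fun h => hxK (Or.inr h)
    simp [hζdef, h1, h2]
  have hζi : Integrable ζ := hφi.sub (hρi.const_mul k)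
  set ψ : ℝ → ℝ := fun x => ∫ t in m..x, ζ t
  have hψd : ∀ x, HasDerivAt ψ (ζ x) x := fun x =>
    (hζ.continuous.integral_hasStrictDerivAt m x).hasDerivAt
  have hψ' : deriv ψ = ζ := funext fun x => (hψd x).deriv
  have hψ : ContDiff ℝ ∞ ψ := by
    rw [contDiff_infty_iff_deriv]
    exact ⟨fun x => (hψd x).differentiableAt, by rw [hψ']; exact hζ⟩
  have hψout : ∀ x, x ∉ Icc m M → ψ x = 0 := by
    intro x hx
    rcases lt_or_ge x m with hxm | hxm
    · show ∫ t in m..x, ζ t = 0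
      rw [intervalIntegral.integral_symm, intervalIntegral.integral_of_le hxm.le,
        integral_Ioc_eq_integral_Ioo, setIntegral_eq_zero_of_forall_eq_zero, neg_zero]
      exact fun t ht => hζout t fun ht' => absurd ht.2 (not_lt.2 ht'.1)
    · have hxM : M < x := by
        by_contra hcon
        exact hx ⟨hxm, not_lt.1 hcon⟩
      have : ∫ t in m..x, ζ t = ∫ t, ζ t := by
        rw [intervalIntegral.integral_of_le hxm, ← integral_Icc_eq_integral_Ioc,
          setIntegral_eq_integral_of_forall_compl_eq_zero]
        intro t ht
        exact hζout t fun ht' => ht ⟨ht'.1, ht'.2.trans hxM.le⟩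
      show ∫ t in m..x, ζ t = 0
      rw [this, hζ0]
  have hψts : tsupport ψ ⊆ Icc m M :=
    closure_minimal (fun x hx => by_contra fun hx' => hx (hψout x hx')) isClosed_Icc
  have hψc : HasCompactSupport ψ := isCompact_Icc.of_isClosed_subset (isClosed_tsupport _) hψts
  have h0 := hz ψ hψ hψc (hψts.trans hIcc)
  rw [hψ'] at h0
  have hi1 := integrableOn_mul_of_hasCompactSupport hh hφ.continuous hφc hφs
  have hi2 := integrableOn_mul_of_hasCompactSupport hh hρ.continuous hρc hρs
  have h1 : ∫ x in I, h x * φ x = k * c := by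
    have : ∫ x in I, h x * ζ x = (∫ x in I, h x * φ x) - k * c := by
      rw [← integral_const_mul, ← integral_sub hi1 (hi2.const_mul k)]
      congr 1 with x
      simp only [hζdef]; ring
    linarith
  have h2 : ∫ x, φ x • (h x - c) = ∫ x in I, φ x • (h x - c) := by
    rw [setIntegral_eq_integral_of_forall_compl_eq_zero]
    intro x hx
    rw [image_eq_zero_of_notMem_tsupport fun h => hx (hφs h), zero_smul]
  have h3 : ∫ x in I, φ x = k :=
    setIntegral_eq_integral_of_forall_compl_eq_zero fun x hx =>
      image_eq_zero_of_notMem_tsupport fun h => hx (hφs h)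
  rw [h2]
  have h4 : ∫ x in I, φ x • (h x - c) = (∫ x in I, h x * φ x) - (∫ x in I, φ x) * c := by
    rw [← integral_mul_const, ← integral_sub hi1 (hφi.integrableOn.mul_const c)]
    congr 1 with x
    simp only [smul_eq_mul]; ring
  rw [h4, h1, h3]; ring

section

variable {I C : Set ℝ}

lemma IsEdgePair.Icc_subset (hIC : IsEdgePair I C) {x : ℝ} (hx : x ∈ C) : Icc 0 x ⊆ C := by
  have := hIC.convex.ordConnected
  exact this.out hIC.zero_mem hx

lemma intervalIntegrable_of_memLp_two {g : ℝ → ℝ} (hg : MemLp g 2 (volume.restrict I))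
    {b : ℝ} (hb : 0 ≤ b) (hsub : Ioo 0 b ⊆ I) : IntervalIntegrable g volume 0 b := by
  rw [intervalIntegrable_iff_integrableOn_Ioo_of_le hb]
  have h1 : MemLp g 2 (volume.restrict (Ioo 0 b)) :=
    hg.mono_measure (Measure.restrict_mono hsub le_rfl)
  exact h1.integrable (by norm_num)

lemma locallyIntegrableOn_of_memLp_two {g : ℝ → ℝ}
    (hg : MemLp g 2 (volume.restrict I)) : LocallyIntegrableOn g I := by
  have : LocallyIntegrable g (volume.restrict I) := hg.locallyIntegrable (by norm_num)
  exact locallyIntegrableOn_of_locallyIntegrable_restrict this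

lemma IsEdgePair.setIntegral_eq (hIC : IsEdgePair I C) {F : ℝ → ℝ} {M : ℝ} (hM : M ∈ C)
    (hF : ∀ x, x ∉ Ioo 0 M → F x = 0) : ∫ x in I, F x = ∫ x in (0 : ℝ)..M, F x := by
  rw [intervalIntegral.integral_of_le (hIC.nonneg M hM), integral_Ioc_eq_integral_Ioo]
  refine setIntegral_eq_of_subset_of_forall_sdiff_eq_zero hIC.isOpen.measurableSet
    (hIC.Ioo_subset M hM) fun x hx => hF x hx.2

lemma IsEdgePair.continuousOn_primitive (hIC : IsEdgePair I C) {f : ℝ → ℝ}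
    (hf : ∀ x ∈ C, IntervalIntegrable f volume 0 x) :
    ContinuousOn (fun x => ∫ t in (0 : ℝ)..x, f t) C := by
  intro x hx
  obtain ⟨M, hM, hMx⟩ := hIC.exists_nhdsWithin x hx
  have hM0 := hIC.nonneg M hM
  have h := intervalIntegral.continuousOn_primitive_interval (f := f) (μ := volume) (a := 0) (b := M)
    (by rw [uIcc_of_le hM0, ← intervalIntegrable_iff_integrableOn_Icc_of_le hM0]; exact hf M hM)
  rw [uIcc_of_le hM0] at h
  exact (h x (mem_of_mem_nhdsWithin hx hMx)).mono_of_mem_nhdsWithin hMx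

/-- A primitive has the expected weak derivative. -/
lemma IsEdgePair.isWeakDeriv_of_primitive (hIC : IsEdgePair I C) {F f : ℝ → ℝ}
    (hf : ∀ x ∈ C, IntervalIntegrable f volume 0 x)
    (hF : ∀ x ∈ C, F x = F 0 + ∫ t in (0 : ℝ)..x, f t) : IsWeakDeriv I F f := by
  intro ψ hψ hψc hψs
  obtain ⟨M, hM, hKM⟩ := hIC.exists_subset_Ioo _ hψs hψc
  have hM0 := hIC.nonneg M hM
  have hψ0 : ∀ x, x ∉ Ioo 0 M → ψ x = 0 := fun x hx =>
    image_eq_zero_of_notMem_tsupport fun h => hx (hKM h)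
  have hψd0 : ∀ x, x ∉ Ioo 0 M → deriv ψ x = 0 := fun x hx =>
    image_eq_zero_of_notMem_tsupport fun h => hx (hKM (tsupport_deriv_subset h))
  have hψ1 : ContDiff ℝ 1 ψ := hψ.of_le (by exact_mod_cast le_top)
  have hdc : Continuous (deriv ψ) := hψ1.continuous_deriv le_rfl
  have hsub : Icc 0 M ⊆ C := hIC.Icc_subset hM
  have key := integral_mul_add_mul_of_primitive hM0 (hf M hM) (hdc.intervalIntegrable 0 M)
    (fun x hx => hF x (hsub hx)) (G := ψ) (fun x hx => by
      rw [intervalIntegral.integral_deriv_eq_sub (fun y _ => hψ1.differentiable (by simp) y)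
        (hdc.intervalIntegrable _ _)]; ring)
  rw [hψ0 M (by simp), hψ0 0 (by simp), mul_zero, mul_zero, sub_zero] at key
  have hFc : ContinuousOn F (uIcc 0 M) := by
    rw [uIcc_of_le hM0]
    exact (((hIC.continuousOn_primitive hf).mono hsub).const_add (F 0)).congr
      fun x hx => hF x (hsub hx)
  rw [intervalIntegral.integral_add ((hf M hM).mul_continuousOn hψ.continuous.continuousOn)
    ((hdc.intervalIntegrable 0 M).continuousOn_mul hFc)] at key
  rw [hIC.setIntegral_eq hM fun x hx => by rw [hψd0 x hx, mul_zero],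
    hIC.setIntegral_eq hM fun x hx => by rw [hψ0 x hx, mul_zero]]
  linarith

/-- A continuous function with a weak derivative in `L²` is a primitive of it. -/
lemma IsEdgePair.eq_add_integral (hIC : IsEdgePair I C) {u g : ℝ → ℝ} (hu : ContinuousOn u C)
    (hg : MemLp g 2 (volume.restrict I)) (hw : IsWeakDeriv I u g) {x : ℝ} (hx : x ∈ C) :
    u x = u 0 + ∫ t in (0 : ℝ)..x, g t := by
  have hgi : ∀ x ∈ C, IntervalIntegrable g volume 0 x := fun x hx =>
    intervalIntegrable_of_memLp_two hg (hIC.nonneg x hx) (hIC.Ioo_subset x hx)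
  -- The difference `u - F` has zero weak derivative, so it is a.e. constant on `I`; continuity
  -- makes it constant on all of `C`.
  set F : ℝ → ℝ := fun x => ∫ t in (0 : ℝ)..x, g t with hFdef
  have hFw : IsWeakDeriv I F g := hIC.isWeakDeriv_of_primitive hgi fun x _ => by simp [hFdef]
  have hFc : ContinuousOn F C := hIC.continuousOn_primitive hgi
  have hli : LocallyIntegrableOn (fun x => u x - F x) I :=
    ((hu.sub hFc).mono hIC.subset).locallyIntegrableOn hIC.isOpen.measurableSet
  obtain ⟨c, hc⟩ := ae_eq_const_of_integral_mul_deriv_eq_zero hIC.isOpen hIC.ordConnected hli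
    (fun ψ hψ hψc hψs => by
      have h1 := hw ψ hψ hψc hψs
      have h2 := hFw ψ hψ hψc hψs
      have hψ1 : ContDiff ℝ 1 ψ := hψ.of_le (by exact_mod_cast le_top)
      have hi : ∀ {w : ℝ → ℝ}, ContinuousOn w C → IntegrableOn (fun x => w x * deriv ψ x) I :=
        fun hw => integrableOn_mul_of_hasCompactSupport
          ((hw.mono hIC.subset).locallyIntegrableOn hIC.isOpen.measurableSet)
          (hψ1.continuous_deriv le_rfl) hψc.deriv
          (tsupport_deriv_subset.trans hψs)
      simp only [sub_mul]
      rw [integral_sub (hi hu) (hi hFc), h1, h2, sub_self])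
  have heq : EqOn (fun x => u x - F x) (fun _ => c) I := by
    refine Measure.eqOn_open_of_ae_eq (μ := volume) ?_ hIC.isOpen
      ((hu.sub hFc).mono hIC.subset) continuousOn_const
    exact (ae_restrict_iff' hIC.isOpen.measurableSet).2 hc
  have heq' : EqOn (fun x => u x - F x) (fun _ => c) C :=
    heq.of_subset_closure (hu.sub hFc) continuousOn_const hIC.subset hIC.subset_closure
  have e1 := heq' hx
  have e2 := heq' hIC.zero_mem
  simp only [hFdef, intervalIntegral.integral_same] at e1 e2
  linarith

end

end SingleKnotGraph

namespace SingleKnotGraph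

/-! ### Regularity of bound-states -/

variable {p : ℝ} {H P L : ℕ} {I C : Set ℝ}

lemma IsEdgePair.eq_add_integral_of_hasDerivWithinAt (hIC : IsEdgePair I C) {u v : ℝ → ℝ}
    (hu : ∀ x ∈ C, HasDerivWithinAt u (v x) C x) (hv : ContinuousOn v C) {x : ℝ} (hx : x ∈ C) :
    u x = u 0 + ∫ t in (0 : ℝ)..x, v t := by
  have hsub := hIC.Icc_subset hx
  have hx0 := hIC.nonneg x hx
  have hc : ContinuousOn u C := fun y hy => (hu y hy).continuousWithinAt
  rw [intervalIntegral.integral_eq_sub_of_hasDerivAt_of_le hx0 (hc.mono hsub) (fun y hy => ?_)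
    ((hv.mono hsub).intervalIntegrable_of_Icc hx0)]
  · ring
  · have hyI := hIC.Ioo_subset x hx hy
    exact (hu y (hIC.subset hyI)).hasDerivAt
      (mem_of_superset (hIC.isOpen.mem_nhds hyI) hIC.subset)

lemma IsEdgePair.intervalIntegrable_of_continuousOn (hIC : IsEdgePair I C) {v : ℝ → ℝ}
    (hv : ContinuousOn v C) {x : ℝ} (hx : x ∈ C) : IntervalIntegrable v volume 0 x :=
  (hv.mono (hIC.Icc_subset hx)).intervalIntegrable_of_Icc (hIC.nonneg x hx)

lemma IsEdgePair.isWeakDeriv_of_hasDerivWithinAt (hIC : IsEdgePair I C) {u v : ℝ → ℝ}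
    (hu : ∀ x ∈ C, HasDerivWithinAt u (v x) C x) (hv : ContinuousOn v C) : IsWeakDeriv I u v :=
  hIC.isWeakDeriv_of_primitive (fun _ hx => hIC.intervalIntegrable_of_continuousOn hv hx)
    fun _ hx => hIC.eq_add_integral_of_hasDerivWithinAt hu hv hx

/-- A weak solution on an edge is a classical solution up to the endpoints. -/
lemma IsEdgePair.exists_isSol (hp : 2 < p) (hIC : IsEdgePair I C) {u g : ℝ → ℝ}
    (hu : ContinuousOn u C) (hg : MemLp g 2 (volume.restrict I)) (hw : IsWeakDeriv I u g)
    (heq : ∀ ψ : ℝ → ℝ, ContDiff ℝ ∞ ψ → HasCompactSupport ψ → tsupport ψ ⊆ I →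
      ∫ x in I, (g x * deriv ψ x + u x * ψ x - |u x| ^ (p - 2) * u x * ψ x) = 0) :
    ∃ v, IsSol p C u v ∧ g =ᵐ[volume.restrict I] v := by
  -- Composing with a retraction onto `C` extends the right-hand side continuously to the whole
  -- line, so its primitive `W` is differentiable at the endpoints too.
  obtain ⟨r, hr, hrC, hreq⟩ := hIC.exists_retraction
  set w : ℝ → ℝ := fun x => force p (u (r x)) with hwdef
  have huc : Continuous fun x => u (r x) := hu.comp_continuous hr hrC
  have hwc : Continuous w := (continuous_force hp).comp huc
  set W : ℝ → ℝ := fun x => ∫ t in (0 : ℝ)..x, w t with hWdef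
  have hWd : ∀ x, HasDerivAt W (w x) x := fun x => (hwc.integral_hasStrictDerivAt 0 x).hasDerivAt
  have hWc : Continuous W := continuous_iff_continuousAt.2 fun x => (hWd x).continuousAt
  have hWw : IsWeakDeriv I W w :=
    hIC.isWeakDeriv_of_hasDerivWithinAt (fun x _ => (hWd x).hasDerivWithinAt) hwc.continuousOn
  have hgl := locallyIntegrableOn_of_memLp_two hg
  have hWl := hWc.locallyIntegrable.locallyIntegrableOn (μ := volume) I
  -- The weak equation says that `g` and `W` have the same weak derivative.
  obtain ⟨c, hc⟩ := ae_eq_const_of_integral_mul_deriv_eq_zero hIC.isOpen hIC.ordConnected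
    (hgl.sub hWl)
    (fun ψ hψ hψc hψs => by
      have h1 := heq ψ hψ hψc hψs
      have h2 := hWw ψ hψ hψc hψs
      have hψ1 : ContDiff ℝ 1 ψ := hψ.of_le (by exact_mod_cast le_top)
      have hd : ∀ {w : ℝ → ℝ}, LocallyIntegrableOn w I →
          IntegrableOn (fun x => w x * deriv ψ x) I :=
        fun hw => integrableOn_mul_of_hasCompactSupport hw
          (hψ1.continuous_deriv le_rfl) hψc.deriv (tsupport_deriv_subset.trans hψs)
      have h3 : ∫ x in I, (g x * deriv ψ x + u x * ψ x - |u x| ^ (p - 2) * u x * ψ x)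
          = (∫ x in I, g x * deriv ψ x) + ∫ x in I, w x * ψ x := by
        rw [← integral_add (hd hgl) (integrableOn_mul_of_hasCompactSupport
          (hwc.locallyIntegrable.locallyIntegrableOn I) hψ.continuous hψc hψs)]
        refine setIntegral_congr_fun hIC.isOpen.measurableSet fun x hx => ?_
        simp only [hwdef, hreq x (hIC.subset hx), force]
        ring
      show ∫ x in I, (g x - W x) * deriv ψ x = 0
      simp only [sub_mul]
      rw [integral_sub (hd hgl) (hd hWl)]
      linarith)
  set v : ℝ → ℝ := fun x => W x + c with hvdef
  have hvc : Continuous v := hWc.add continuous_const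
  have hae : g =ᵐ[volume.restrict I] v := by
    refine (ae_restrict_iff' hIC.isOpen.measurableSet).2 (hc.mono fun x hx hxI => ?_)
    have := hx hxI
    simp only [hvdef]
    simp only [Pi.sub_apply] at this
    linarith
  refine ⟨v, fun x hx => ⟨?_, ?_⟩, hae⟩
  · have hprim : ∀ y ∈ C, u y = u 0 + ∫ t in (0 : ℝ)..y, v t := by
      intro y hy
      rw [hIC.eq_add_integral hu hg hw hy]
      congr 1
      rw [intervalIntegral.integral_of_le (hIC.nonneg y hy),
        intervalIntegral.integral_of_le (hIC.nonneg y hy), integral_Ioc_eq_integral_Ioo,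
        integral_Ioc_eq_integral_Ioo]
      exact integral_congr_ae (ae_restrict_of_ae_restrict_of_subset (hIC.Ioo_subset y hy) hae)
    have hd : HasDerivAt (fun y => u 0 + ∫ t in (0 : ℝ)..y, v t) (v x) x :=
      ((hvc.integral_hasStrictDerivAt 0 x).hasDerivAt).const_add _
    exact hd.hasDerivWithinAt.congr_of_mem hprim hx
  · have hd : HasDerivAt v (w x) x := (hWd x).add_const c
    have : w x = force p (u x) := by simp only [hwdef, hreq x hx]
    rw [← this]
    exact hd.hasDerivWithinAt

/-- A smooth function with compact support in an open edge, extended by zero to the graph. -/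
noncomputable def testFunction (G : SingleKnotGraph H P L) (e : Edge H P L) (ψ : ℝ → ℝ)
    (hψ : ContDiff ℝ ∞ ψ) (hψc : HasCompactSupport ψ) (hψs : tsupport ψ ⊆ G.openEdge e) :
    H1Function G where
  toFun e' := if e' = e then ψ else 0
  deriv e' := if e' = e then _root_.deriv ψ else 0
  continuousOn e' := by
    split_ifs
    · exact hψ.continuous.continuousOn
    · exact continuousOn_const
  continuous_vertex := by
    have h0 : ∀ x, x ∉ G.openEdge e → ψ x = 0 := fun x hx =>
      image_eq_zero_of_notMem_tsupport fun h => hx (hψs h)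
    refine ⟨0, fun e' => ?_, fun j => ?_⟩
    · split_ifs
      · refine h0 0 ?_
        rcases e with i | j | h <;> simp [openEdge]
      · rfl
    · split_ifs with h
      · subst h
        exact h0 _ (by simp [openEdge])
      · rfl
  memLp e' := by
    split_ifs
    · exact (hψ.continuous.memLp_of_hasCompactSupport hψc).restrict _
    · exact MemLp.zero'
  deriv_memLp e' := by
    have hψ1 : ContDiff ℝ 1 ψ := hψ.of_le (by exact_mod_cast le_top)
    split_ifs
    · exact ((hψ1.continuous_deriv le_rfl).memLp_of_hasCompactSupport hψc.deriv).restrict _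
    · exact MemLp.zero'
  isWeakDeriv e' := by
    have hψ1 : ContDiff ℝ 1 ψ := hψ.of_le (by exact_mod_cast le_top)
    split_ifs
    · exact (isEdgePair G e').isWeakDeriv_of_hasDerivWithinAt
        (fun x _ => (hψ1.differentiable (by simp) x).hasDerivAt.hasDerivWithinAt)
        (hψ1.continuous_deriv le_rfl).continuousOn
    · intro ψ _ _ _
      simp

variable {G : SingleKnotGraph H P L}

/-- `v` is the classical derivative of the solution `u` on every edge. -/
def IsClassical (p : ℝ) (u : H1Function G) (v : Edge H P L → ℝ → ℝ) : Prop :=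
  ∀ e, IsSol p (G.closedEdge e) (u.toFun e) (v e) ∧
    u.deriv e =ᵐ[volume.restrict (G.openEdge e)] v e

/-- Test functions supported inside one edge decouple the edges. What the weak equation says at the
vertex and the tips is extracted separately, in `IsBoundState.vertex_conditions`. -/
lemma IsBoundState.exists_isClassical (hp : 2 < p) {u : H1Function G} (hu : IsBoundState p u) :
    ∃ v, IsClassical p u v := by
  have : ∀ e, ∃ v, IsSol p (G.closedEdge e) (u.toFun e) v ∧
      u.deriv e =ᵐ[volume.restrict (G.openEdge e)] v := by
    intro e
    refine (isEdgePair G e).exists_isSol hp (u.continuousOn e) (u.deriv_memLp e)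
      (u.isWeakDeriv e) fun ψ hψ hψc hψs => ?_
    have h := hu.2 (testFunction G e ψ hψ hψc hψs)
    rw [SingleKnotGraph.integral, Finset.sum_eq_single e] at h
    · simpa [testFunction] using h
    · intro e' _ he'
      simp [testFunction, he']
    · simp
  choose v hv using this
  exact ⟨v, hv⟩

/-! ### Solutions in `H¹` of a half-line -/

lemma exists_bound_of_tendsto {u : ℝ → ℝ} (hu : ContinuousOn u (Ici 0))
    (ht : Tendsto u atTop (𝓝 0)) : ∃ B, 0 ≤ B ∧ ∀ x ∈ Ici (0 : ℝ), |u x| ≤ B := by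
  obtain ⟨N, hN⟩ := eventually_atTop.1 (ht.eventually (Metric.ball_mem_nhds 0 one_pos))
  obtain ⟨B, hB⟩ := (isCompact_Icc (a := 0) (b := N)).exists_bound_of_continuousOn
    (hu.mono Icc_subset_Ici_self)
  refine ⟨max B 1, zero_le_one.trans (le_max_right _ _), fun x hx => ?_⟩
  rcases le_total x N with h | h
  · exact (hB x ⟨hx, h⟩).trans (le_max_left _ _)
  · have := hN x h
    rw [dist_zero_right] at this
    exact this.le.trans (le_max_right _ _)

namespace IsSol

variable {u v η η' : ℝ → ℝ}

/-- Both `u ^ 2` and its derivative `2 u v` are integrable. -/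
lemma tendsto_zero (h : IsSol p (Ici 0) u v) (hu : MemLp u 2 (volume.restrict (Ioi 0)))
    (hv : MemLp v 2 (volume.restrict (Ioi 0))) : Tendsto u atTop (𝓝 0) := by
  have hd : ∀ x ∈ Ioi (0 : ℝ), HasDerivAt (fun x => u x ^ 2) (2 * (u x * v x)) x := by
    intro x hx
    have := ((h x (Ioi_subset_Ici_self hx)).1.hasDerivAt (Ici_mem_nhds hx)).pow 2
    exact this.congr_deriv (by simp; ring)
  have h1 : Integrable (fun x => 2 * (u x * v x)) (volume.restrict (Ioi 0)) :=
    (hu.integrable_mul hv).const_mul 2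
  have h2 := tendsto_zero_of_hasDerivAt_of_integrableOn_Ioi hd h1 hu.integrable_sq
  have h3 : Tendsto (fun x => |u x|) atTop (𝓝 0) := by
    have := (Real.continuous_sqrt.tendsto 0).comp h2
    simpa [Function.comp_def, Real.sqrt_sq_eq_abs] using this
  exact tendsto_zero_iff_abs_tendsto_zero _ |>.2 h3

lemma integrableOn_rpow_Ioi (hp : 2 < p) (h : IsSol p (Ici 0) u v)
    (hu : MemLp u 2 (volume.restrict (Ioi 0))) (hv : MemLp v 2 (volume.restrict (Ioi 0))) :
    IntegrableOn (fun x => |u x| ^ p) (Ioi 0) := by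
  obtain ⟨B, hB0, hB⟩ := exists_bound_of_tendsto h.continuousOn (h.tendsto_zero hu hv)
  refine Integrable.mono' (hu.integrable_sq.const_mul (B ^ (p - 2)))
    ((continuous_abs_rpow (by linarith)).comp_aestronglyMeasurable hu.aestronglyMeasurable) ?_
  refine (ae_restrict_iff' measurableSet_Ioi).2 (Eventually.of_forall fun x hx => ?_)
  rw [Real.norm_of_nonneg (by positivity), ← abs_rpow_sub_two_mul_sq hp, mul_assoc, ← sq]
  gcongr
  exact hB x (Ioi_subset_Ici_self hx)

lemma memLp_force (hp : 2 < p) (h : IsSol p (Ici 0) u v)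
    (hu : MemLp u 2 (volume.restrict (Ioi 0))) (hv : MemLp v 2 (volume.restrict (Ioi 0))) :
    MemLp (fun x => force p (u x)) 2 (volume.restrict (Ioi 0)) := by
  obtain ⟨B, hB0, hB⟩ := exists_bound_of_tendsto h.continuousOn (h.tendsto_zero hu hv)
  refine hu.of_le_mul (c := 1 + B ^ (p - 2))
    ((continuous_force hp).comp_aestronglyMeasurable hu.aestronglyMeasurable) ?_
  refine (ae_restrict_iff' measurableSet_Ioi).2 (Eventually.of_forall fun x hx => ?_)
  have h1 : |u x| ^ (p - 2) ≤ B ^ (p - 2) := by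
    gcongr
    exact hB x (Ioi_subset_Ici_self hx)
  calc ‖force p (u x)‖ ≤ ‖u x‖ + ‖|u x| ^ (p - 2) * u x‖ := norm_sub_le _ _
    _ = (1 + |u x| ^ (p - 2)) * ‖u x‖ := by
        rw [norm_mul, Real.norm_of_nonneg (by positivity : (0 : ℝ) ≤ |u x| ^ (p - 2))]; ring
    _ ≤ _ := by gcongr

/-- The energy of a solution in `H¹` of a half-line vanishes. -/
lemma energy_eq_zero (hp : 2 < p) (h : IsSol p (Ici 0) u v)
    (hu : MemLp u 2 (volume.restrict (Ioi 0))) (hv : MemLp v 2 (volume.restrict (Ioi 0))) :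
    energy p (u 0) (v 0) = 0 := by
  -- The energy is constant along the solution, and an integrable constant on a set of infinite
  -- measure is zero.
  have hi : Integrable (fun x => energy p (u x) (v x)) (volume.restrict (Ioi 0)) :=
    ((hv.integrable_sq.div_const 2).sub (hu.integrable_sq.div_const 2)).add
      ((h.integrableOn_rpow_Ioi hp hu hv).div_const p)
  have hi' : IntegrableOn (fun _ : ℝ => energy p (u 0) (v 0)) (Ioi 0) := by
    refine IntegrableOn.congr_fun hi (fun x hx => ?_) measurableSet_Ioi
    exact h.energy_eq hp (convex_Ici 0) (Ioi_subset_Ici_self hx) self_mem_Ici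
  rw [integrableOn_const_iff] at hi'
  simpa using hi'

lemma integral_Ioo_eq_boundary (hp : 2 < p) {b : ℝ} (hb : 0 < b) (h : IsSol p (Icc 0 b) u v)
    (hη' : MemLp η' 2 (volume.restrict (Ioo 0 b)))
    (hη : ∀ x ∈ Icc 0 b, η x = η 0 + ∫ t in (0 : ℝ)..x, η' t) :
    ∫ x in Ioo 0 b, (v x * η' x + force p (u x) * η x) = v b * η b - v 0 * η 0 := by
  have hIC := isEdgePair_Icc hb
  have hf : ContinuousOn (fun x => force p (u x)) (Icc 0 b) :=
    (continuous_force hp).comp_continuousOn h.continuousOn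
  have hbm : b ∈ Icc 0 b := ⟨hb.le, le_rfl⟩
  rw [← integral_Ioc_eq_integral_Ioo, ← intervalIntegral.integral_of_le hb.le,
    ← integral_mul_add_mul_of_primitive hb.le
    (hIC.intervalIntegrable_of_continuousOn hf hbm)
    (intervalIntegrable_of_memLp_two hη' hb.le Subset.rfl)
    (fun x hx => hIC.eq_add_integral_of_hasDerivWithinAt (fun y hy => (h y hy).2) hf hx) hη]
  exact intervalIntegral.integral_congr fun x _ => add_comm _ _

/-- No boundary term survives at infinity: `v b * η b` converges because the integrals over `(0, b)`
do, and its limit is zero because the product is integrable. -/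
lemma integral_Ioi_eq_boundary (hp : 2 < p) (h : IsSol p (Ici 0) u v)
    (hu : MemLp u 2 (volume.restrict (Ioi 0))) (hv : MemLp v 2 (volume.restrict (Ioi 0)))
    (hηL : MemLp η 2 (volume.restrict (Ioi 0))) (hη' : MemLp η' 2 (volume.restrict (Ioi 0)))
    (hη : ∀ x ∈ Ici (0 : ℝ), η x = η 0 + ∫ t in (0 : ℝ)..x, η' t) :
    ∫ x in Ioi 0, (v x * η' x + force p (u x) * η x) = -(v 0 * η 0) := by
  have hi : IntegrableOn (fun x => v x * η' x + force p (u x) * η x) (Ioi 0) :=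
    (hv.integrable_mul hη').add ((h.memLp_force hp hu hv).integrable_mul hηL)
  have hlim : Tendsto (fun b => v b * η b - v 0 * η 0) atTop
      (𝓝 (∫ x in Ioi 0, (v x * η' x + force p (u x) * η x))) := by
    refine (intervalIntegral_tendsto_integral_Ioi 0 hi tendsto_id).congr' ?_
    filter_upwards [Ioi_mem_atTop 0] with b hb
    rw [← (h.mono (fun x hx => hx.1 : Icc 0 b ⊆ Ici 0)).integral_Ioo_eq_boundary hp hb
      (hη'.mono_measure (Measure.restrict_mono Ioo_subset_Ioi_self le_rfl))
      (fun x hx => hη x hx.1), id, intervalIntegral.integral_of_le (le_of_lt hb),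
      integral_Ioc_eq_integral_Ioo]
  have hlim' : Tendsto (fun b => v b * η b) atTop
      (𝓝 ((∫ x in Ioi 0, (v x * η' x + force p (u x) * η x)) + v 0 * η 0)) := by
    simpa using hlim.add_const (v 0 * η 0)
  have hint : IntegrableAtFilter (fun b => v b * η b) atTop volume :=
    ⟨Ioi 0, Ioi_mem_atTop 0, hv.integrable_mul hηL⟩
  have := hint.eq_zero_of_tendsto (fun s hs => by
    rcases mem_atTop_sets.1 hs with ⟨b, hb⟩
    rw [← top_le_iff, ← Real.volume_Ici (a := b)]
    exact measure_mono hb) hlim'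
  linarith

end IsSol

/-! ### The boundary form of the weak equation -/

lemma H1Function.eq_add_integral (η : H1Function G) (e : Edge H P L) {x : ℝ}
    (hx : x ∈ G.closedEdge e) : η.toFun e x = η.toFun e 0 + ∫ t in (0 : ℝ)..x, η.deriv e t :=
  (isEdgePair G e).eq_add_integral (η.continuousOn e) (η.deriv_memLp e) (η.isWeakDeriv e) hx

lemma IsClassical.memLp {u : H1Function G} {v : Edge H P L → ℝ → ℝ} (h : IsClassical p u v)
    (e : Edge H P L) : MemLp (v e) 2 (volume.restrict (G.openEdge e)) :=
  (memLp_congr_ae (h e).2).1 (u.deriv_memLp e)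

/-- The weak form of the equation at a classical solution only sees the vertices. -/
lemma IsClassical.integral_eq (hp : 2 < p) {u : H1Function G} {v : Edge H P L → ℝ → ℝ}
    (h : IsClassical p u v) (η : H1Function G) :
    G.integral (fun e x => u.deriv e x * η.deriv e x + u.toFun e x * η.toFun e x
      - |u.toFun e x| ^ (p - 2) * u.toFun e x * η.toFun e x) =
    (∑ i, (v (pendant i) (G.pendantLength i) * η.toFun (pendant i) (G.pendantLength i)
        - v (pendant i) 0 * η.toFun (pendant i) 0)) +
    ((∑ j, (v (loop j) (G.loopLength j) * η.toFun (loop j) (G.loopLength j)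
        - v (loop j) 0 * η.toFun (loop j) 0)) +
      ∑ k, -(v (halfLine k) 0 * η.toFun (halfLine k) 0)) := by
  have hcongr : ∀ e, ∫ x in G.openEdge e, (u.deriv e x * η.deriv e x + u.toFun e x * η.toFun e x
      - |u.toFun e x| ^ (p - 2) * u.toFun e x * η.toFun e x) =
      ∫ x in G.openEdge e, (v e x * η.deriv e x + force p (u.toFun e x) * η.toFun e x) := by
    intro e
    refine integral_congr_ae ((h e).2.mono fun x hx => ?_)
    simp only [hx, force]
    ring
  rw [SingleKnotGraph.integral]
  simp only [hcongr, Fintype.sum_sum_type]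
  congr 1
  · refine Finset.sum_congr rfl fun i _ => ?_
    exact (h (pendant i)).1.integral_Ioo_eq_boundary hp (G.pendantLength_pos i)
      (η.deriv_memLp (pendant i)) fun x hx => η.eq_add_integral (pendant i) hx
  congr 1
  · refine Finset.sum_congr rfl fun j _ => ?_
    exact (h (loop j)).1.integral_Ioo_eq_boundary hp (G.loopLength_pos j)
      (η.deriv_memLp (loop j)) fun x hx => η.eq_add_integral (loop j) hx
  · refine Finset.sum_congr rfl fun k _ => ?_
    exact (h (halfLine k)).1.integral_Ioi_eq_boundary hp (u.memLp (halfLine k))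
      (h.memLp (halfLine k)) (η.memLp (halfLine k)) (η.deriv_memLp (halfLine k))
      fun x hx => η.eq_add_integral (halfLine k) hx

end SingleKnotGraph

namespace SingleKnotGraph

/-! ### The soliton -/

/-- The maximum of the soliton. -/
noncomputable def amplitude (p : ℝ) : ℝ := (p / 2) ^ (1 / (p - 2))

/-- The even positive homoclinic solution of `u'' = u - |u|^(p-2) u`. -/
noncomputable def soliton (p x : ℝ) : ℝ :=
  amplitude p * Real.cosh ((p - 2) / 2 * x) ^ (-(2 / (p - 2)))

/-- The derivative of the soliton. -/
noncomputable def solitonDeriv (p x : ℝ) : ℝ :=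
  -(soliton p x * (Real.sinh ((p - 2) / 2 * x) / Real.cosh ((p - 2) / 2 * x)))

variable {p : ℝ}

lemma amplitude_pos (hp : 2 < p) : 0 < amplitude p := Real.rpow_pos_of_pos (by linarith) _

lemma amplitude_rpow (hp : 2 < p) : amplitude p ^ (p - 2) = p / 2 := by
  rw [amplitude, ← Real.rpow_mul (by linarith), one_div, inv_mul_cancel₀ (by linarith), Real.rpow_one]

lemma one_lt_amplitude (hp : 2 < p) : 1 < amplitude p :=
  Real.one_lt_rpow (by linarith) (by apply one_div_pos.2; linarith)

lemma soliton_pos (hp : 2 < p) (x : ℝ) : 0 < soliton p x :=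
  mul_pos (amplitude_pos hp) (Real.rpow_pos_of_pos (Real.cosh_pos _) _)

lemma soliton_neg (p x : ℝ) : soliton p (-x) = soliton p x := by simp [soliton]

lemma solitonDeriv_neg (p x : ℝ) : solitonDeriv p (-x) = -solitonDeriv p x := by
  simp [solitonDeriv, soliton_neg, neg_div]

lemma soliton_zero (p : ℝ) : soliton p 0 = amplitude p := by simp [soliton]

lemma solitonDeriv_zero (p : ℝ) : solitonDeriv p 0 = 0 := by simp [solitonDeriv]

lemma solitonDeriv_neg_of_pos (hp : 2 < p) {x : ℝ} (hx : 0 < x) : solitonDeriv p x < 0 := by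
  have : 0 < (p - 2) / 2 * x := by have : 0 < p - 2 := by linarith
                                   positivity
  have h1 := Real.sinh_pos_iff.2 this
  have h2 := soliton_pos hp x
  have h3 := Real.cosh_pos ((p - 2) / 2 * x)
  rw [solitonDeriv, neg_lt_zero]
  positivity

lemma soliton_rpow (hp : 2 < p) (x : ℝ) :
    soliton p x ^ (p - 2) = p / 2 / Real.cosh ((p - 2) / 2 * x) ^ 2 := by
  rw [soliton, Real.mul_rpow (amplitude_pos hp).le (Real.rpow_nonneg (Real.cosh_pos _).le _),
    amplitude_rpow hp, ← Real.rpow_mul (Real.cosh_pos _).le]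
  have : -(2 / (p - 2)) * (p - 2) = -2 := by
    have : p - 2 ≠ 0 := by linarith
    field_simp
  rw [this, Real.rpow_neg (Real.cosh_pos _).le, div_eq_mul_inv (p / 2), Real.rpow_two]

lemma hasDerivAt_soliton (hp : 2 < p) (x : ℝ) : HasDerivAt (soliton p) (solitonDeriv p x) x := by
  have hc := Real.cosh_pos ((p - 2) / 2 * x)
  have h1 : HasDerivAt (fun x => Real.cosh ((p - 2) / 2 * x))
      (Real.sinh ((p - 2) / 2 * x) * ((p - 2) / 2)) x := by
    simpa using ((hasDerivAt_id x).const_mul ((p - 2) / 2)).cosh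
  have h2 := (h1.rpow_const (p := -(2 / (p - 2))) (Or.inl hc.ne')).const_mul (amplitude p)
  refine h2.congr_deriv ?_
  rw [solitonDeriv, soliton, Real.rpow_sub_one hc.ne']
  have : p - 2 ≠ 0 := by linarith
  field_simp

lemma hasDerivAt_solitonDeriv (hp : 2 < p) (x : ℝ) :
    HasDerivAt (solitonDeriv p) (force p (soliton p x)) x := by
  have hc := Real.cosh_pos ((p - 2) / 2 * x)
  have h1 : HasDerivAt (fun x => Real.cosh ((p - 2) / 2 * x))
      (Real.sinh ((p - 2) / 2 * x) * ((p - 2) / 2)) x := by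
    simpa using ((hasDerivAt_id x).const_mul ((p - 2) / 2)).cosh
  have h2 : HasDerivAt (fun x => Real.sinh ((p - 2) / 2 * x))
      (Real.cosh ((p - 2) / 2 * x) * ((p - 2) / 2)) x := by
    simpa using ((hasDerivAt_id x).const_mul ((p - 2) / 2)).sinh
  have h3 := ((hasDerivAt_soliton hp x).mul (h2.div h1 hc.ne')).neg
  refine h3.congr_deriv ?_
  have hs : Real.sinh ((p - 2) / 2 * x) ^ 2 = Real.cosh ((p - 2) / 2 * x) ^ 2 - 1 := by
    rw [Real.cosh_sq]; ring
  simp only [Pi.div_apply]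
  generalize hS : Real.sinh ((p - 2) / 2 * x) = S at *
  rw [force, abs_of_pos (soliton_pos hp x), soliton_rpow hp, solitonDeriv, hS]
  generalize Real.cosh ((p - 2) / 2 * x) = c at *
  field_simp
  linear_combination soliton p x * p * hs

lemma isSol_soliton (hp : 2 < p) (t : ℝ) (s : Set ℝ) :
    IsSol p s (fun x => soliton p (x + t)) (fun x => solitonDeriv p (x + t)) := fun x _ =>
  ⟨((hasDerivAt_soliton hp (x + t)).comp_add_const x t).hasDerivWithinAt,
    ((hasDerivAt_solitonDeriv hp (x + t)).comp_add_const x t).hasDerivWithinAt⟩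

lemma continuous_soliton (hp : 2 < p) : Continuous (soliton p) :=
  continuous_iff_continuousAt.2 fun x => (hasDerivAt_soliton hp x).continuousAt

lemma continuous_solitonDeriv (hp : 2 < p) : Continuous (solitonDeriv p) :=
  continuous_iff_continuousAt.2 fun x => (hasDerivAt_solitonDeriv hp x).continuousAt

lemma abs_solitonDeriv_le (hp : 2 < p) (x : ℝ) : |solitonDeriv p x| ≤ soliton p x := by
  rw [solitonDeriv, abs_neg, abs_mul, abs_of_pos (soliton_pos hp x), ← Real.tanh_eq_sinh_div_cosh]
  exact mul_le_of_le_one_right (soliton_pos hp x).le (Real.abs_tanh_lt_one _).le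

lemma soliton_antitoneOn (hp : 2 < p) : AntitoneOn (soliton p) (Ici 0) := by
  refine antitoneOn_of_deriv_nonpos (convex_Ici 0) (continuous_soliton hp).continuousOn
    (fun x _ => (hasDerivAt_soliton hp x).differentiableAt.differentiableWithinAt) fun x hx => ?_
  rw [interior_Ici] at hx
  rw [(hasDerivAt_soliton hp x).deriv]
  exact (solitonDeriv_neg_of_pos hp hx).le

lemma soliton_le_exp (hp : 2 < p) :
    ∃ K : ℝ, ∀ x, soliton p x ≤ K * Real.exp (-x) := by
  refine ⟨amplitude p * 2⁻¹ ^ (-(2 / (p - 2))), fun x => ?_⟩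
  have h1 : Real.exp ((p - 2) / 2 * x) * 2⁻¹ ≤ Real.cosh ((p - 2) / 2 * x) := by
    rw [Real.cosh_eq]
    have := Real.exp_pos (-((p - 2) / 2 * x))
    linarith
  have h2 : Real.cosh ((p - 2) / 2 * x) ^ (-(2 / (p - 2))) ≤
      (Real.exp ((p - 2) / 2 * x) * 2⁻¹) ^ (-(2 / (p - 2))) := by
    refine Real.rpow_le_rpow_of_nonpos (by positivity) h1 ?_
    have : 0 < 2 / (p - 2) := by apply div_pos <;> linarith
    linarith
  rw [Real.mul_rpow (Real.exp_pos _).le (by norm_num), ← Real.exp_mul] at h2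
  have h3 : (p - 2) / 2 * x * -(2 / (p - 2)) = -x := by
    have : p - 2 ≠ 0 := by linarith
    field_simp
  rw [h3] at h2
  calc soliton p x ≤ amplitude p * (Real.exp (-x) * 2⁻¹ ^ (-(2 / (p - 2)))) :=
        mul_le_mul_of_nonneg_left h2 (amplitude_pos hp).le
    _ = _ := by ring

lemma memLp_two_of_le_exp {f : ℝ → ℝ} (hf : Continuous f) {K : ℝ}
    (h : ∀ x, |f x| ≤ K * Real.exp (-x)) : MemLp f 2 (volume.restrict (Ioi 0)) := by
  rw [memLp_two_iff_integrable_sq hf.aestronglyMeasurable]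
  refine Integrable.mono' ((exp_neg_integrableOn_Ioi 0 (b := 2) (by norm_num)).const_mul (K ^ 2))
    (hf.pow 2).aestronglyMeasurable (Eventually.of_forall fun x => ?_)
  rw [Real.norm_of_nonneg (sq_nonneg _), ← sq_abs]
  calc |f x| ^ 2 ≤ (K * Real.exp (-x)) ^ 2 := by gcongr; exact h x
    _ = K ^ 2 * Real.exp (-2 * x) := by rw [mul_pow, ← Real.exp_nat_mul]; congr 2; push_cast; ring

lemma memLp_soliton (hp : 2 < p) (t : ℝ) :
    MemLp (fun x => soliton p (x + t)) 2 (volume.restrict (Ioi 0)) := by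
  obtain ⟨K, hK⟩ := soliton_le_exp hp
  refine memLp_two_of_le_exp (K := K * Real.exp (-t))
    ((continuous_soliton hp).comp (continuous_add_const t)) fun x => ?_
  rw [abs_of_pos (soliton_pos hp _), mul_assoc, ← Real.exp_add]
  convert hK (x + t) using 3
  ring

lemma memLp_solitonDeriv (hp : 2 < p) (t : ℝ) :
    MemLp (fun x => solitonDeriv p (x + t)) 2 (volume.restrict (Ioi 0)) :=
  (memLp_soliton hp t).mono
    ((continuous_solitonDeriv hp).comp (continuous_add_const t)).aestronglyMeasurable
    (Eventually.of_forall fun _ => (abs_solitonDeriv_le hp _).trans (le_abs_self _))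

lemma tendsto_soliton (hp : 2 < p) : Tendsto (soliton p) atTop (𝓝 0) := by
  obtain ⟨K, hK⟩ := soliton_le_exp hp
  refine squeeze_zero (fun x => (soliton_pos hp x).le) hK ?_
  simpa using (Real.tendsto_exp_neg_atTop_nhds_zero).const_mul K

lemma soliton_energy (hp : 2 < p) (t : ℝ) : energy p (soliton p t) (solitonDeriv p t) = 0 := by
  simpa using (isSol_soliton hp t (Ici 0)).energy_eq_zero hp (memLp_soliton hp t)
    (memLp_solitonDeriv hp t)

/-- The integral of the `p`-th power of the soliton over `(t, ∞)`. -/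
noncomputable def solitonMass (p t : ℝ) : ℝ := ∫ x in Ioi 0, |soliton p (x + t)| ^ p

lemma continuous_abs_soliton_rpow (hp : 2 < p) : Continuous fun x => |soliton p x| ^ p :=
  (continuous_abs_rpow (by linarith)).comp (continuous_soliton hp)

lemma solitonMass_eq (hp : 2 < p) (t : ℝ) :
    solitonMass p t = solitonMass p 0 - ∫ x in (0 : ℝ)..t, |soliton p x| ^ p := by
  have hc := continuous_abs_soliton_rpow hp
  have hi : ∀ t, Tendsto (fun N => ∫ x in (0 : ℝ)..N, |soliton p (x + t)| ^ p) atTop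
      (𝓝 (solitonMass p t)) := fun t => intervalIntegral_tendsto_integral_Ioi 0
    ((isSol_soliton hp t _).integrableOn_rpow_Ioi hp (memLp_soliton hp t) (memLp_solitonDeriv hp t))
    tendsto_id
  have h0 := ((hi 0).comp (tendsto_atTop_add_const_right _ t tendsto_id)).sub_const
    (∫ x in (0 : ℝ)..t, |soliton p x| ^ p)
  refine tendsto_nhds_unique (hi t) (h0.congr fun N => ?_)
  simp only [Function.comp_apply, id, add_zero]
  rw [intervalIntegral.integral_comp_add_right (fun x => |soliton p x| ^ p) t, zero_add,
    intervalIntegral.integral_interval_sub_left (hc.intervalIntegrable _ _)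
      (hc.intervalIntegrable _ _)]

/-- The soliton is even, so its pieces beyond `-a` and beyond `a` have together the mass of a whole
soliton. -/
lemma solitonMass_neg_add (hp : 2 < p) (a : ℝ) :
    solitonMass p (-a) + solitonMass p a = 2 * solitonMass p 0 := by
  have h : ∫ x in (0 : ℝ)..(-a), |soliton p x| ^ p = -∫ x in (0 : ℝ)..a, |soliton p x| ^ p := by
    have := intervalIntegral.integral_comp_neg (a := 0) (b := a) (fun x => |soliton p x| ^ p)
    simp only [soliton_neg, neg_zero] at this
    rw [intervalIntegral.integral_symm, ← this]
  rw [solitonMass_eq hp (-a), solitonMass_eq hp a, h]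
  ring

lemma solitonMass_nonneg (p t : ℝ) : 0 ≤ solitonMass p t :=
  integral_nonneg fun x => by positivity

lemma antitone_solitonMass (hp : 2 < p) : Antitone (solitonMass p) := by
  intro a b hab
  have hc := continuous_abs_soliton_rpow hp
  rw [solitonMass_eq hp a, solitonMass_eq hp b]
  have := intervalIntegral.integral_interval_sub_left (hc.intervalIntegrable 0 b)
      (hc.intervalIntegrable (μ := volume) 0 a)
  have h2 : 0 ≤ ∫ x in a..b, |soliton p x| ^ p :=
    intervalIntegral.integral_nonneg hab fun x _ => by positivity
  linarith

lemma continuous_solitonMass (hp : 2 < p) : Continuous (solitonMass p) := by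
  have : solitonMass p = fun t => solitonMass p 0 - ∫ x in (0 : ℝ)..t, |soliton p x| ^ p :=
    funext (solitonMass_eq hp)
  rw [this]
  exact continuous_const.sub
    (continuous_iff_continuousAt.2 fun x => ((continuous_abs_soliton_rpow hp).integral_hasStrictDerivAt
      0 x).hasDerivAt.continuousAt)

lemma tendsto_solitonMass (hp : 2 < p) : Tendsto (solitonMass p) atTop (𝓝 0) := by
  have h := intervalIntegral_tendsto_integral_Ioi 0
    ((isSol_soliton hp 0 _).integrableOn_rpow_Ioi hp (memLp_soliton hp 0) (memLp_solitonDeriv hp 0))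
    tendsto_id
  have h' := h.const_sub (solitonMass p 0)
  have e : solitonMass p 0 - ∫ x in Ioi 0, |soliton p (x + 0)| ^ p = 0 := sub_self _
  rw [e] at h'
  refine h'.congr fun t => ?_
  rw [solitonMass_eq hp t]
  simp

lemma solitonMass_zero_pos (hp : 2 < p) : 0 < solitonMass p 0 := by
  have h1 : 0 < ∫ x in (0 : ℝ)..1, |soliton p x| ^ p :=
    intervalIntegral.intervalIntegral_pos_of_pos
      ((continuous_abs_soliton_rpow hp).intervalIntegrable _ _)
      (fun x => Real.rpow_pos_of_pos (abs_pos.2 (soliton_pos hp x).ne') _) one_pos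
  have h2 := solitonMass_eq hp 1
  have h3 := solitonMass_nonneg p 1
  linarith

/-! ### Classification of the solutions in `H¹` of a half-line -/

lemma exists_soliton_eq (hp : 2 < p) {c : ℝ} (h0 : 0 < c) (h1 : c ≤ amplitude p) :
    ∃ a, 0 ≤ a ∧ soliton p a = c := by
  obtain ⟨N, hN0, hN⟩ := ((eventually_ge_atTop 0).and
    ((tendsto_soliton hp).eventually (gt_mem_nhds h0))).exists
  obtain ⟨a, ha, hac⟩ := intermediate_value_Icc' hN0 (continuous_soliton hp).continuousOn
    (⟨hN.le, by rwa [soliton_zero]⟩ : c ∈ Icc (soliton p N) (soliton p 0))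
  exact ⟨a, ha.1, hac⟩

/-- Zero energy means `d ^ 2 = c ^ 2 (1 - (2 / p) |c| ^ (p - 2))`, and the bracket is negative
beyond the amplitude. Hence a nonzero `|c|` is a value of the soliton. -/
lemma abs_le_amplitude_of_energy (hp : 2 < p) {c d : ℝ} (h : energy p c d = 0) :
    |c| ≤ amplitude p := by
  by_contra hcon
  rw [not_le] at hcon
  have hc : 0 < |c| := (amplitude_pos hp).trans hcon
  have h1 : p / 2 < |c| ^ (p - 2) := by
    rw [← amplitude_rpow hp]
    exact Real.rpow_lt_rpow (amplitude_pos hp).le hcon (by linarith)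
  have h2 : |c| ^ p = |c| ^ (p - 2) * |c| ^ 2 := by
    rw [← Real.rpow_natCast, ← Real.rpow_add hc]; norm_num
  have h3 : p / 2 * |c| ^ 2 < |c| ^ p := by rw [h2]; gcongr
  have h4 : |c| ^ 2 / 2 < |c| ^ p / p := by
    rw [div_lt_div_iff₀ (by norm_num) (by linarith)]; linarith
  rw [energy, ← sq_abs c] at h
  nlinarith [sq_nonneg d]

lemma exists_soliton_data (hp : 2 < p) {c d : ℝ} (hc : c ≠ 0) (h : energy p c d = 0) :
    ∃ σ a : ℝ, (σ = 1 ∨ σ = -1) ∧ 0 ≤ a ∧ c = σ * soliton p a := by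
  obtain ⟨a, ha, hac⟩ := exists_soliton_eq hp (abs_pos.2 hc) (abs_le_amplitude_of_energy hp h)
  rcases le_total 0 c with h0 | h0
  · exact ⟨1, a, Or.inl rfl, ha, by rw [hac, abs_of_nonneg h0, one_mul]⟩
  · exact ⟨-1, a, Or.inr rfl, ha, by rw [hac, abs_of_nonpos h0]; ring⟩

namespace IsSol

variable {u v : ℝ → ℝ}

lemma eq_zero_of_Ici (hp : 2 < p) (h : IsSol p (Ici 0) u v)
    (hu : MemLp u 2 (volume.restrict (Ioi 0))) (hv : MemLp v 2 (volume.restrict (Ioi 0)))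
    (h0 : u 0 = 0) : EqOn u (fun _ => 0) (Ici 0) ∧ v 0 = 0 := by
  have hE := h.energy_eq_zero hp hu hv
  have hv0 : v 0 = 0 := by
    rw [energy, h0, abs_zero, Real.zero_rpow (by linarith), zero_div] at hE
    have : v 0 ^ 2 = 0 := by linarith
    exact pow_eq_zero_iff (two_ne_zero) |>.1 this
  exact ⟨(eqOn_Ici hp h (IsSol.zero p _) h0 hv0).1, hv0⟩

/-- A nontrivial solution in `H¹` of a half-line is a piece of a soliton. -/
lemma exists_shift (hp : 2 < p) (h : IsSol p (Ici 0) u v)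
    (hu : MemLp u 2 (volume.restrict (Ioi 0))) (hv : MemLp v 2 (volume.restrict (Ioi 0)))
    {σ a : ℝ} (hσ : σ = 1 ∨ σ = -1) (ha : 0 ≤ a) (h0 : u 0 = σ * soliton p a) :
    ∃ t, (t = a ∧ 0 < a ∨ t = -a) ∧ EqOn u (fun x => σ * soliton p (x + t)) (Ici 0) ∧
      v 0 = σ * solitonDeriv p t := by
  have hE := h.energy_eq_zero hp hu hv
  have hE' := soliton_energy hp a
  have hσ2 : σ ^ 2 = 1 := by rcases hσ with rfl | rfl <;> norm_num
  have hσ1 : |σ| = 1 := by rcases hσ with rfl | rfl <;> norm_num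
  have hsq : v 0 ^ 2 = (σ * solitonDeriv p a) ^ 2 := by
    rw [energy, h0, abs_mul, hσ1, one_mul, mul_pow, hσ2, one_mul] at hE
    rw [energy] at hE'
    rw [mul_pow, hσ2]
    linarith
  have key : ∀ t, soliton p t = soliton p a → v 0 = σ * solitonDeriv p t →
      EqOn u (fun x => σ * soliton p (x + t)) (Ici 0) := by
    intro t ht hvt
    exact (eqOn_Ici hp h ((isSol_soliton hp t _).const_mul hσ) (by simp [h0, ht])
      (by simp [hvt])).1
  -- The peak `a = 0` is counted as the alternative `t = -a`, so that the other alternative always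
  -- means a strictly negative soliton slope at the vertex.
  rcases ha.eq_or_lt with rfl | ha'
  · rw [solitonDeriv_zero, mul_zero, zero_pow two_ne_zero, sq_eq_zero_iff] at hsq
    exact ⟨-0, Or.inr rfl, key _ (by simp) (by simp [hsq, solitonDeriv_zero]),
      by simp [hsq, solitonDeriv_zero]⟩
  rcases sq_eq_sq_iff_eq_or_eq_neg.1 hsq with h1 | h1
  · exact ⟨a, Or.inl ⟨rfl, ha'⟩, key a rfl h1, h1⟩
  · have h1' : v 0 = σ * solitonDeriv p (-a) := by rw [h1, solitonDeriv_neg]; ring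
    exact ⟨-a, Or.inr rfl, key _ (soliton_neg p a) h1', h1'⟩

end IsSol

lemma integral_rpow_eq_solitonMass {u : ℝ → ℝ} {σ t : ℝ} (hσ : σ = 1 ∨ σ = -1)
    (h : EqOn u (fun x => σ * soliton p (x + t)) (Ici 0)) :
    ∫ x in Ioi 0, |u x| ^ p = solitonMass p t := by
  refine setIntegral_congr_fun measurableSet_Ioi fun x hx => ?_
  have hσ1 : |σ| = 1 := by rcases hσ with rfl | rfl <;> norm_num
  simp only [h (Ioi_subset_Ici_self hx), abs_mul, hσ1, one_mul]

end SingleKnotGraph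

namespace SingleKnotGraph

/-! ### Vertex conditions, action and construction of bound-states -/

variable {p : ℝ} {H P L : ℕ}

lemma memLp_two_of_continuousOn_Icc {f : ℝ → ℝ} {b : ℝ} (hf : ContinuousOn f (Icc 0 b)) :
    MemLp f 2 (volume.restrict (Ioo 0 b)) := by
  obtain ⟨B, hB⟩ := isCompact_Icc.exists_bound_of_continuousOn hf
  refine MemLp.of_bound ((hf.mono Ioo_subset_Icc_self).aestronglyMeasurable measurableSet_Ioo) B ?_
  exact (ae_restrict_iff' measurableSet_Ioo).2 (Eventually.of_forall fun x hx =>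
    hB x (Ioo_subset_Icc_self hx))

/-- A function on the graph given by continuously differentiable functions on the edges. -/
noncomputable def H1Function.ofHasDeriv (G : SingleKnotGraph H P L) (f g : Edge H P L → ℝ → ℝ)
    (hd : ∀ e, ∀ x ∈ G.closedEdge e, HasDerivWithinAt (f e) (g e x) (G.closedEdge e) x)
    (hg : ∀ e, ContinuousOn (g e) (G.closedEdge e))
    (hv : ∃ c : ℝ, (∀ e, f e 0 = c) ∧ ∀ j : Fin L, f (loop j) (G.loopLength j) = c)
    (hf2 : ∀ k, MemLp (f (halfLine k)) 2 (volume.restrict (Ioi 0)))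
    (hg2 : ∀ k, MemLp (g (halfLine k)) 2 (volume.restrict (Ioi 0))) : H1Function G where
  toFun := f
  deriv := g
  continuousOn e := fun x hx => (hd e x hx).continuousWithinAt
  continuous_vertex := hv
  memLp e := by
    rcases e with i | j | k
    · exact memLp_two_of_continuousOn_Icc fun x hx => (hd (pendant i) x hx).continuousWithinAt
    · exact memLp_two_of_continuousOn_Icc fun x hx => (hd (loop j) x hx).continuousWithinAt
    · exact hf2 k
  deriv_memLp e := by
    rcases e with i | j | k
    · exact memLp_two_of_continuousOn_Icc (hg (pendant i))
    · exact memLp_two_of_continuousOn_Icc (hg (loop j))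
    · exact hg2 k
  isWeakDeriv e := (isEdgePair G e).isWeakDeriv_of_hasDerivWithinAt (hd e) (hg e)

variable {G : SingleKnotGraph H P L}

/-- A test function that is affine on pendants, constant on loops, exponential on half-lines. -/
lemma exists_affine_testFunction (G : SingleKnotGraph H P L) (A : ℝ) (B : Fin P → ℝ) :
    ∃ η : H1Function G, (∀ i x, η.toFun (pendant i) x = A + B i * x) ∧
      (∀ j x, η.toFun (loop j) x = A) ∧ ∀ k x, η.toFun (halfLine k) x = A * Real.exp (-x) := by
  have hexp : ∀ A : ℝ, MemLp (fun x => A * Real.exp (-x)) 2 (volume.restrict (Ioi 0)) := fun A =>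
    memLp_two_of_le_exp (K := |A|) (by fun_prop) fun x => by
      rw [abs_mul, abs_of_pos (Real.exp_pos _)]
  refine ⟨H1Function.ofHasDeriv G
    (fun e x => match e with
      | Sum.inl i => A + B i * x
      | Sum.inr (Sum.inl _) => A
      | Sum.inr (Sum.inr _) => A * Real.exp (-x))
    (fun e x => match e with
      | Sum.inl i => B i
      | Sum.inr (Sum.inl _) => 0
      | Sum.inr (Sum.inr _) => -A * Real.exp (-x)) ?_ ?_ ?_ ?_ ?_, ?_, ?_, ?_⟩
  · rintro (i | j | k) x hx
    · simpa using (((hasDerivAt_id x).const_mul (B i)).const_add A).hasDerivWithinAt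
    · exact hasDerivWithinAt_const _ _ _
    · have := ((hasDerivAt_neg x).exp.const_mul A).hasDerivWithinAt (s := G.closedEdge (halfLine k))
      exact this.congr_deriv (by ring)
  · rintro (i | j | k)
    · exact continuousOn_const
    · exact continuousOn_const
    · exact (by fun_prop : Continuous fun x : ℝ => -A * Real.exp (-x)).continuousOn
  · refine ⟨A, ?_, fun j => rfl⟩
    rintro (i | j | k) <;> simp
  · exact fun k => hexp A
  · exact fun k => hexp (-A)
  · exact fun i x => rfl
  · exact fun j x => rfl
  · exact fun k x => rfl

/-- The vertex conditions satisfied by a bound-state. -/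
lemma IsBoundState.vertex_conditions (hp : 2 < p) {u : H1Function G} (hu : IsBoundState p u)
    {v : Edge H P L → ℝ → ℝ} (hv : IsClassical p u v) :
    (∀ i, v (pendant i) (G.pendantLength i) = 0) ∧
    (∑ i, v (pendant i) 0) + ((∑ j, (v (loop j) 0 - v (loop j) (G.loopLength j))) +
      ∑ k, v (halfLine k) 0) = 0 := by
  -- The vertex value `A` and the pendant slopes `B` are free: `A = 0` with one nonzero slope
  -- isolates a tip, and `A = 1`, `B = 0` isolates the vertex.
  have key : ∀ (A : ℝ) (B : Fin P → ℝ),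
      (∑ i, (v (pendant i) (G.pendantLength i) * (A + B i * G.pendantLength i)
        - v (pendant i) 0 * A)) + ((∑ j, (v (loop j) (G.loopLength j) * A - v (loop j) 0 * A)) +
      ∑ k, -(v (halfLine k) 0 * A)) = 0 := by
    intro A B
    obtain ⟨η, h1, h2, h3⟩ := exists_affine_testFunction G A B
    have h := hu.2 η
    rw [hv.integral_eq hp η] at h
    simpa [h1, h2, h3] using h
  have htip : ∀ i, v (pendant i) (G.pendantLength i) = 0 := by
    intro i
    have h := key 0 (Pi.single i 1)
    simp only [mul_zero, zero_add, sub_zero, neg_zero, Finset.sum_const_zero, add_zero] at h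
    rw [Finset.sum_eq_single i] at h
    · have := (G.pendantLength_pos i).ne'
      simpa [this] using h
    · intro j _ hj
      simp [Pi.single_eq_of_ne hj]
    · simp
  refine ⟨htip, ?_⟩
  have h := key 1 0
  simp only [htip, zero_mul, mul_one, zero_sub, Finset.sum_neg_distrib,
    Finset.sum_sub_distrib] at h ⊢
  linarith

/-- Classical solutions on the edges satisfying the vertex conditions form a bound-state. -/
lemma IsClassical.isBoundState (hp : 2 < p) {u : H1Function G} {v : Edge H P L → ℝ → ℝ}
    (hv : IsClassical p u v) (hne : ∃ e, ∃ x ∈ G.closedEdge e, u.toFun e x ≠ 0)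
    (htip : ∀ i, v (pendant i) (G.pendantLength i) = 0)
    (hK : (∑ i, v (pendant i) 0) + ((∑ j, (v (loop j) 0 - v (loop j) (G.loopLength j))) +
      ∑ k, v (halfLine k) 0) = 0) : IsBoundState p u := by
  refine ⟨hne, fun η => ?_⟩
  obtain ⟨A, hA, hA'⟩ := η.continuous_vertex
  rw [hv.integral_eq hp η]
  simp only [htip, hA, hA', zero_mul, zero_sub, Finset.sum_neg_distrib,
    Finset.sum_sub_distrib] at hK ⊢
  rw [← Finset.sum_mul, ← Finset.sum_mul, ← Finset.sum_mul, ← Finset.sum_mul]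
  linear_combination (-A) * hK

lemma IsClassical.integrableOn_rpow (hp : 2 < p) {u : H1Function G} {v : Edge H P L → ℝ → ℝ}
    (hv : IsClassical p u v) (e : Edge H P L) :
    IntegrableOn (fun x => |u.toFun e x| ^ p) (G.openEdge e) := by
  have hc : ∀ {b : ℝ} {f : ℝ → ℝ}, ContinuousOn f (Icc 0 b) →
      IntegrableOn (fun x => |f x| ^ p) (Ioo 0 b) := fun hf =>
    (((continuous_abs_rpow (by linarith)).comp_continuousOn hf).integrableOn_Icc).mono_set
      Ioo_subset_Icc_self
  rcases e with i | j | k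
  · exact hc (u.continuousOn (pendant i))
  · exact hc (u.continuousOn (loop j))
  · exact (hv (halfLine k)).1.integrableOn_rpow_Ioi hp (u.memLp (halfLine k)) (hv.memLp (halfLine k))

/-- The action of a bound-state in terms of its `L^p` norm. -/
lemma IsBoundState.action_eq (hp : 2 < p) {u : H1Function G} (hu : IsBoundState p u)
    {v : Edge H P L → ℝ → ℝ} (hv : IsClassical p u v) :
    action p u = (1 / 2 - 1 / p) * G.integral (fun e x => |u.toFun e x| ^ p) := by
  -- Testing with `u` itself gives the Nehari identity `∫ (u'^2 + u^2) = ∫ |u|^p`.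
  have h := hu.2 u
  have h1 : ∀ e, ∫ x in G.openEdge e, (u.deriv e x * u.deriv e x + u.toFun e x * u.toFun e x
      - |u.toFun e x| ^ (p - 2) * u.toFun e x * u.toFun e x) =
      (∫ x in G.openEdge e, ((u.deriv e x) ^ 2 + (u.toFun e x) ^ 2)) -
        ∫ x in G.openEdge e, |u.toFun e x| ^ p := by
    intro e
    have hi : Integrable (fun x => (u.deriv e x) ^ 2 + (u.toFun e x) ^ 2)
        (volume.restrict (G.openEdge e)) :=
      (u.deriv_memLp e).integrable_sq.add (u.memLp e).integrable_sq
    rw [← integral_sub hi (hv.integrableOn_rpow hp e)]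
    congr 1 with x
    rw [abs_rpow_sub_two_mul_sq hp]; ring
  simp only [SingleKnotGraph.integral, h1, Finset.sum_sub_distrib] at h
  simp only [action, SingleKnotGraph.integral]
  rw [sub_eq_zero.1 h]; ring

lemma one_half_sub_inv_pos (hp : 2 < p) : 0 < 1 / 2 - 1 / p := by
  have : 1 / p < 1 / 2 := one_div_lt_one_div_of_lt (by norm_num) hp
  linarith

/-! ### Estimates on a compact edge -/

namespace IsSol

variable {u v : ℝ → ℝ} {b : ℝ}

/-- The integrand is the derivative of `u v`: a Nehari identity on one edge, with its boundary term.
-/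
lemma integral_rpow_eq (hp : 2 < p) (hb : 0 ≤ b) (h : IsSol p (Icc 0 b) u v) :
    ∫ x in (0 : ℝ)..b, (v x ^ 2 + u x ^ 2 - |u x| ^ p) = u b * v b - u 0 * v 0 := by
  refine intervalIntegral.integral_eq_sub_of_hasDerivAt_of_le hb
    (f := fun x => u x * v x) (h.continuousOn.mul h.continuousOn_deriv) (fun x hx => ?_) ?_
  · have hn := Icc_mem_nhds hx.1 hx.2
    have h1 := (h x (Ioo_subset_Icc_self hx)).1.hasDerivAt hn
    have h2 := (h x (Ioo_subset_Icc_self hx)).2.hasDerivAt hn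
    refine (h1.mul h2).congr_deriv ?_
    rw [mul_comm (u x), force_mul_self hp]; ring
  · exact (((h.continuousOn_deriv.pow 2).add (h.continuousOn.pow 2)).sub
      ((continuous_abs_rpow (by linarith)).comp_continuousOn h.continuousOn)).intervalIntegrable_of_Icc hb

lemma intervalIntegrable_rpow (hp : 2 < p) (hb : 0 ≤ b) (h : IsSol p (Icc 0 b) u v) :
    IntervalIntegrable (fun x => |u x| ^ p) volume 0 b :=
  ((continuous_abs_rpow (by linarith)).comp_continuousOn h.continuousOn).intervalIntegrable_of_Icc hb

/-- A nontrivial solution with nonpositive boundary term has `∫ |u|^p ≥ 1/2`. -/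
lemma one_half_le_integral_rpow (hp : 2 < p) (hb : 1 ≤ b) (h : IsSol p (Icc 0 b) u v)
    (hne : ∃ x ∈ Icc 0 b, u x ≠ 0) (hbd : u b * v b - u 0 * v 0 ≤ 0) :
    1 / 2 ≤ ∫ x in (0 : ℝ)..b, |u x| ^ p := by
  have hb0 : 0 < b := by linarith
  have hcu := h.continuousOn
  have hcv := h.continuousOn_deriv
  have hcp : ContinuousOn (fun x => |u x| ^ p) (Icc 0 b) :=
    (continuous_abs_rpow (by linarith)).comp_continuousOn hcu
  have hi1 : IntervalIntegrable (fun x => v x ^ 2 + u x ^ 2) volume 0 b :=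
    ((hcv.pow 2).add (hcu.pow 2)).intervalIntegrable_of_Icc hb0.le
  -- It suffices to bound the left integral `J` below by `1/2`. Nehari forces `|u| ≥ 1` somewhere,
  -- the length `b ≥ 1` gives a point with `u ^ 2 ≤ J`, and `2 |u v| ≤ u ^ 2 + v ^ 2` lets `u ^ 2`
  -- rise by at most `J` in between, so `1 ≤ 2 J`.
  have hI : ∫ x in (0 : ℝ)..b, (v x ^ 2 + u x ^ 2) ≤ ∫ x in (0 : ℝ)..b, |u x| ^ p := by
    have := h.integral_rpow_eq hp hb0.le
    rw [intervalIntegral.integral_sub hi1 (h.intervalIntegrable_rpow hp hb0.le)] at this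
    linarith
  -- the solution reaches the value `1`
  have hx₀ : ∃ x₀ ∈ Icc 0 b, 1 ≤ |u x₀| := by
    by_contra hcon
    push Not at hcon
    have hle : ∀ x ∈ Icc 0 b, |u x| ^ p ≤ u x ^ 2 := by
      intro x hx
      rw [← sq_abs, ← Real.rpow_two]
      rcases (abs_nonneg (u x)).eq_or_lt with h0 | h0
      · rw [← h0, Real.zero_rpow (by linarith), Real.zero_rpow (by norm_num)]
      · exact Real.rpow_le_rpow_of_exponent_ge h0 (hcon x hx).le hp.le
    obtain ⟨x, hx, hx0⟩ := hne
    have hlt : |u x| ^ p < u x ^ 2 := by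
      rw [← sq_abs, ← Real.rpow_two]
      exact Real.rpow_lt_rpow_of_exponent_gt (abs_pos.2 hx0) (hcon x hx) hp
    have h2 : ∫ x in (0 : ℝ)..b, |u x| ^ p < ∫ x in (0 : ℝ)..b, (v x ^ 2 + u x ^ 2) := by
      refine intervalIntegral.integral_lt_integral_of_continuousOn_of_le_of_exists_lt hb0 hcp
        ((hcv.pow 2).add (hcu.pow 2)) (fun y hy => ?_) ⟨x, hx, ?_⟩
      · nlinarith [hle y (Ioc_subset_Icc_self hy), sq_nonneg (v y)]
      · nlinarith [sq_nonneg (v x)]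
    linarith
  obtain ⟨x₀, hx₀, h1⟩ := hx₀
  set J := ∫ x in (0 : ℝ)..b, (v x ^ 2 + u x ^ 2) with hJ
  have hJ0 : 0 ≤ J := intervalIntegral.integral_nonneg hb0.le fun x _ => by positivity
  -- there is a point where `u ^ 2 ≤ J`
  have hy : ∃ y ∈ Icc 0 b, u y ^ 2 ≤ J := by
    by_contra hcon
    push Not at hcon
    have : ∫ _ in (0 : ℝ)..b, J < ∫ x in (0 : ℝ)..b, (v x ^ 2 + u x ^ 2) := by
      refine intervalIntegral.integral_lt_integral_of_continuousOn_of_le_of_exists_lt hb0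
        continuousOn_const ((hcv.pow 2).add (hcu.pow 2)) (fun y hy => ?_) ⟨0, ⟨le_rfl, hb0.le⟩, ?_⟩
      · nlinarith [hcon y (Ioc_subset_Icc_self hy), sq_nonneg (v y)]
      · nlinarith [sq_nonneg (v 0), hcon 0 ⟨le_rfl, hb0.le⟩]
    rw [intervalIntegral.integral_const, smul_eq_mul, sub_zero, ← hJ] at this
    nlinarith
  obtain ⟨y, hy, hyJ⟩ := hy
  have hdiff : u x₀ ^ 2 - u y ^ 2 ≤ J := by
    have hsub : uIcc y x₀ ⊆ Icc 0 b := uIcc_subset_Icc hy hx₀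
    have hc2 : ContinuousOn (fun x => 2 * u x * v x) (uIcc y x₀) :=
      ((continuousOn_const.mul hcu).mul hcv).mono hsub
    have hftc : ∫ x in y..x₀, 2 * u x * v x = u x₀ ^ 2 - u y ^ 2 := by
      refine intervalIntegral.integral_eq_sub_of_hasDeriv_right
        (f := fun x => u x ^ 2) ((hcu.pow 2).mono hsub) (fun x hx => ?_) hc2.intervalIntegrable
      have hx' : x ∈ Ioo 0 b := by
        have h1 := hsub ⟨hx.1.le, hx.2.le⟩
        refine ⟨lt_of_le_of_lt ?_ hx.1, lt_of_lt_of_le hx.2 ?_⟩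
        · exact le_min hy.1 hx₀.1
        · exact max_le hy.2 hx₀.2
      have := ((h x (Ioo_subset_Icc_self hx')).1.hasDerivAt (Icc_mem_nhds hx'.1 hx'.2)).pow 2
      exact (this.congr_deriv (by simp)).hasDerivWithinAt
    rw [← hftc]
    refine (Real.le_norm_self _).trans
      ((intervalIntegral.norm_integral_le_integral_norm_uIoc).trans ?_)
    simp only [Real.norm_eq_abs]
    rw [hJ, intervalIntegral.integral_of_le hb0.le]
    have hsub' : uIoc y x₀ ⊆ Ioc 0 b := by
      rw [uIoc]
      exact Ioc_subset_Ioc (le_min hy.1 hx₀.1) (max_le hy.2 hx₀.2)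
    calc ∫ x in uIoc y x₀, |2 * u x * v x| ≤ ∫ x in uIoc y x₀, (v x ^ 2 + u x ^ 2) := by
          refine setIntegral_mono_on ?_ (hi1.1.mono_set hsub') measurableSet_uIoc fun x _ => ?_
          · exact (intervalIntegrable_iff.1 hc2.abs.intervalIntegrable)
          · rw [abs_le]
            constructor <;> nlinarith [sq_nonneg (u x + v x), sq_nonneg (u x - v x)]
      _ ≤ _ := setIntegral_mono_set hi1.1 (Eventually.of_forall fun x => by
            simp only [Pi.zero_apply]; positivity) hsub'.eventuallyLE
  have h1sq : 1 ≤ u x₀ ^ 2 := by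
    rw [← sq_abs]; nlinarith
  linarith

end IsSol

end SingleKnotGraph

namespace SingleKnotGraph

/-! ### The action of half a soliton as an optimal profile energy -/

/-- The absolute value of the slope of a solution of zero energy at height `s`. -/
noncomputable def profile (p s : ℝ) : ℝ := √(s ^ 2 - 2 / p * |s| ^ p)

/-- The primitive of `profile`. -/
noncomputable def profileInt (p s : ℝ) : ℝ := ∫ t in (0 : ℝ)..s, profile p t

variable {p : ℝ}

lemma profile_nonneg (p s : ℝ) : 0 ≤ profile p s := Real.sqrt_nonneg _

lemma continuous_profile (hp : 2 < p) : Continuous (profile p) :=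
  ((continuous_pow 2).sub (continuous_const.mul (continuous_abs_rpow (by linarith)))).sqrt

lemma le_profile_sq (p s : ℝ) : s ^ 2 - 2 / p * |s| ^ p ≤ profile p s ^ 2 := by
  rcases le_total 0 (s ^ 2 - 2 / p * |s| ^ p) with h | h
  · rw [profile, Real.sq_sqrt h]
  · exact h.trans (sq_nonneg _)

lemma abs_rpow_eq_mul_sq (hp : 2 < p) (s : ℝ) : |s| ^ p = |s| ^ (p - 2) * s ^ 2 := by
  rw [← abs_rpow_sub_two_mul_sq hp]; ring

lemma profile_sq (hp : 2 < p) {s : ℝ} (hs : |s| ≤ amplitude p) :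
    profile p s ^ 2 = s ^ 2 - 2 / p * |s| ^ p := by
  refine Real.sq_sqrt ?_
  have h1 : |s| ^ (p - 2) ≤ p / 2 := by
    rw [← amplitude_rpow hp]
    exact Real.rpow_le_rpow (abs_nonneg s) hs (by linarith)
  have h2 : 2 / p * |s| ^ (p - 2) ≤ 1 := by
    calc 2 / p * |s| ^ (p - 2) ≤ 2 / p * (p / 2) := by gcongr
      _ = 1 := by field_simp
  rw [abs_rpow_eq_mul_sq hp]
  nlinarith [sq_nonneg s]

lemma profile_eq_zero (hp : 2 < p) {s : ℝ} (hs : amplitude p ≤ |s|) : profile p s = 0 := by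
  refine Real.sqrt_eq_zero_of_nonpos ?_
  have h1 : p / 2 ≤ |s| ^ (p - 2) := by
    rw [← amplitude_rpow hp]
    exact Real.rpow_le_rpow (amplitude_pos hp).le hs (by linarith)
  have h2 : 1 ≤ 2 / p * |s| ^ (p - 2) := by
    calc 1 = 2 / p * (p / 2) := by field_simp
      _ ≤ 2 / p * |s| ^ (p - 2) := by gcongr
  rw [abs_rpow_eq_mul_sq hp]
  nlinarith [sq_nonneg s]

lemma hasDerivAt_profileInt (hp : 2 < p) (s : ℝ) :
    HasDerivAt (profileInt p) (profile p s) s :=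
  ((continuous_profile hp).integral_hasStrictDerivAt 0 s).hasDerivAt

lemma continuous_profileInt (hp : 2 < p) : Continuous (profileInt p) :=
  continuous_iff_continuousAt.2 fun s => (hasDerivAt_profileInt hp s).continuousAt

lemma profileInt_zero (p : ℝ) : profileInt p 0 = 0 := by simp [profileInt]

lemma profileInt_neg (p s : ℝ) : profileInt p (-s) = -profileInt p s := by
  have := intervalIntegral.integral_comp_neg (a := 0) (b := s) (profile p)
  have he : ∀ x, profile p (-x) = profile p x := fun x => by simp [profile]
  simp only [he, neg_zero] at this
  rw [profileInt, intervalIntegral.integral_symm, ← this, profileInt]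

lemma monotone_profileInt (hp : 2 < p) : Monotone (profileInt p) :=
  monotone_of_hasDerivAt_nonneg (hasDerivAt_profileInt hp) (profile_nonneg p)

/-- Beyond the amplitude the radicand in `profile` is nonpositive and `√` returns `0`, so
`profileInt` stops growing and no upper bound on `s` is needed. -/
lemma profileInt_le (hp : 2 < p) (s : ℝ) : profileInt p s ≤ profileInt p (amplitude p) := by
  rcases le_total s (amplitude p) with h | h
  · exact monotone_profileInt hp h
  · have hc := continuous_profile hp
    have := intervalIntegral.integral_interval_sub_left (hc.intervalIntegrable 0 s)
      (hc.intervalIntegrable (μ := volume) 0 (amplitude p))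
    have h0 : ∫ t in (amplitude p)..s, profile p t = 0 := by
      refine (intervalIntegral.integral_congr (g := fun _ => 0) fun t ht => ?_).trans (by simp)
      rw [uIcc_of_le h] at ht
      exact profile_eq_zero hp (ht.1.trans (le_abs_self t))
    simp only [profileInt]
    linarith

lemma profileInt_nonneg (hp : 2 < p) {s : ℝ} (hs : 0 ≤ s) : 0 ≤ profileInt p s := by
  rw [← profileInt_zero p]
  exact monotone_profileInt hp hs

/-- Pointwise identity behind the formula for the mass of a solution. -/
lemma mass_density_eq (hp : 2 < p) (u v : ℝ) :
    (1 / 2 - 1 / p) * |u| ^ p = v ^ 2 - energy p u v - 1 / 2 * (v ^ 2 + u ^ 2 - |u| ^ p) := by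
  rw [energy]; field_simp; ring

namespace IsSol

variable {u v : ℝ → ℝ} {b : ℝ}

/-- Integrating `mass_density_eq`, the energy is constant and the last bracket is a total
derivative. The remaining `∫ v ^ 2` can be compared with the endpoint quantity `profileInt`. -/
lemma mass_eq (hp : 2 < p) (hb : 0 ≤ b) (h : IsSol p (Icc 0 b) u v) :
    (1 / 2 - 1 / p) * ∫ x in (0 : ℝ)..b, |u x| ^ p =
      (∫ x in (0 : ℝ)..b, v x ^ 2) - b * energy p (u 0) (v 0) - 1 / 2 * (u b * v b - u 0 * v 0) := by
  have hcu := h.continuousOn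
  have hcv := h.continuousOn_deriv
  have hcp : ContinuousOn (fun x => |u x| ^ p) (Icc 0 b) :=
    (continuous_abs_rpow (by linarith)).comp_continuousOn hcu
  rw [← h.integral_rpow_eq hp hb, ← intervalIntegral.integral_const_mul,
    ← intervalIntegral.integral_const_mul]
  have e1 : b * energy p (u 0) (v 0) = ∫ _ in (0 : ℝ)..b, energy p (u 0) (v 0) := by simp
  rw [e1, ← intervalIntegral.integral_sub, ← intervalIntegral.integral_sub]
  · refine intervalIntegral.integral_congr fun x hx => ?_
    rw [uIcc_of_le hb] at hx
    show (1 / 2 - 1 / p) * |u x| ^ p = v x ^ 2 - energy p (u 0) (v 0) -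
      1 / 2 * (v x ^ 2 + u x ^ 2 - |u x| ^ p)
    rw [h.energy_eq hp (convex_Icc 0 b) ⟨le_rfl, hb⟩ hx, mass_density_eq hp (u x) (v x)]
  · exact ((hcv.pow 2).sub continuousOn_const).intervalIntegrable_of_Icc hb
  · exact (continuousOn_const.mul
      (((hcv.pow 2).add (hcu.pow 2)).sub hcp)).intervalIntegrable_of_Icc hb
  · exact (hcv.pow 2).intervalIntegrable_of_Icc hb
  · exact intervalIntegrable_const

/-- The change of variables `s = t * u x` for `profile`. -/
lemma integral_profile_comp (hp : 2 < p) (h : IsSol p (Icc 0 b) u v) (t : ℝ) {x y : ℝ}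
    (hx : x ∈ Icc 0 b) (hy : y ∈ Icc 0 b) (hxy : x ≤ y) :
    ∫ z in x..y, profile p (t * u z) * (t * v z) =
      profileInt p (t * u y) - profileInt p (t * u x) := by
  have hsub : Icc x y ⊆ Icc 0 b := Icc_subset_Icc hx.1 hy.2
  have hcu := h.continuousOn.mono hsub
  have hcv := h.continuousOn_deriv.mono hsub
  refine intervalIntegral.integral_eq_sub_of_hasDerivAt_of_le hxy
    (f := fun z => profileInt p (t * u z))
    ((continuous_profileInt hp).comp_continuousOn (continuousOn_const.mul hcu))
    (fun z hz => ?_) ?_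
  · have hz' := hsub (Ioo_subset_Icc_self hz)
    have hd := (h z hz').1.hasDerivAt
      (mem_of_superset (Icc_mem_nhds hz.1 hz.2) hsub)
    exact (hasDerivAt_profileInt hp (t * u z)).comp z (hd.const_mul t)
  · exact (((continuous_profile hp).comp_continuousOn (continuousOn_const.mul hcu)).mul
      (continuousOn_const.mul hcv)).intervalIntegrable_of_Icc hxy

/-- Upper bound for the mass of an increasing solution. -/
lemma mass_le (hp : 2 < p) (hb : 0 ≤ b) (h : IsSol p (Icc 0 b) u v) (hu0 : 0 ≤ u 0)
    (hv : ∀ x ∈ Icc 0 b, 0 ≤ v x) (hvb : v b = 0) (hE : 0 ≤ energy p (u 0) (v 0)) {S : ℝ}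
    (hS : 0 ≤ S) (hES : 2 * energy p (u 0) (v 0) ≤ S ^ 2) :
    (1 / 2 - 1 / p) * ∫ x in (0 : ℝ)..b, |u x| ^ p ≤
      profileInt p (amplitude p) + S * (u b - u 0) + 1 / 2 * (u 0 * v 0) := by
  have hcu := h.continuousOn
  have hcv := h.continuousOn_deriv
  -- Energy conservation gives `v ^ 2 ≤ S ^ 2 + profile ^ 2 ≤ (S + profile) ^ 2`. Multiplying `v ≤ S
  -- + profile` by `v ≥ 0` produces two exact derivatives.
  have hpt : ∀ x ∈ Icc 0 b, v x ^ 2 ≤ S * v x + profile p (1 * u x) * (1 * v x) := by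
    intro x hx
    have h1 : v x ≤ S + profile p (u x) := by
      refine abs_le_of_sq_le_sq' ?_ (add_nonneg hS (profile_nonneg _ _)) |>.2
      have h2 := h.energy_eq hp (convex_Icc 0 b) ⟨le_rfl, hb⟩ hx
      have h3 := le_profile_sq p (u x)
      have h4 : v x ^ 2 = 2 * energy p (u 0) (v 0) + (u x ^ 2 - 2 / p * |u x| ^ p) := by
        rw [h2, energy]; ring
      nlinarith [mul_nonneg hS (profile_nonneg p (u x))]
    have h2 := hv x hx
    rw [one_mul, one_mul]
    nlinarith
  have hi1 : IntervalIntegrable (fun x => S * v x) volume 0 b :=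
    (continuousOn_const.mul hcv).intervalIntegrable_of_Icc hb
  have hi2 : IntervalIntegrable (fun x => profile p (1 * u x) * (1 * v x)) volume 0 b :=
    (((continuous_profile hp).comp_continuousOn (continuousOn_const.mul hcu)).mul
      (continuousOn_const.mul hcv)).intervalIntegrable_of_Icc hb
  have hi3 : IntervalIntegrable (fun x => v x ^ 2) volume 0 b :=
    (hcv.pow 2).intervalIntegrable_of_Icc hb
  have hle := intervalIntegral.integral_mono_on hb hi3 (hi1.add hi2) hpt
  rw [intervalIntegral.integral_add hi1 hi2, h.integral_profile_comp hp 1 ⟨le_rfl, hb⟩ ⟨hb, le_rfl⟩ hb,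
    intervalIntegral.integral_const_mul, intervalIntegral.integral_eq_sub_of_hasDerivAt_of_le hb
      hcu (fun x hx => (h x (Ioo_subset_Icc_self hx)).1.hasDerivAt (Icc_mem_nhds hx.1 hx.2))
      (hcv.intervalIntegrable_of_Icc hb), one_mul, one_mul] at hle
  rw [h.mass_eq hp hb, hvb]
  have h1 := profileInt_le hp (u b)
  have h2 := profileInt_nonneg hp hu0
  have h3 := mul_nonneg hb hE
  linarith

/-- The mass of a nontrivial solution vanishing at both endpoints of an interval is at least that of
a soliton. -/
lemma two_mul_profileInt_le (hp : 2 < p) (hb : 0 < b) (h : IsSol p (Icc 0 b) u v) (hu0 : u 0 = 0)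
    (hub : u b = 0) (hne : ∃ x ∈ Icc 0 b, u x ≠ 0) :
    2 * profileInt p (amplitude p) ≤ (1 / 2 - 1 / p) * ∫ x in (0 : ℝ)..b, |u x| ^ p := by
  have hcu := h.continuousOn
  have hcv := h.continuousOn_deriv
  have hcp : ContinuousOn (fun x => |u x| ^ p) (Icc 0 b) :=
    (continuous_abs_rpow (by linarith)).comp_continuousOn hcu
  obtain ⟨x₀, hx₀, hmax⟩ := isCompact_Icc.exists_isMaxOn ⟨0, ⟨le_rfl, hb.le⟩⟩ hcu.abs
  obtain ⟨x₁, hx₁, hx₁0⟩ := hne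
  have hM : 0 < |u x₀| := (abs_pos.2 hx₁0).trans_le (hmax hx₁)
  -- After this scaling the maximum of `|t u|` is the amplitude, so `profileInt p (t * u x)` goes
  -- from zero to plus or minus its extreme value and back.
  set t := amplitude p / |u x₀| with ht
  have ht0 : 0 < t := div_pos (amplitude_pos hp) hM
  have htM : t * |u x₀| = amplitude p := div_mul_cancel₀ _ hM.ne'
  -- Young's inequality; the right-hand side is the action density of `t u`.
  have hpt : ∀ x ∈ Icc 0 b, |profile p (t * u x) * (t * v x)| ≤
      t ^ 2 / 2 * (v x ^ 2 + u x ^ 2) - t ^ p / p * |u x| ^ p := by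
    intro x hx
    have h1 : |t * u x| ≤ amplitude p := by
      rw [abs_mul, abs_of_pos ht0, ← htM]
      exact mul_le_mul_of_nonneg_left (hmax hx) ht0.le
    have h2 := profile_sq hp h1
    rw [abs_mul, abs_of_pos ht0, Real.mul_rpow ht0.le (abs_nonneg _)] at h2
    have h3 : t ^ 2 / 2 * (v x ^ 2 + u x ^ 2) - t ^ p / p * |u x| ^ p =
        ((t * v x) ^ 2 + profile p (t * u x) ^ 2) / 2 := by
      rw [h2]; ring
    rw [h3, abs_le]
    constructor <;> nlinarith [sq_nonneg (t * v x - profile p (t * u x)),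
      sq_nonneg (t * v x + profile p (t * u x))]
  have hcprof : ContinuousOn (fun x => profile p (t * u x) * (t * v x)) (Icc 0 b) :=
    ((continuous_profile hp).comp_continuousOn (continuousOn_const.mul hcu)).mul
      (continuousOn_const.mul hcv)
  have hPhi : |profileInt p (t * u x₀)| = profileInt p (amplitude p) := by
    have h0 := profileInt_nonneg hp (amplitude_pos hp).le
    rcases abs_cases (u x₀) with ⟨h1, _⟩ | ⟨h1, _⟩
    · rw [← h1, htM, abs_of_nonneg h0]
    · rw [show u x₀ = -|u x₀| by linarith, mul_neg, htM, profileInt_neg, abs_neg, abs_of_nonneg h0]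
  have hm0 : (0 : ℝ) ∈ Icc 0 b := ⟨le_rfl, hb.le⟩
  have hmb : b ∈ Icc 0 b := ⟨hb.le, le_rfl⟩
  have hl : profileInt p (amplitude p) ≤ ∫ x in (0 : ℝ)..x₀, |profile p (t * u x) * (t * v x)| := by
    rw [← hPhi]
    have := h.integral_profile_comp hp t hm0 hx₀ hx₀.1
    rw [hu0, mul_zero, profileInt_zero, sub_zero] at this
    rw [← this]
    exact intervalIntegral.abs_integral_le_integral_abs hx₀.1
  have hr : profileInt p (amplitude p) ≤ ∫ x in x₀..b, |profile p (t * u x) * (t * v x)| := by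
    rw [← hPhi]
    have := h.integral_profile_comp hp t hx₀ hmb hx₀.2
    rw [hub, mul_zero, profileInt_zero, zero_sub] at this
    rw [← abs_neg, ← this]
    exact intervalIntegral.abs_integral_le_integral_abs hx₀.2
  have hi : ∀ x ∈ Icc 0 b, ∀ y ∈ Icc 0 b, IntervalIntegrable
      (fun x => |profile p (t * u x) * (t * v x)|) volume x y := fun x hx y hy =>
    (hcprof.abs.mono (uIcc_subset_Icc hx hy)).intervalIntegrable
  have hsum := intervalIntegral.integral_add_adjacent_intervals (hi 0 hm0 x₀ hx₀) (hi x₀ hx₀ b hmb)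
  have hi1 : IntervalIntegrable (fun x => v x ^ 2 + u x ^ 2) volume 0 b :=
    ((hcv.pow 2).add (hcu.pow 2)).intervalIntegrable_of_Icc hb.le
  have hi2 := h.intervalIntegrable_rpow hp hb.le
  have hle := intervalIntegral.integral_mono_on hb.le (hi 0 hm0 b hmb)
    ((hi1.const_mul (t ^ 2 / 2)).sub (hi2.const_mul (t ^ p / p))) hpt
  rw [intervalIntegral.integral_sub (hi1.const_mul _) (hi2.const_mul _),
    intervalIntegral.integral_const_mul, intervalIntegral.integral_const_mul] at hle
  have hN := h.integral_rpow_eq hp hb.le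
  rw [intervalIntegral.integral_sub hi1 hi2, hu0, hub] at hN
  set B := ∫ x in (0 : ℝ)..b, |u x| ^ p with hB
  have hB0 : 0 ≤ B := intervalIntegral.integral_nonneg hb.le fun x _ => by positivity
  have hNB : ∫ x in (0 : ℝ)..b, (v x ^ 2 + u x ^ 2) = B := by linarith
  rw [hNB] at hle
  -- On its ray, an element of the Nehari set maximizes the action at `t = 1`; here this is
  -- Bernoulli's inequality for `(t ^ 2) ^ (p / 2)`.
  have hbern : t ^ 2 / 2 - t ^ p / p ≤ 1 / 2 - 1 / p := by
    have h1 := one_add_mul_self_le_rpow_one_add (s := t ^ 2 - 1) (p := p / 2)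
      (by nlinarith [sq_nonneg t]) (by linarith)
    rw [add_sub_cancel, ← Real.rpow_two, ← Real.rpow_mul ht0.le,
      show (2 : ℝ) * (p / 2) = p by ring, Real.rpow_two] at h1
    have h2 : (1 + p / 2 * (t ^ 2 - 1)) / p ≤ t ^ p / p := by gcongr
    have h3 : (1 + p / 2 * (t ^ 2 - 1)) / p = 1 / p + (t ^ 2 - 1) / 2 := by field_simp
    linarith
  have := mul_le_mul_of_nonneg_right hbern hB0
  linarith

end IsSol

lemma solitonDeriv_eq_neg_profile (hp : 2 < p) {x : ℝ} (hx : 0 ≤ x) :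
    solitonDeriv p x = -profile p (soliton p x) := by
  have h1 := soliton_energy hp x
  have h2 : solitonDeriv p x ≤ 0 := by
    rcases hx.eq_or_lt with rfl | h
    · rw [solitonDeriv_zero]
    · exact (solitonDeriv_neg_of_pos hp h).le
  have h3 : soliton p x ^ 2 - 2 / p * |soliton p x| ^ p = solitonDeriv p x ^ 2 := by
    rw [energy] at h1
    linear_combination (-2) * h1
  rw [profile, h3, Real.sqrt_sq_eq_abs, abs_of_nonpos h2]; ring

/-- The action of half a soliton. -/
lemma solitonMass_zero_eq (hp : 2 < p) :
    (1 / 2 - 1 / p) * solitonMass p 0 = profileInt p (amplitude p) := by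
  have hsol : ∀ N, IsSol p (Icc 0 N) (soliton p) (solitonDeriv p) := fun N => by
    simpa using isSol_soliton hp 0 (Icc 0 N)
  have h1 : Tendsto (fun N => (1 / 2 - 1 / p) * ∫ x in (0 : ℝ)..N, |soliton p x| ^ p) atTop
      (𝓝 ((1 / 2 - 1 / p) * solitonMass p 0)) := by
    have := ((tendsto_solitonMass hp).const_sub (solitonMass p 0)).const_mul (1 / 2 - 1 / p)
    rw [sub_zero] at this
    refine this.congr fun N => ?_
    rw [solitonMass_eq hp N]; ring
  have hd : Tendsto (solitonDeriv p) atTop (𝓝 0) :=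
    squeeze_zero_norm (fun x => abs_solitonDeriv_le hp x) (tendsto_soliton hp)
  have h2 : Tendsto (fun N => profileInt p (amplitude p) - profileInt p (soliton p N)
      - 1 / 2 * (soliton p N * solitonDeriv p N)) atTop (𝓝 (profileInt p (amplitude p))) := by
    have hPhi := ((continuous_profileInt hp).tendsto 0).comp (tendsto_soliton hp)
    rw [profileInt_zero] at hPhi
    have := (hPhi.const_sub (profileInt p (amplitude p))).sub
      (((tendsto_soliton hp).mul hd).const_mul (1 / 2))
    rwa [mul_zero, mul_zero, sub_zero, sub_zero] at this
  -- On `[0, N]` the energy is zero and `φ'^2 = -profile(φ) φ'`, so `mass_eq` evaluates the mass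
  -- exactly from the endpoint values.
  refine tendsto_nhds_unique h1 (h2.congr' ?_)
  filter_upwards [eventually_ge_atTop 0] with N hN
  rw [(hsol N).mass_eq hp hN, soliton_energy hp, solitonDeriv_zero]
  have h3 := (hsol N).integral_profile_comp hp 1 ⟨le_rfl, hN⟩ ⟨hN, le_rfl⟩ hN
  have h4 : ∫ x in (0 : ℝ)..N, solitonDeriv p x ^ 2 =
      -∫ x in (0 : ℝ)..N, profile p (1 * soliton p x) * (1 * solitonDeriv p x) := by
    rw [← intervalIntegral.integral_neg]
    refine intervalIntegral.integral_congr fun x hx => ?_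
    rw [uIcc_of_le hN] at hx
    simp only [one_mul, solitonDeriv_eq_neg_profile hp hx.1]
    ring
  rw [h4, h3, soliton_zero]
  simp only [one_mul]
  ring

end SingleKnotGraph

namespace SingleKnotGraph

/-! ### The initial value problem -/

variable {p : ℝ}

/-- Continuous dependence on the initial data. -/
lemma exists_dist_le (hp : 2 < p) (R : ℝ) : ∃ K : ℝ, 0 ≤ K ∧ ∀ {b : ℝ} {u v u' v' : ℝ → ℝ},
    IsSol p (Icc 0 b) u v → IsSol p (Icc 0 b) u' v' → (∀ x ∈ Icc 0 b, |u x| ≤ R) →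
    (∀ x ∈ Icc 0 b, |u' x| ≤ R) → ∀ x ∈ Icc 0 b,
      dist (u x, v x) (u' x, v' x) ≤ dist (u 0, v 0) (u' 0, v' 0) * Real.exp (K * b) := by
  obtain ⟨K, hlip⟩ := exists_lipschitzOnWith_field hp R
  refine ⟨K, K.2, fun {b u v u' v'} h h' hR hR' x hx => ?_⟩
  have key := dist_le_of_trajectories_ODE_of_mem (K := K)
    (v := fun _ z => (z.2, force p z.1)) (s := fun _ => Icc (-R) R ×ˢ univ)
    (f := fun t => (u t, v t)) (g := fun t => (u' t, v' t)) (a := 0) (b := b)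
    (fun _ _ => hlip) (h.continuousOn.prodMk h.continuousOn_deriv) (fun _ => h.hasDerivWithinAt_Ici)
    (fun t ht => ⟨abs_le.1 (hR t ⟨ht.1, ht.2.le⟩), trivial⟩)
    (h'.continuousOn.prodMk h'.continuousOn_deriv) (fun _ => h'.hasDerivWithinAt_Ici)
    (fun t ht => ⟨abs_le.1 (hR' t ⟨ht.1, ht.2.le⟩), trivial⟩) le_rfl x hx
  refine key.trans ?_
  rw [sub_zero]
  gcongr
  exact hx.2

lemma exists_bound_of_energy (hp : 2 < p) (E : ℝ) :
    ∃ R : ℝ, 0 < R ∧ ∀ u v, energy p u v ≤ E → |u| < R ∧ |v| < R := by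
  -- From `|u| ≥ ρ` on, `|u| ^ p / p ≥ u ^ 2`, so the energy dominates `u ^ 2 / 2`.
  set ρ : ℝ := p ^ (1 / (p - 2)) with hρ
  have hρ0 : 0 < ρ := Real.rpow_pos_of_pos (by linarith) _
  have hρp : ρ ^ (p - 2) = p := by
    rw [hρ, ← Real.rpow_mul (by linarith), one_div, inv_mul_cancel₀ (by linarith), Real.rpow_one]
  set R₁ := ρ + 2 * |E| + 1 with hR₁
  have hE0 := abs_nonneg E
  have hE1 := le_abs_self E
  have hu : ∀ u v, energy p u v ≤ E → |u| < R₁ := by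
    intro u v h
    by_contra hcon
    rw [not_lt] at hcon
    have h1 : p ≤ |u| ^ (p - 2) := by
      calc p = ρ ^ (p - 2) := hρp.symm
        _ ≤ _ := Real.rpow_le_rpow hρ0.le (by linarith) (by linarith)
    have h2 : u ^ 2 ≤ |u| ^ p / p := by
      rw [abs_rpow_eq_mul_sq hp, le_div_iff₀ (by linarith), mul_comm]
      exact mul_le_mul_of_nonneg_right h1 (sq_nonneg u)
    rw [energy] at h
    have h3 : (2 * |E| + 1) ^ 2 ≤ |u| ^ 2 := by
      gcongr
      linarith
    rw [sq_abs] at h3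
    nlinarith [sq_nonneg v]
  refine ⟨R₁ + 2 * |E| + 1, by positivity, fun u v h => ⟨by linarith [hu u v h], ?_⟩⟩
  have h1 := hu u v h
  have h2 : 0 ≤ |u| ^ p / p := by have : 0 < p := by linarith
                                  positivity
  rw [energy] at h
  have h3 : u ^ 2 < R₁ ^ 2 := by
    rw [← sq_abs]
    exact pow_lt_pow_left₀ h1 (abs_nonneg u) two_ne_zero
  have hR₁0 : 0 < R₁ := by positivity
  refine abs_lt_of_sq_lt_sq ?_ (by positivity)
  nlinarith

/-- Global existence for the initial value problem. -/
lemma exists_isSol (hp : 2 < p) (c d : ℝ) {b : ℝ} (hb : 0 < b) :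
    ∃ u v, IsSol p (Icc 0 b) u v ∧ u 0 = c ∧ v 0 = d := by
  set E := energy p c d with hE
  obtain ⟨R, hR0, hR⟩ := exists_bound_of_energy hp E
  -- Truncation at the a priori bound `R` makes the field globally bounded and Lipschitz, so
  -- Picard–Lindelöf reaches `b` at once; energy conservation then shows that the truncation is
  -- never active.
  set q : ℝ → ℝ := fun x => max (-R) (min x R) with hq
  have hq1 : LipschitzWith 1 q := (LipschitzWith.id.min_const R).const_max (-R)
  have hqmem : ∀ x, q x ∈ Icc (-R) R := fun x =>
    ⟨le_max_left _ _, max_le (by linarith) (min_le_right _ _)⟩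
  have hqeq : ∀ x, |x| ≤ R → q x = x := fun x hx => by
    rw [abs_le] at hx
    simp [hq, min_eq_left hx.2, max_eq_right hx.1]
  obtain ⟨K, hK⟩ := exists_lipschitzOnWith_force hp R
  set F : ℝ × ℝ → ℝ × ℝ := fun z => (q z.2, force p (q z.1)) with hF
  have hFlip : LipschitzWith (max 1 K) F := by
    have h1 : LipschitzWith 1 (fun z : ℝ × ℝ => q z.2) := by
      simpa [Function.comp_def] using hq1.comp (LipschitzWith.prod_snd (α := ℝ) (β := ℝ))
    have h2 : LipschitzWith K (fun z : ℝ × ℝ => force p (q z.1)) := by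
      have := hK.comp (f := fun z : ℝ × ℝ => q z.1) (s := univ)
        (hq1.comp LipschitzWith.prod_fst).lipschitzOnWith (fun z _ => hqmem z.1)
      simpa [Function.comp_def] using lipschitzOnWith_univ.1 this
    exact h1.prodMk h2
  obtain ⟨M, hM⟩ := (isCompact_Icc (a := -R) (b := R)).exists_bound_of_continuousOn
    (continuous_force hp).continuousOn
  set L : ℝ := max R M
  have hL0 : 0 ≤ L := hR0.le.trans (le_max_left _ _)
  have hFL : ∀ z, ‖F z‖ ≤ L := fun z => by
    rw [Prod.norm_def]
    exact max_le ((abs_le.2 (hqmem z.2)).trans (le_max_left _ _))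
      ((hM _ (hqmem z.1)).trans (le_max_right _ _))
  have hPL : IsPicardLindelof (fun _ => F) (⟨0, ⟨le_rfl, hb.le⟩⟩ : Icc (0 : ℝ) b) (c, d)
      ⟨L * b, by positivity⟩ 0 ⟨L, hL0⟩ (max 1 K) :=
    IsPicardLindelof.of_time_independent (fun z _ => hFL z) hFlip.lipschitzOnWith (by
      simp [hb.le]
      rfl)
  obtain ⟨α, hα0, hα⟩ := hPL.exists_eq_forall_mem_Icc_hasDerivWithinAt₀
  simp only at hα0
  set u : ℝ → ℝ := fun x => (α x).1
  set v : ℝ → ℝ := fun x => (α x).2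
  have hud : ∀ x ∈ Icc 0 b, HasDerivWithinAt u (q (v x)) (Icc 0 b) x := fun x hx => (hα x hx).fst
  have hvd : ∀ x ∈ Icc 0 b, HasDerivWithinAt v (force p (q (u x))) (Icc 0 b) x :=
    fun x hx => (hα x hx).snd
  have hu0 : u 0 = c := by simp [u, hα0]
  have hv0 : v 0 = d := by simp [v, hα0]
  have huc : ContinuousOn u (Icc 0 b) := fun x hx => (hud x hx).continuousWithinAt
  have hvc : ContinuousOn v (Icc 0 b) := fun x hx => (hvd x hx).continuousWithinAt
  have hEc : ContinuousOn (fun x => energy p (u x) (v x)) (Icc 0 b) :=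
    (((hvc.pow 2).div_const 2).sub ((huc.pow 2).div_const 2)).add
      (((continuous_abs_rpow (by linarith)).comp_continuousOn huc).div_const p)
  -- Continuous induction: the set is closed, and at each of its points the bounds by `R` are
  -- strict, so the truncation is inactive just to the right and the energy is conserved there.
  have hsub : Icc 0 b ⊆ {x | energy p (u x) (v x) = E} := by
    refine IsClosed.Icc_subset_of_forall_mem_nhdsWithin ?_ ?_ fun x hx => ?_
    · rw [inter_comm]
      exact hEc.preimage_isClosed_of_isClosed isClosed_Icc isClosed_singleton
    · simp [hu0, hv0, hE]
    · have hxE : energy p (u x) (v x) = E := hx.1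
      have hbd := hR _ _ hxE.le
      have hxm : x ∈ Icc 0 b := ⟨hx.2.1, hx.2.2.le⟩
      have hmem : Icc 0 b ∈ 𝓝[≥] x := Icc_mem_nhdsGE_of_mem hx.2
      have h1 : ∀ᶠ y in 𝓝[≥] x, |u y| < R := by
        have := (huc x hxm).mono_of_mem_nhdsWithin hmem
        exact this.abs.eventually (gt_mem_nhds hbd.1)
      have h2 : ∀ᶠ y in 𝓝[≥] x, |v y| < R := by
        have := (hvc x hxm).mono_of_mem_nhdsWithin hmem
        exact this.abs.eventually (gt_mem_nhds hbd.2)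
      obtain ⟨ε, hε, hεs⟩ := mem_nhdsGE_iff_exists_Icc_subset.1
        (inter_mem (inter_mem h1 h2) hmem)
      have hsol : IsSol p (Icc x ε) u v := by
        intro y hy
        obtain ⟨⟨hy1, hy2⟩, hy3⟩ := hεs hy
        have e1 := (hud y hy3).mono (fun z hz => (hεs hz).2 : Icc x ε ⊆ Icc 0 b)
        have e2 := (hvd y hy3).mono (fun z hz => (hεs hz).2 : Icc x ε ⊆ Icc 0 b)
        rw [hqeq _ (le_of_lt hy2)] at e1
        rw [hqeq _ (le_of_lt hy1)] at e2
        exact ⟨e1, e2⟩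
      refine mem_of_superset (Ioo_mem_nhdsGT hε) fun y hy => ?_
      show energy p (u y) (v y) = E
      rw [← hxE]
      exact hsol.energy_eq hp (convex_Icc _ _) (Ioo_subset_Icc_self hy) ⟨le_rfl, le_of_lt hε⟩
  refine ⟨u, v, fun x hx => ?_, hu0, hv0⟩
  have hbd := hR _ _ (hsub hx).le
  have e1 := hud x hx
  have e2 := hvd x hx
  rw [hqeq _ hbd.2.le] at e1
  rw [hqeq _ hbd.1.le] at e2
  exact ⟨e1, e2⟩

/-! ### The shooting family and its dependence on the parameter -/

/-- A family of solutions on `[0, ℓ]` matching solitons on the half-lines through the vertex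
condition with weight `N`. -/
structure IsShooting (p N ℓ : ℝ) (U V : ℝ → ℝ → ℝ) : Prop where
  isSol : ∀ a, IsSol p (Icc 0 ℓ) (U a) (V a)
  init : ∀ a, U a 0 = soliton p a
  init_deriv : ∀ a, V a 0 = -(N * solitonDeriv p a)

namespace IsShooting

variable {N ℓ : ℝ} {U V : ℝ → ℝ → ℝ}

lemma exists_isShooting (hp : 2 < p) (N : ℝ) {ℓ : ℝ} (hℓ : 0 < ℓ) :
    ∃ U V, IsShooting p N ℓ U V := by
  choose U V h1 h2 h3 using fun a => exists_isSol hp (soliton p a) (-(N * solitonDeriv p a)) hℓ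
  exact ⟨U, V, h1, h2, h3⟩

/-- The soliton has zero energy and the weight only rescales the slope. For `N ≥ 1`, which is what
`H ≥ 2` provides, shooting solutions therefore have nonnegative energy. -/
lemma energy_init (hp : 2 < p) (h : IsShooting p N ℓ U V) (a : ℝ) :
    energy p (U a 0) (V a 0) = (N ^ 2 - 1) / 2 * solitonDeriv p a ^ 2 := by
  have := soliton_energy hp a
  rw [energy] at this
  rw [h.init, h.init_deriv, energy]
  linear_combination this

lemma solitonDeriv_sq_le (hp : 2 < p) (a : ℝ) : solitonDeriv p a ^ 2 ≤ amplitude p ^ 2 := by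
  rw [← sq_abs]
  have h1 := abs_solitonDeriv_le hp a
  have h2 := abs_le_amplitude_of_energy hp (soliton_energy hp a)
  rw [abs_of_pos (soliton_pos hp a)] at h2
  gcongr
  exact h1.trans h2

/-- The bound is independent of `ℓ`, which is what allows a length threshold valid for all longer
edges. -/
lemma exists_bound (hp : 2 < p) (hN : 1 ≤ N) : ∃ R, 0 < R ∧ ∀ {ℓ : ℝ} {U V : ℝ → ℝ → ℝ}, 0 < ℓ →
    IsShooting p N ℓ U V → ∀ a, ∀ x ∈ Icc 0 ℓ, |U a x| ≤ R ∧ |V a x| ≤ R := by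
  obtain ⟨R, hR0, hR⟩ := exists_bound_of_energy hp ((N ^ 2 - 1) / 2 * amplitude p ^ 2)
  refine ⟨R, hR0, fun {ℓ U V} hℓ h a x hx => ?_⟩
  have h1 : energy p (U a x) (V a x) ≤ (N ^ 2 - 1) / 2 * amplitude p ^ 2 := by
    rw [(h.isSol a).energy_eq hp (convex_Icc _ _) hx ⟨le_rfl, hℓ.le⟩, h.energy_init hp]
    have : 0 ≤ (N ^ 2 - 1) / 2 := by nlinarith
    exact mul_le_mul_of_nonneg_left (solitonDeriv_sq_le hp a) this
  exact ⟨(hR _ _ h1).1.le, (hR _ _ h1).2.le⟩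

lemma continuousOn (hp : 2 < p) (hN : 1 ≤ N) (hℓ : 0 < ℓ) (h : IsShooting p N ℓ U V) :
    ContinuousOn (fun z : ℝ × ℝ => (U z.1 z.2, V z.1 z.2)) (univ ×ˢ Icc 0 ℓ) := by
  obtain ⟨R, _, hR⟩ := exists_bound hp hN
  obtain ⟨K, hK0, hK⟩ := exists_dist_le hp R
  have hinit : Continuous fun a => (soliton p a, -(N * solitonDeriv p a)) :=
    (continuous_soliton hp).prodMk (continuous_const.mul (continuous_solitonDeriv hp)).neg
  rintro ⟨a, x⟩ ⟨-, hx⟩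
  have h1 : Tendsto (fun z : ℝ × ℝ => (U a z.2, V a z.2)) (𝓝[univ ×ˢ Icc 0 ℓ] (a, x))
      (𝓝 (U a x, V a x)) := by
    have hc := ((h.isSol a).continuousOn.prodMk (h.isSol a).continuousOn_deriv) x hx
    refine hc.tendsto.comp (tendsto_nhdsWithin_iff.2 ⟨continuous_snd.continuousAt.tendsto.mono_left
      nhdsWithin_le_nhds, ?_⟩)
    filter_upwards [self_mem_nhdsWithin] with z hz using hz.2
  have h2 : Tendsto (fun z : ℝ × ℝ => dist (U a z.2, V a z.2) (U z.1 z.2, V z.1 z.2))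
      (𝓝[univ ×ˢ Icc 0 ℓ] (a, x)) (𝓝 0) := by
    have h3 : Tendsto (fun z : ℝ × ℝ => dist (soliton p a, -(N * solitonDeriv p a))
        (soliton p z.1, -(N * solitonDeriv p z.1)) * Real.exp (K * ℓ))
        (𝓝[univ ×ˢ Icc 0 ℓ] (a, x)) (𝓝 0) := by
      have hc : Continuous fun z : ℝ × ℝ => dist (soliton p a, -(N * solitonDeriv p a))
        (soliton p z.1, -(N * solitonDeriv p z.1)) * Real.exp (K * ℓ) :=
        (continuous_const.dist (hinit.comp continuous_fst)).mul continuous_const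
      have := (hc.tendsto (a, x)).mono_left
        (nhdsWithin_le_nhds (s := (univ : Set ℝ) ×ˢ Icc 0 ℓ))
      simpa using this
    refine squeeze_zero' (Eventually.of_forall fun _ => dist_nonneg) ?_ h3
    filter_upwards [self_mem_nhdsWithin] with z hz
    have := hK (h.isSol a) (h.isSol z.1) (fun y hy => (hR hℓ h a y hy).1)
      (fun y hy => (hR hℓ h z.1 y hy).1) z.2 hz.2
    simpa only [h.init, h.init_deriv] using this
  exact (tendsto_iff_of_dist h2).1 h1

end IsShooting

end SingleKnotGraph

namespace SingleKnotGraph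

/-! ### Existence of shooting parameters -/

variable {p : ℝ}

/-- A trajectory of nonnegative energy thus cannot have zero slope at a nonzero height of absolute
value at most `1`. -/
lemma energy_neg_of_abs_lt_one (hp : 2 < p) {u : ℝ} (hu0 : u ≠ 0) (hu1 : |u| ≤ 1) :
    energy p u 0 < 0 := by
  have h1 : |u| ^ (p - 2) ≤ 1 := Real.rpow_le_one (abs_nonneg u) hu1 (by linarith)
  have h2 : 0 < u ^ 2 := by positivity
  have h3 : |u| ^ p ≤ u ^ 2 := by
    rw [abs_rpow_eq_mul_sq hp]
    nlinarith
  have h4 : |u| ^ p / p < u ^ 2 / 2 := by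
    rw [div_lt_div_iff₀ (by linarith) (by norm_num)]
    nlinarith
  rw [energy]
  linarith

namespace IsSol

variable {u v : ℝ → ℝ} {b : ℝ}

/-- A solution of nonnegative energy increases as long as it stays in `(-1, 1)`. -/
lemma deriv_pos_of_abs_lt_one (hp : 2 < p) (h : IsSol p (Icc 0 b) u v) (hu0 : u 0 ≠ 0)
    (hv0 : 0 < v 0) (hE : 0 ≤ energy p (u 0) (v 0)) (hu : ∀ x ∈ Icc 0 b, |u x| < 1) :
    ∀ x ∈ Icc 0 b, 0 < v x := by
  intro x hx
  by_contra hcon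
  rw [not_lt] at hcon
  -- At a zero of `v`, nonnegative energy leaves only `u y = 0`; backward uniqueness then makes `u`
  -- vanish at `0`.
  obtain ⟨y, hy, hvy⟩ := intermediate_value_Icc' hx.1
    (h.continuousOn_deriv.mono (Icc_subset_Icc_right hx.2)) (⟨hcon, hv0.le⟩ : (0 : ℝ) ∈ Icc (v x) (v 0))
  have hy' : y ∈ Icc 0 b := ⟨hy.1, hy.2.trans hx.2⟩
  have hEy := h.energy_eq hp (convex_Icc 0 b) ⟨le_rfl, hy'.1.trans hy'.2⟩ hy'
  rw [hvy] at hEy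
  have huy : u y = 0 := by
    by_contra hne
    have := energy_neg_of_abs_lt_one hp hne (hu y hy').le
    linarith
  have hrefl := (h.mono (Icc_subset_Icc_right hy'.2)).reflect
  have := (eqOn_Icc hp hrefl (IsSol.zero p _) (by simp [huy]) (by simp [hvy])).1 ⟨hy.1, le_rfl⟩
  simp only [sub_self] at this
  exact hu0 this

end IsSol

/-- A solution of nonnegative energy with positive initial value stops increasing in finite time. -/
lemma exists_time_deriv_nonpos (hp : 2 < p) {c R : ℝ} (hc : 0 < c) (hR : 0 < R) :
    ∃ T, 0 < T ∧ ∀ {u v : ℝ → ℝ}, IsSol p (Icc 0 T) u v → u 0 = c →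
      0 ≤ energy p (u 0) (v 0) → (∀ x ∈ Icc 0 T, |v x| ≤ R) → ∃ x ∈ Icc 0 T, v x ≤ 0 := by
  have hA := one_lt_amplitude hp
  -- Any level strictly between the equilibrium `1` and the amplitude works. Below `β`, nonnegative
  -- energy forces slope at least `d`, so an increasing `u` reaches `β` by time `β / d`; above `β`,
  -- `v' ≤ -κ` uses up a slope of at most `R` within a further time `R / κ`.
  set β := (1 + amplitude p) / 2 with hβ
  have hβ1 : 1 < β := by linarith
  have hβA : β < amplitude p := by linarith
  have hp2 : 0 < p - 2 := by linarith
  have hβp : β ^ (p - 2) < p / 2 := by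
    rw [← amplitude_rpow hp]
    exact Real.rpow_lt_rpow (by linarith) hβA hp2
  have hβp1 : 1 < β ^ (p - 2) := Real.one_lt_rpow hβ1 hp2
  set κ := β * (β ^ (p - 2) - 1) with hκ
  have hκ0 : 0 < κ := mul_pos (by linarith) (by linarith)
  set m := 1 - 2 / p * β ^ (p - 2) with hm
  have hm0 : 0 < m := by
    have : 2 / p * β ^ (p - 2) < 2 / p * (p / 2) := by gcongr
    rw [show 2 / p * (p / 2) = 1 by field_simp] at this
    linarith
  set d := c * √m with hd
  have hd0 : 0 < d := mul_pos hc (Real.sqrt_pos.2 hm0)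
  set T₁ := β / d with hT₁
  have hT₁0 : 0 < T₁ := div_pos (by linarith) hd0
  set T := T₁ + R / κ with hT
  have hRκ : 0 < R / κ := by positivity
  refine ⟨T, by positivity, fun {u v} h hu0 hE hvR => ?_⟩
  by_contra hcon
  push Not at hcon
  have hT₁T : T₁ ≤ T := by linarith
  have hcu := h.continuousOn
  have hcv := h.continuousOn_deriv
  have hud : ∀ x ∈ Ioo 0 T, HasDerivAt u (v x) x := fun x hx =>
    (h x (Ioo_subset_Icc_self hx)).1.hasDerivAt (Icc_mem_nhds hx.1 hx.2)
  have hvd : ∀ x ∈ Ioo 0 T, HasDerivAt v (force p (u x)) x := fun x hx =>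
    (h x (Ioo_subset_Icc_self hx)).2.hasDerivAt (Icc_mem_nhds hx.1 hx.2)
  have hmono : MonotoneOn u (Icc 0 T) := by
    refine monotoneOn_of_hasDerivWithinAt_nonneg (f' := v) (convex_Icc 0 T) hcu
      (fun x hx => ?_) (fun x hx => ?_)
    · rw [interior_Icc] at hx
      exact (hud x hx).hasDerivWithinAt
    · exact (hcon x (interior_subset hx)).le
  have h0T : (0 : ℝ) ∈ Icc 0 T := ⟨le_rfl, by positivity⟩
  have hT₁m : T₁ ∈ Icc 0 T := ⟨hT₁0.le, hT₁T⟩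
  have hcu' : ∀ x ∈ Icc 0 T, c ≤ u x := fun x hx => by
    rw [← hu0]; exact hmono h0T hx hx.1
  have hβu : β ≤ u T₁ := by
    by_contra hlt
    rw [not_le] at hlt
    have hdv : ∀ x ∈ Icc 0 T₁, d ≤ v x := by
      intro x hx
      have hxT : x ∈ Icc 0 T := ⟨hx.1, hx.2.trans hT₁T⟩
      have hux := hcu' x hxT
      have huβ : u x ≤ β := (hmono hxT hT₁m hx.2).trans hlt.le
      have hE' := h.energy_eq hp (convex_Icc 0 T) h0T hxT
      rw [hE', energy, abs_rpow_eq_mul_sq hp, abs_of_pos (hc.trans_le hux)] at hE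
      have h1 : u x ^ (p - 2) ≤ β ^ (p - 2) :=
        Real.rpow_le_rpow (hc.le.trans hux) huβ hp2.le
      have h2 : u x ^ (p - 2) * u x ^ 2 / p ≤ β ^ (p - 2) * u x ^ 2 / p := by gcongr
      have h3 : u x ^ 2 * m ≤ v x ^ 2 := by
        have : u x ^ 2 * m = u x ^ 2 - 2 * (β ^ (p - 2) * u x ^ 2 / p) := by
          rw [hm]; ring
        linarith
      have h4 : d ^ 2 ≤ v x ^ 2 := by
        rw [hd, mul_pow, Real.sq_sqrt hm0.le]
        refine le_trans ?_ h3
        gcongr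
      exact (le_abs_self d).trans (abs_le_of_sq_le_sq h4 (hcon x hxT).le)
    have hmon : MonotoneOn (fun x => u x - d * x) (Icc 0 T₁) := by
      refine monotoneOn_of_hasDerivWithinAt_nonneg (f' := fun x => v x - d) (convex_Icc 0 T₁)
        ((hcu.mono (Icc_subset_Icc_right hT₁T)).sub (by fun_prop)) (fun x hx => ?_) (fun x hx => ?_)
      · rw [interior_Icc] at hx
        have := (hud x ⟨hx.1, hx.2.trans_le hT₁T⟩).sub ((hasDerivAt_id x).const_mul d)
        exact (this.congr_deriv (by simp)).hasDerivWithinAt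
      · linarith [hdv x (interior_subset hx)]
    have h5 := hmon ⟨le_rfl, hT₁0.le⟩ ⟨hT₁0.le, le_rfl⟩ hT₁0.le
    have h6 : d * T₁ = β := mul_div_cancel₀ _ hd0.ne'
    simp only [mul_zero, sub_zero, hu0, h6] at h5
    linarith
  have hforce : ∀ x ∈ Icc T₁ T, force p (u x) ≤ -κ := by
    intro x hx
    have hxT : x ∈ Icc 0 T := ⟨hT₁0.le.trans hx.1, hx.2⟩
    have hux : β ≤ u x := hβu.trans (hmono hT₁m hxT hx.1)
    have hu0' : 0 < u x := by linarith
    have h1 : β ^ (p - 2) ≤ u x ^ (p - 2) := Real.rpow_le_rpow (by linarith) hux hp2.le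
    rw [force, abs_of_pos hu0', hκ]
    nlinarith
  have hanti : AntitoneOn (fun x => v x + κ * x) (Icc T₁ T) := by
    refine antitoneOn_of_hasDerivWithinAt_nonpos (f' := fun x => force p (u x) + κ)
      (convex_Icc T₁ T) ((hcv.mono (Icc_subset_Icc_left hT₁0.le)).add (by fun_prop))
      (fun x hx => ?_) (fun x hx => ?_)
    · rw [interior_Icc] at hx
      have := (hvd x ⟨hT₁0.trans hx.1, hx.2⟩).add ((hasDerivAt_id x).const_mul κ)
      exact (this.congr_deriv (by simp)).hasDerivWithinAt
    · linarith [hforce x (interior_subset hx)]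
  have h7 := hanti ⟨le_rfl, hT₁T⟩ ⟨hT₁T, le_rfl⟩ hT₁T
  have h8 := (le_abs_self _).trans (hvR T₁ hT₁m)
  have h9 := hcon T ⟨by positivity, le_rfl⟩
  have h10 : κ * T = κ * T₁ + R := by rw [hT]; field_simp
  simp only at h7
  linarith

namespace IsShooting

variable {N ℓ : ℝ} {U V : ℝ → ℝ → ℝ}

lemma energy_nonneg (hp : 2 < p) (hN : 1 ≤ N) (h : IsShooting p N ℓ U V) (a : ℝ) :
    0 ≤ energy p (U a 0) (V a 0) := by
  rw [h.energy_init hp]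
  have : 0 ≤ (N ^ 2 - 1) / 2 := by nlinarith
  positivity

lemma deriv_init_pos (hp : 2 < p) (hN : 1 ≤ N) (h : IsShooting p N ℓ U V) {a : ℝ} (ha : 0 < a) :
    0 < V a 0 := by
  rw [h.init_deriv]
  have := mul_neg_of_pos_of_neg (by linarith : 0 < N) (solitonDeriv_neg_of_pos hp ha)
  linarith

lemma continuousOn_fst (hp : 2 < p) (hN : 1 ≤ N) (hℓ : 0 < ℓ) (h : IsShooting p N ℓ U V) :
    ContinuousOn (fun z : ℝ × ℝ => U z.1 z.2) (univ ×ˢ Icc 0 ℓ) :=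
  continuous_fst.comp_continuousOn (h.continuousOn hp hN hℓ)

lemma continuousOn_snd (hp : 2 < p) (hN : 1 ≤ N) (hℓ : 0 < ℓ) (h : IsShooting p N ℓ U V) :
    ContinuousOn (fun z : ℝ × ℝ => V z.1 z.2) (univ ×ˢ Icc 0 ℓ) :=
  continuous_snd.comp_continuousOn (h.continuousOn hp hN hℓ)

lemma continuous_section {W : ℝ → ℝ → ℝ}
    (h : ContinuousOn (fun z : ℝ × ℝ => W z.1 z.2) (univ ×ˢ Icc 0 ℓ)) {x : ℝ} (hx : x ∈ Icc 0 ℓ) :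
    Continuous fun a => W a x :=
  h.comp_continuous (continuous_id.prodMk continuous_const) fun _ => ⟨trivial, hx⟩

/-- For large parameters the solution is still increasing at the end of the edge. -/
lemma exists_forall_deriv_pos (hp : 2 < p) (hN : 1 ≤ N) (hℓ : 0 < ℓ) (h : IsShooting p N ℓ U V) :
    ∃ A, ∀ a, A ≤ a → ∀ x ∈ Icc 0 ℓ, 0 < V a x := by
  obtain ⟨R, hR0, hR⟩ := exists_bound hp hN
  obtain ⟨K, hK0, hK⟩ := exists_dist_le hp R
  -- The initial data have size at most `N φ(a)`, and Gronwall's comparison with the zero solution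
  -- keeps `|U a|` below `1` on the whole edge.
  have hlim : Tendsto (fun a => N * soliton p a * Real.exp (K * ℓ)) atTop (𝓝 0) := by
    simpa using ((tendsto_soliton hp).const_mul N).mul_const (Real.exp (K * ℓ))
  obtain ⟨A, hA⟩ := eventually_atTop.1 (hlim.eventually (gt_mem_nhds one_pos))
  refine ⟨max A 1, fun a ha => ?_⟩
  have ha0 : 0 < a := lt_of_lt_of_le one_pos ((le_max_right _ _).trans ha)
  refine (h.isSol a).deriv_pos_of_abs_lt_one hp ?_ (h.deriv_init_pos hp hN ha0)
    (h.energy_nonneg hp hN a) fun x hx => ?_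
  · rw [h.init]; exact (soliton_pos hp a).ne'
  · have h1 := hK (h.isSol a) (IsSol.zero p (Icc 0 ℓ)) (fun y hy => (hR hℓ h a y hy).1)
      (fun y _ => by simpa using hR0.le) x hx
    have h2 : dist (U a 0, V a 0) ((0 : ℝ), (0 : ℝ)) ≤ N * soliton p a := by
      have hs := soliton_pos hp a
      rw [h.init, h.init_deriv, Prod.dist_eq, dist_zero_right, dist_zero_right, Real.norm_eq_abs,
        Real.norm_eq_abs, abs_neg, abs_mul, abs_of_pos hs, abs_of_pos (by linarith : 0 < N)]
      refine max_le (by nlinarith) ?_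
      exact mul_le_mul_of_nonneg_left (abs_solitonDeriv_le hp a) (by linarith)
    calc |U a x| ≤ dist (U a x, V a x) ((0 : ℝ), (0 : ℝ)) := by
          rw [Prod.dist_eq, dist_zero_right, dist_zero_right]
          exact le_max_left _ _
      _ ≤ N * soliton p a * Real.exp (K * ℓ) := h1.trans (by gcongr)
      _ < 1 := hA a ((le_max_left _ _).trans ha)

/-- The mass of the `a`-th solution on `[0, ℓ]` depends continuously on `a`. -/
lemma continuous_mass (hp : 2 < p) (hN : 1 ≤ N) (hℓ : 0 < ℓ) (h : IsShooting p N ℓ U V) :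
    Continuous fun a => ∫ x in (0 : ℝ)..ℓ, |U a x| ^ p := by
  obtain ⟨R, hR0, hR⟩ := exists_bound hp hN
  refine intervalIntegral.continuous_of_dominated_interval (bound := fun _ => R ^ p)
    (fun a => ?_) (fun a => ?_) intervalIntegrable_const ?_
  · exact ((h.isSol a).intervalIntegrable_rpow hp hℓ.le).aestronglyMeasurable_restrict_uIoc
  · refine Eventually.of_forall fun x hx => ?_
    rw [uIoc_of_le hℓ.le] at hx
    rw [Real.norm_of_nonneg (by positivity)]
    exact Real.rpow_le_rpow (abs_nonneg _) (hR hℓ h a x (Ioc_subset_Icc_self hx)).1 (by linarith)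
  · refine Eventually.of_forall fun x hx => ?_
    rw [uIoc_of_le hℓ.le] at hx
    exact (continuous_abs_rpow (by linarith)).comp
      (continuous_section (h.continuousOn_fst hp hN hℓ) (Ioc_subset_Icc_self hx))

/-- The total mass is minimized among the parameters satisfying the Neumann condition. -/
lemma exists_min_mass (hp : 2 < p) (hN : 1 ≤ N) (hℓ : 0 < ℓ) (h : IsShooting p N ℓ U V) (m n : ℝ)
    (hne : ∃ a, 0 ≤ a ∧ V a ℓ = 0) :
    ∃ a, (0 ≤ a ∧ V a ℓ = 0) ∧ ∀ a', 0 ≤ a' → V a' ℓ = 0 →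
      m * (∫ x in (0 : ℝ)..ℓ, |U a x| ^ p) + n * solitonMass p a ≤
        m * (∫ x in (0 : ℝ)..ℓ, |U a' x| ^ p) + n * solitonMass p a' := by
  have hℓm : ℓ ∈ Icc 0 ℓ := ⟨hℓ.le, le_rfl⟩
  obtain ⟨A, hA⟩ := h.exists_forall_deriv_pos hp hN hℓ
  -- Large parameters violate the Neumann condition, so the admissible set is compact.
  set K := Icc 0 A ∩ {a | V a ℓ = 0} with hK
  have hKc : IsCompact K := isCompact_Icc.inter_right
    (isClosed_eq (continuous_section (h.continuousOn_snd hp hN hℓ) hℓm) continuous_const)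
  have hmem : ∀ a, 0 ≤ a → V a ℓ = 0 → a ∈ K := fun a ha hV =>
    ⟨⟨ha, le_of_not_ge fun hle => (hA a hle ℓ hℓm).ne' hV⟩, hV⟩
  obtain ⟨a₀, ha₀, hV₀⟩ := hne
  obtain ⟨a, ha, hmin⟩ := hKc.exists_isMinOn ⟨a₀, hmem a₀ ha₀ hV₀⟩
    (f := fun a => m * (∫ x in (0 : ℝ)..ℓ, |U a x| ^ p) + n * solitonMass p a)
    ((continuous_const.mul (h.continuous_mass hp hN hℓ)).add
      (continuous_const.mul (continuous_solitonMass hp))).continuousOn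
  exact ⟨a, ⟨ha.1.1, ha.2⟩, fun a' h1 h2 => hmin (hmem a' h1 h2)⟩

/-- On a long edge there is an increasing solution satisfying the Neumann condition. -/
lemma exists_increasing (hp : 2 < p) (hN : 1 ≤ N) {a₁ : ℝ} (ha₁ : 0 < a₁) :
    ∃ T, 0 < T ∧ ∀ {ℓ : ℝ} {U V : ℝ → ℝ → ℝ}, T ≤ ℓ → IsShooting p N ℓ U V →
      ∃ a, a₁ ≤ a ∧ V a ℓ = 0 ∧ ∀ x ∈ Icc 0 ℓ, 0 ≤ V a x := by
  obtain ⟨R, hR0, hR⟩ := exists_bound hp hN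
  obtain ⟨T, hT0, hT⟩ := exists_time_deriv_nonpos hp (soliton_pos hp a₁) hR0
  refine ⟨T, hT0, fun {ℓ U V} hTℓ h => ?_⟩
  have hℓ : 0 < ℓ := hT0.trans_le hTℓ
  have hsub : Icc 0 T ⊆ Icc 0 ℓ := Icc_subset_Icc_right hTℓ
  obtain ⟨x₁, hx₁, hVx₁⟩ := hT ((h.isSol a₁).mono hsub) (h.init a₁) (h.energy_nonneg hp hN a₁)
    fun x hx => (hR hℓ h a₁ x (hsub hx)).2
  obtain ⟨A, hA⟩ := h.exists_forall_deriv_pos hp hN hℓ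
  have hVc := h.continuousOn_snd hp hN hℓ
  -- Take the largest parameter whose slope is nonpositive somewhere. For larger ones the slope is
  -- positive, so in the limit it is nonnegative and touches zero at `x₀`; the claim is that `x₀ =
  -- ℓ`.
  set S : Set (ℝ × ℝ) := (Icc a₁ A ×ˢ Icc 0 ℓ) ∩ {z | V z.1 z.2 ≤ 0} with hS
  have hSc : IsCompact S := by
    have hc : IsCompact (Icc a₁ A ×ˢ Icc 0 ℓ) := isCompact_Icc.prod isCompact_Icc
    refine hc.of_isClosed_subset ?_ inter_subset_left
    exact (hVc.mono (prod_mono (subset_univ _) Subset.rfl)).preimage_isClosed_of_isClosed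
      hc.isClosed isClosed_Iic
  have hmem : ∀ a, a₁ ≤ a → ∀ x ∈ Icc 0 ℓ, V a x ≤ 0 → (a, x) ∈ S := fun a ha x hx hV =>
    ⟨⟨⟨ha, le_of_not_ge fun hle => (hA a hle x hx).not_ge hV⟩, hx⟩, hV⟩
  obtain ⟨⟨a, x₀⟩, ha, hmax⟩ := hSc.exists_isMaxOn
    ⟨_, hmem a₁ le_rfl x₁ (hsub hx₁) hVx₁⟩ (f := Prod.fst) continuous_fst.continuousOn
  have haa : a₁ ≤ a := ha.1.1.1
  have hx₀ : x₀ ∈ Icc 0 ℓ := ha.1.2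
  have ha0 : 0 < a := ha₁.trans_le haa
  have hpos : ∀ a', a < a' → ∀ x ∈ Icc 0 ℓ, 0 < V a' x := fun a' ha' x hx => by
    by_contra hcon
    have := hmax (hmem a' (haa.trans ha'.le) x hx (not_lt.1 hcon))
    exact absurd ha' (not_lt.2 this)
  have hnn : ∀ x ∈ Icc 0 ℓ, 0 ≤ V a x := by
    intro x hx
    have hc : Tendsto (fun a' => V a' x) (𝓝[>] a) (𝓝 (V a x)) :=
      ((continuous_section hVc hx).tendsto a).mono_left nhdsWithin_le_nhds
    exact ge_of_tendsto hc (by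
      filter_upwards [self_mem_nhdsWithin] with a' ha' using (hpos a' ha' x hx).le)
  have hV0 : V a x₀ = 0 := le_antisymm ha.2 (hnn x₀ hx₀)
  refine ⟨a, haa, ?_, hnn⟩
  rcases hx₀.2.eq_or_lt with rfl | hlt
  · exact hV0
  -- An interior touching point minimizes the slope, so the force vanishes there. This puts the
  -- height in `(0, 1]` with zero slope, where the energy is negative.
  exfalso
  have hx₀0 : 0 < x₀ := by
    refine lt_of_le_of_ne hx₀.1 fun h0 => ?_
    rw [← h0] at hV0
    exact (h.deriv_init_pos hp hN ha0).ne' hV0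
  have hn : Icc 0 ℓ ∈ 𝓝 x₀ := Icc_mem_nhds hx₀0 hlt
  have hmin : IsLocalMin (V a) x₀ := by
    filter_upwards [hn] with x hx
    rw [hV0]; exact hnn x hx
  have hforce : force p (U a x₀) = 0 :=
    hmin.hasDerivAt_eq_zero (((h.isSol a) x₀ hx₀).2.hasDerivAt hn)
  have hmono : MonotoneOn (U a) (Icc 0 ℓ) := by
    refine monotoneOn_of_hasDerivWithinAt_nonneg (f' := V a) (convex_Icc 0 ℓ)
      (h.isSol a).continuousOn (fun x hx => ?_) (fun x hx => hnn x (interior_subset hx))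
    rw [interior_Icc] at hx ⊢
    exact ((h.isSol a) x (Ioo_subset_Icc_self hx)).1.mono Ioo_subset_Icc_self
  have hU0 : 0 < U a x₀ := by
    have := hmono ⟨le_rfl, hℓ.le⟩ hx₀ hx₀.1
    rw [h.init] at this
    exact (soliton_pos hp a).trans_le this
  have hU1 : U a x₀ ≤ 1 := by
    by_contra hcon
    have h1 : 1 < U a x₀ ^ (p - 2) := Real.one_lt_rpow (not_le.1 hcon) (by linarith)
    rw [force, abs_of_pos hU0] at hforce
    nlinarith
  have hE := h.energy_nonneg hp hN a
  rw [(h.isSol a).energy_eq hp (convex_Icc 0 ℓ) ⟨le_rfl, hℓ.le⟩ hx₀, hV0] at hE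
  have := energy_neg_of_abs_lt_one hp hU0.ne' (by rwa [abs_of_pos hU0])
  linarith

/-- On a long edge there is a parameter satisfying the Neumann condition whose action is close to
that of half a soliton. -/
lemma exists_small_action (hp : 2 < p) (hN : 1 ≤ N) {ε : ℝ} (hε : 0 < ε) :
    ∃ T, 0 < T ∧ ∀ {ℓ : ℝ} {U V : ℝ → ℝ → ℝ}, T ≤ ℓ → IsShooting p N ℓ U V →
      ∃ a, 0 ≤ a ∧ V a ℓ = 0 ∧ solitonMass p a ≤ ε ∧
        (1 / 2 - 1 / p) * ∫ x in (0 : ℝ)..ℓ, |U a x| ^ p ≤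
          (1 / 2 - 1 / p) * solitonMass p 0 + ε := by
  obtain ⟨R, hR0, hR⟩ := exists_bound hp hN
  -- This quantity controls both error terms of `IsSol.mass_le` with `S = N |φ'(a)|`: the `R` part
  -- bounds `S` times the rise of `U a`, the amplitude part the boundary product.
  have hlim : Tendsto (fun a => N * soliton p a * (R + amplitude p)) atTop (𝓝 0) := by
    simpa using ((tendsto_soliton hp).const_mul N).mul_const (R + amplitude p)
  obtain ⟨a₁, ha₁, ha₁ε, ha₁m⟩ := ((eventually_gt_atTop 0).and
    ((hlim.eventually (gt_mem_nhds hε)).and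
      ((tendsto_solitonMass hp).eventually (gt_mem_nhds hε)))).exists
  obtain ⟨T, hT0, hT⟩ := exists_increasing hp hN ha₁
  refine ⟨T, hT0, fun {ℓ U V} hTℓ h => ?_⟩
  have hℓ : 0 < ℓ := hT0.trans_le hTℓ
  obtain ⟨a, haa, hVa, hnn⟩ := hT hTℓ h
  have ha0 : 0 < a := ha₁.trans_le haa
  refine ⟨a, ha0.le, hVa, (antitone_solitonMass hp haa).trans ha₁m.le, ?_⟩
  have hs := soliton_pos hp a
  have hd := abs_solitonDeriv_le hp a
  have hle := (h.isSol a).mass_le hp hℓ.le (by rw [h.init]; exact hs.le) hnn hVa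
    (h.energy_nonneg hp hN a) (S := N * |solitonDeriv p a|) (by positivity) (by
      rw [h.energy_init hp, mul_pow, sq_abs]
      nlinarith [sq_nonneg (solitonDeriv p a)])
  rw [solitonMass_zero_eq hp]
  refine hle.trans ?_
  have hUR := (le_abs_self _).trans (hR hℓ h a ℓ ⟨hℓ.le, le_rfl⟩).1
  have hV0 : V a 0 ≤ N * soliton p a := by
    rw [h.init_deriv]
    have := mul_le_mul_of_nonneg_left ((neg_le_abs _).trans hd) (by linarith : 0 ≤ N)
    linarith
  have hsa : soliton p a ≤ soliton p a₁ := soliton_antitoneOn hp ha₁.le ha0.le haa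
  have hsA : soliton p a ≤ amplitude p := by
    rw [← soliton_zero]; exact soliton_antitoneOn hp (mem_Ici.2 le_rfl) ha0.le ha0.le
  have hN0 : 0 < N := by linarith
  have e1 : N * |solitonDeriv p a| * (U a ℓ - U a 0) ≤ N * soliton p a₁ * R := by
    rw [h.init]
    calc N * |solitonDeriv p a| * (U a ℓ - soliton p a) ≤ N * |solitonDeriv p a| * R := by
          gcongr; linarith
      _ ≤ N * soliton p a₁ * R := by gcongr; exact hd.trans hsa
  have e2 : 1 / 2 * (U a 0 * V a 0) ≤ N * soliton p a₁ * amplitude p := by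
    rw [h.init]
    have f1 : soliton p a * V a 0 ≤ amplitude p * (N * soliton p a₁) :=
      mul_le_mul hsA (hV0.trans (by gcongr)) (h.deriv_init_pos hp hN ha0).le (amplitude_pos hp).le
    have f2 := mul_pos hs (h.deriv_init_pos hp hN ha0)
    nlinarith
  nlinarith

/-- With unit weight the solution of the shooting problem is a translated soliton. -/
lemma eq_soliton_of_weight_one (hp : 2 < p) (h : IsShooting p 1 ℓ U V) (a : ℝ) :
    EqOn (U a) (fun x => soliton p (x + -a)) (Icc 0 ℓ) ∧
      EqOn (V a) (fun x => solitonDeriv p (x + -a)) (Icc 0 ℓ) :=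
  (h.isSol a).eqOn_Icc hp (isSol_soliton hp (-a) _) (by simp [h.init, soliton_neg])
    (by simp [h.init_deriv, solitonDeriv_neg])

/-- For `a = ℓ` the solution is `φ(x - ℓ)`, with its peak at the Neumann point. Each compact edge
completes a half-line tail to half a soliton, so the total is exact for every length. -/
lemma exists_action_of_weight_one (hp : 2 < p) (hℓ : 0 < ℓ) (h : IsShooting p 1 ℓ U V) :
    ∃ a, 0 ≤ a ∧ V a ℓ = 0 ∧
      2 * (∫ x in (0 : ℝ)..ℓ, |U a x| ^ p) + 2 * solitonMass p a = 2 * solitonMass p 0 := by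
  have hℓm : ℓ ∈ Icc 0 ℓ := ⟨hℓ.le, le_rfl⟩
  obtain ⟨h1, h2⟩ := h.eq_soliton_of_weight_one hp ℓ
  refine ⟨ℓ, hℓ.le, by simp [h2 hℓm, solitonDeriv_zero], ?_⟩
  have h3 : ∫ x in (0 : ℝ)..ℓ, |U ℓ x| ^ p = ∫ x in (0 : ℝ)..ℓ, |soliton p x| ^ p := by
    rw [intervalIntegral.integral_congr (g := fun x => |soliton p (ℓ - x)| ^ p) fun x hx => ?_]
    · rw [intervalIntegral.integral_comp_sub_left (fun x => |soliton p x| ^ p)]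
      simp
    · rw [uIcc_of_le hℓ.le] at hx
      simp only [h1 hx]
      rw [← soliton_neg]
      ring_nf
  rw [h3, solitonMass_eq hp ℓ]
  ring

end IsShooting

end SingleKnotGraph

namespace SingleKnotGraph

/-! ### Bound-states and their half-lines -/

variable {p ℓ : ℝ} {H P L : ℕ}

lemma integral_eq_sum (G : SingleKnotGraph H P L) (f : Edge H P L → ℝ → ℝ) :
    G.integral f = (∑ i, ∫ x in (0 : ℝ)..G.pendantLength i, f (pendant i) x) +
      ((∑ j, ∫ x in (0 : ℝ)..G.loopLength j, f (loop j) x) +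
        ∑ k, ∫ x in Ioi 0, f (halfLine k) x) := by
  have h : ∀ {b : ℝ} (g : ℝ → ℝ), 0 < b → ∫ x in (0 : ℝ)..b, g x = ∫ x in Ioo 0 b, g x :=
    fun g hb => by rw [intervalIntegral.integral_of_le hb.le, integral_Ioc_eq_integral_Ioo]
  simp only [SingleKnotGraph.integral, Fintype.sum_sum_type, openEdge,
    h _ (G.pendantLength_pos _), h _ (G.loopLength_pos _)]

section Shifts

variable {a : ℝ} {t : Fin H → ℝ}

lemma solitonMass_le_of_shift (hp : 2 < p) (ha : 0 ≤ a) {s : ℝ} (hs : s = a ∧ 0 < a ∨ s = -a) :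
    solitonMass p a ≤ solitonMass p s :=
  antitone_solitonMass hp (by rcases hs with h | h <;> linarith [h])

/-- A half-line with shift `-a` pairs with any other one, whose mass is at least that for shift `a`.
-/
lemma two_mul_solitonMass_le_sum (hp : 2 < p) (hH : 2 ≤ H) (ha : 0 ≤ a)
    (ht : ∀ k, t k = a ∧ 0 < a ∨ t k = -a) (hex : ∃ k, t k = -a) :
    2 * solitonMass p 0 ≤ ∑ k, solitonMass p (t k) := by
  obtain ⟨k, hk⟩ := hex
  have := Fin.nontrivial_iff_two_le.2 hH
  obtain ⟨j, hj⟩ := exists_ne k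
  have h1 : ∑ i ∈ {k, j}, solitonMass p (t i) ≤ ∑ i, solitonMass p (t i) :=
    Finset.sum_le_univ_sum_of_nonneg fun i => solitonMass_nonneg p _
  rw [Finset.sum_pair hj.symm, hk] at h1
  have h2 := solitonMass_neg_add hp a
  have h3 := solitonMass_le_of_shift hp ha (ht j)
  linarith

/-- One of the two half-lines with shift `-a` pairs with a third half-line to a full soliton; the
other still carries half a soliton. -/
lemma three_mul_solitonMass_le_sum (hp : 2 < p) (hH : 3 ≤ H) (ha : 0 ≤ a)
    (ht : ∀ k, t k = a ∧ 0 < a ∨ t k = -a) {k j : Fin H} (hkj : k ≠ j) (hk : t k = -a)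
    (hj : t j = -a) : 3 * solitonMass p 0 ≤ ∑ k, solitonMass p (t k) := by
  obtain ⟨i, -, hi⟩ := Finset.exists_mem_notMem_of_card_lt_card
    (s := {k, j}) (t := (Finset.univ : Finset (Fin H)))
    (by rw [Finset.card_pair hkj, Finset.card_univ, Fintype.card_fin]; omega)
  have h1 : ∑ i ∈ {i, k, j}, solitonMass p (t i) ≤ ∑ i, solitonMass p (t i) :=
    Finset.sum_le_univ_sum_of_nonneg fun i => solitonMass_nonneg p _
  rw [Finset.sum_insert hi, Finset.sum_pair hkj, hk, hj] at h1
  have h2 := solitonMass_neg_add hp a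
  have h3 := solitonMass_le_of_shift hp ha (ht i)
  have h4 : solitonMass p 0 ≤ solitonMass p (-a) := antitone_solitonMass hp (by linarith)
  linarith

/-- The sum is `(H - 2) φ'(a)`: one decreasing branch cancels the single rising one. -/
lemma sum_solitonDeriv_nonpos (hp : 2 < p) (hH : 2 ≤ H) {k : Fin H} (hk : t k = -a)
    (ht : ∀ j, j ≠ k → t j = a ∧ 0 < a) : ∑ j, solitonDeriv p (t j) ≤ 0 := by
  have := Fin.nontrivial_iff_two_le.2 hH
  obtain ⟨j, hj⟩ := exists_ne k
  have hd := solitonDeriv_neg_of_pos hp (ht j hj).2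
  have hjm : j ∈ Finset.univ.erase k := Finset.mem_erase.2 ⟨hj, Finset.mem_univ j⟩
  rw [← Finset.add_sum_erase _ _ (Finset.mem_univ k), ← Finset.add_sum_erase _ _ hjm, hk,
    (ht j hj).1, solitonDeriv_neg]
  have : ∑ i ∈ (Finset.univ.erase k).erase j, solitonDeriv p (t i) ≤ 0 := by
    refine Finset.sum_nonpos fun i hi => ?_
    have hik : i ≠ k := (Finset.mem_erase.1 (Finset.mem_erase.1 hi).2).1
    rw [(ht i hik).1]; exact hd.le
  linarith

end Shifts

section HalfLines

variable {G : SingleKnotGraph H P L} {u : H1Function G} {v : Edge H P L → ℝ → ℝ} {c : ℝ}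

/-- Since `σ` and `a` are read off from the common vertex value, half-lines can differ only in the
sign of the shift. -/
lemma IsClassical.exists_shifts (hp : 2 < p) (hv : IsClassical p u v)
    (hc : ∀ e, u.toFun e 0 = c) (hc0 : c ≠ 0) :
    ∃ σ a, (σ = 1 ∨ σ = -1) ∧ 0 ≤ a ∧ c = σ * soliton p a ∧ ∃ t : Fin H → ℝ,
      (∀ k, t k = a ∧ 0 < a ∨ t k = -a) ∧
      (∀ k, EqOn (u.toFun (halfLine k)) (fun x => σ * soliton p (x + t k)) (Ici 0)) ∧
      ∀ k, v (halfLine k) 0 = σ * solitonDeriv p (t k) := by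
  have hE := (hv (halfLine ⟨0, G.one_le_halfLines⟩)).1.energy_eq_zero hp
    (u.memLp (halfLine ⟨0, G.one_le_halfLines⟩)) (hv.memLp (halfLine ⟨0, G.one_le_halfLines⟩))
  rw [hc] at hE
  obtain ⟨σ, a, hσ, ha, hca⟩ := exists_soliton_data hp hc0 hE
  choose t h1 h2 h3 using fun k => (hv (halfLine k)).1.exists_shift hp (u.memLp (halfLine k))
    (hv.memLp (halfLine k)) hσ ha ((hc (halfLine k)).trans hca)
  exact ⟨σ, a, hσ, ha, hca, t, h1, h2, h3⟩

lemma IsClassical.halfLine_eq_zero (hp : 2 < p) (hv : IsClassical p u v) (hc : ∀ e, u.toFun e 0 = 0)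
    (k : Fin H) : EqOn (u.toFun (halfLine k)) (fun _ => 0) (Ici 0) ∧ v (halfLine k) 0 = 0 :=
  (hv (halfLine k)).1.eq_zero_of_Ici hp (u.memLp (halfLine k)) (hv.memLp (halfLine k)) (hc _)

end HalfLines

/-! ### Reflection-symmetric solutions -/

namespace IsSol

variable {u v : ℝ → ℝ}

/-- The reflected solution has the same data at the midpoint. Uniqueness forward from `ℓ` covers one
half, and substituting `2 * ℓ - x` the other. -/
lemma eq_reflect_of_deriv_eq_zero (hp : 2 < p) (hℓ : 0 < ℓ) (h : IsSol p (Icc 0 (2 * ℓ)) u v)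
    (hv : v ℓ = 0) :
    ∀ x ∈ Icc 0 (2 * ℓ), u (2 * ℓ - x) = u x ∧ v (2 * ℓ - x) = -v x := by
  have hsub : Icc ℓ (2 * ℓ) ⊆ Icc 0 (2 * ℓ) := Icc_subset_Icc_left hℓ.le
  have h2 : 2 * ℓ - ℓ = ℓ := by ring
  obtain ⟨e1, e2⟩ := (h.reflect.mono hsub).eqOn_Icc hp (h.mono hsub) (by simp [h2]) (by simp [h2, hv])
  intro x hx
  rcases le_total ℓ x with hle | hle
  · have e3 := e1 ⟨hle, hx.2⟩
    have e4 := e2 ⟨hle, hx.2⟩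
    simp only at e3 e4
    exact ⟨e3, by linarith⟩
  · have hm : 2 * ℓ - x ∈ Icc ℓ (2 * ℓ) := ⟨by linarith, by linarith [hx.1]⟩
    have e3 := e1 hm
    have e4 := e2 hm
    simp only [sub_sub_cancel] at e3 e4
    exact ⟨e3.symm, e4.symm⟩

lemma integral_eq_two_mul (hp : 2 < p) (hℓ : 0 < ℓ) (h : IsSol p (Icc 0 (2 * ℓ)) u v)
    (hv : v ℓ = 0) :
    ∫ x in (0 : ℝ)..(2 * ℓ), |u x| ^ p = 2 * ∫ x in (0 : ℝ)..ℓ, |u x| ^ p := by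
  have hi := h.intervalIntegrable_rpow hp (by linarith : 0 ≤ 2 * ℓ)
  have hsub : ∀ {x y : ℝ}, x ∈ Icc 0 (2 * ℓ) → y ∈ Icc 0 (2 * ℓ) → uIcc x y ⊆ uIcc 0 (2 * ℓ) :=
    fun hx hy => by rw [uIcc_of_le (by linarith : (0 : ℝ) ≤ 2 * ℓ)]; exact uIcc_subset_Icc hx hy
  have m0 : (0 : ℝ) ∈ Icc 0 (2 * ℓ) := ⟨le_rfl, by linarith⟩
  have m1 : ℓ ∈ Icc 0 (2 * ℓ) := ⟨hℓ.le, by linarith⟩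
  have m2 : 2 * ℓ ∈ Icc 0 (2 * ℓ) := ⟨by linarith, le_rfl⟩
  rw [← intervalIntegral.integral_add_adjacent_intervals (hi.mono_set (hsub m0 m1))
    (hi.mono_set (hsub m1 m2))]
  have : ∫ x in ℓ..(2 * ℓ), |u x| ^ p = ∫ x in (0 : ℝ)..ℓ, |u x| ^ p := by
    have e := intervalIntegral.integral_comp_sub_left (a := 0) (b := ℓ) (fun x => |u x| ^ p) (2 * ℓ)
    rw [sub_zero, show 2 * ℓ - ℓ = ℓ by ring] at e
    rw [← e]
    refine intervalIntegral.integral_congr fun x hx => ?_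
    rw [uIcc_of_le hℓ.le] at hx
    simp only [(h.eq_reflect_of_deriv_eq_zero hp hℓ hv x ⟨hx.1, by linarith [hx.2]⟩).1]
  rw [this]; ring

end IsSol

/-! ### Bound-states from the shooting problem -/

section Construction

variable {N : ℝ} {U V : ℝ → ℝ → ℝ}

lemma IsShooting.exists_isBoundState (hp : 2 < p) (hℓ : 0 < ℓ) (h : IsShooting p N ℓ U V)
    (hN : N * (P + 2 * L) = H) {G : SingleKnotGraph H P L} (hG : G.IsRegular ℓ) {a : ℝ}
    (hV : V a ℓ = 0) : ∃ u : H1Function G, IsBoundState p u ∧ action p u =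
      (1 / 2 - 1 / p) * ((P + 2 * L) * (∫ x in (0 : ℝ)..ℓ, |U a x| ^ p) + H * solitonMass p a) := by
  -- The family lives on `[0, ℓ]` only. Solving on `[0, 2ℓ]` gives one function that serves both
  -- pendants and loops, symmetric about `ℓ` by the Neumann condition.
  obtain ⟨W, Z, hW, hW0, hZ0⟩ := exists_isSol hp (soliton p a) (-(N * solitonDeriv p a))
    (by linarith : 0 < 2 * ℓ)
  have hsub : Icc 0 ℓ ⊆ Icc 0 (2 * ℓ) := Icc_subset_Icc_right (by linarith)
  obtain ⟨eW, eZ⟩ := (h.isSol a).eqOn_Icc hp (hW.mono hsub) ((h.init a).trans hW0.symm)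
    ((h.init_deriv a).trans hZ0.symm)
  have hℓm : ℓ ∈ Icc 0 ℓ := ⟨hℓ.le, le_rfl⟩
  have hZℓ : Z ℓ = 0 := (eZ hℓm).symm.trans hV
  have hrefl := hW.eq_reflect_of_deriv_eq_zero hp hℓ hZℓ 0 ⟨le_rfl, by linarith⟩
  rw [sub_zero] at hrefl
  set f : Edge H P L → ℝ → ℝ := fun e x => match e with
    | Sum.inl _ => W x
    | Sum.inr (Sum.inl _) => W x
    | Sum.inr (Sum.inr _) => soliton p (x + a) with hf
  set g : Edge H P L → ℝ → ℝ := fun e x => match e with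
    | Sum.inl _ => Z x
    | Sum.inr (Sum.inl _) => Z x
    | Sum.inr (Sum.inr _) => solitonDeriv p (x + a) with hg
  have hsol : ∀ e, IsSol p (G.closedEdge e) (f e) (g e) := by
    rintro (i | j | k)
    · show IsSol p (Icc 0 (G.pendantLength i)) W Z
      rw [hG.1 i]; exact hW.mono hsub
    · show IsSol p (Icc 0 (G.loopLength j)) W Z
      rw [hG.2 j]; exact hW
    · exact isSol_soliton hp a _
  let u : H1Function G := H1Function.ofHasDeriv G f g (fun e x hx => (hsol e x hx).1)
    (fun e => (hsol e).continuousOn_deriv) ⟨soliton p a, by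
      rintro (i | j | k)
      · exact hW0
      · exact hW0
      · simp [hf], fun j => by
        show W (G.loopLength j) = _
        rw [hG.2 j, hrefl.1, hW0]⟩ (fun k => memLp_soliton hp a) (fun k => memLp_solitonDeriv hp a)
  have hu : IsClassical p u g := fun e => ⟨hsol e, EventuallyEq.rfl⟩
  have hb : IsBoundState p u := by
    refine hu.isBoundState hp ⟨halfLine ⟨0, G.one_le_halfLines⟩, 0, mem_Ici.2 le_rfl, ?_⟩
      (fun i => ?_) ?_
    · show soliton p (0 + a) ≠ 0
      exact (soliton_pos hp _).ne'
    · show Z (G.pendantLength i) = 0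
      rw [hG.1 i, hZℓ]
    -- Each pendant contributes `-N φ'(a)`, each loop twice that, and each half-line `φ'(a)`; `hN`
    -- is exactly the balance.
    · simp only [hg, hG.2, hrefl.2, hZ0, zero_add, Finset.sum_const, Finset.card_univ,
        Fintype.card_fin, nsmul_eq_mul]
      rw [← hN]; ring
  refine ⟨u, hb, ?_⟩
  rw [hb.action_eq hp hu, integral_eq_sum]
  have e1 : ∫ x in (0 : ℝ)..ℓ, |W x| ^ p = ∫ x in (0 : ℝ)..ℓ, |U a x| ^ p := by
    refine intervalIntegral.integral_congr fun x hx => ?_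
    rw [uIcc_of_le hℓ.le] at hx
    simp only [eW hx]
  have e2 := hW.integral_eq_two_mul hp hℓ hZℓ
  have e3 : ∀ i, ∫ x in (0 : ℝ)..G.pendantLength i, |u.toFun (pendant i) x| ^ p =
      ∫ x in (0 : ℝ)..ℓ, |U a x| ^ p := fun i => by
    rw [hG.1 i]; exact e1
  have e4 : ∀ j, ∫ x in (0 : ℝ)..G.loopLength j, |u.toFun (loop j) x| ^ p =
      2 * ∫ x in (0 : ℝ)..ℓ, |U a x| ^ p := fun j => by
    rw [hG.2 j, ← e1]; exact e2
  have e5 : ∀ k, ∫ x in Ioi 0, |u.toFun (halfLine k) x| ^ p = solitonMass p a := fun k => rfl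
  simp only [e3, e4, e5, Finset.sum_const, Finset.card_univ, Fintype.card_fin, nsmul_eq_mul]
  ring

/-- If every bound-state has larger action than some solution of the shooting problem or comes from
the shooting problem itself, then ground-states exist and come from the shooting problem. -/
lemma IsShooting.exists_groundState_and_isSymmetric (hp : 2 < p) (hℓ : 0 < ℓ)
    (h : IsShooting p N ℓ U V) (hN1 : 1 ≤ N) (hN : N * (P + 2 * L) = H)
    {G : SingleKnotGraph H P L} (hG : G.IsRegular ℓ) {a₀ : ℝ} (ha₀ : 0 ≤ a₀) (hV₀ : V a₀ ℓ = 0)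
    (halt : ∀ u : H1Function G, IsBoundState p u →
      (1 / 2 - 1 / p) * ((P + 2 * L) * (∫ x in (0 : ℝ)..ℓ, |U a₀ x| ^ p) + H * solitonMass p a₀) <
        action p u ∨
      ∃ a, 0 ≤ a ∧ V a ℓ = 0 ∧ action p u = (1 / 2 - 1 / p) *
        ((P + 2 * L) * (∫ x in (0 : ℝ)..ℓ, |U a x| ^ p) + H * solitonMass p a) ∧
        IsSymmetric ℓ u) :
    (∃ u : H1Function G, IsActionGroundState p u) ∧
      ∀ u : H1Function G, IsActionGroundState p u → IsSymmetric ℓ u := by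
  have hκ := one_half_sub_inv_pos hp
  obtain ⟨a, ⟨-, hVa⟩, hmin⟩ := h.exists_min_mass hp hN1 hℓ (P + 2 * L) H ⟨a₀, ha₀, hV₀⟩
  constructor
  · obtain ⟨u, hu, hact⟩ := h.exists_isBoundState hp hℓ hN hG hVa
    refine ⟨u, hu, ⟨u, hu, rfl⟩, ?_⟩
    rintro _ ⟨w, hw, rfl⟩
    rw [hact]
    rcases halt w hw with hlt | ⟨a', ha', hVa', hact', -⟩
    · exact (mul_le_mul_of_nonneg_left (hmin a₀ ha₀ hV₀) hκ.le).trans hlt.le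
    · rw [hact']
      exact mul_le_mul_of_nonneg_left (hmin a' ha' hVa') hκ.le
  · rintro u ⟨hu, -, hle⟩
    rcases halt u hu with hlt | ⟨_, _, _, _, hs⟩
    · obtain ⟨w, hw, hact⟩ := h.exists_isBoundState hp hℓ hN hG hV₀
      have := hle ⟨w, hw, rfl⟩
      linarith
    · exact hs

end Construction

end SingleKnotGraph

namespace SingleKnotGraph

/-! ### Classification of the bound-states with one pendant or one loop -/

variable {p ℓ : ℝ} {H P L : ℕ} {U V : ℝ → ℝ → ℝ}

/-- A solution on the compact edge with the initial data of the shooting problem, up to sign. -/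
lemma IsShooting.eqOn_of_sign {N : ℝ} (hp : 2 < p) (h : IsShooting p N ℓ U V) {u v : ℝ → ℝ}
    (hu : IsSol p (Icc 0 ℓ) u v) {σ a : ℝ} (hσ : σ = 1 ∨ σ = -1) (h0 : u 0 = σ * soliton p a)
    (h1 : v 0 = -(σ * (N * solitonDeriv p a))) :
    EqOn (U a) (fun x => σ * u x) (Icc 0 ℓ) ∧ EqOn (V a) (fun x => σ * v x) (Icc 0 ℓ) := by
  have hσ2 : σ * σ = 1 := by rcases hσ with rfl | rfl <;> norm_num
  refine (h.isSol a).eqOn_Icc hp (hu.const_mul hσ) ?_ ?_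
  · rw [h.init, h0, ← mul_assoc, hσ2, one_mul]
  · rw [h.init_deriv, h1]
    linear_combination (N * solitonDeriv p a) * hσ2

lemma IsShooting.integral_eq_of_sign {σ a : ℝ} (hℓ : 0 ≤ ℓ) (hσ : σ = 1 ∨ σ = -1) {u : ℝ → ℝ}
    (h : EqOn (U a) (fun x => σ * u x) (Icc 0 ℓ)) :
    ∫ x in (0 : ℝ)..ℓ, |u x| ^ p = ∫ x in (0 : ℝ)..ℓ, |U a x| ^ p := by
  have hσ1 : |σ| = 1 := by rcases hσ with rfl | rfl <;> norm_num
  refine intervalIntegral.integral_congr fun x hx => ?_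
  rw [uIcc_of_le hℓ] at hx
  simp only [h hx, abs_mul, hσ1, one_mul]

/-- A half-line with shift `-a` already gives a full soliton on the half-lines; without one,
Kirchhoff's condition dictates the shooting slope on the pendant. -/
lemma pendant_alternative (hp : 2 < p) (hH : 2 ≤ H) (hℓ : 0 < ℓ) {G : SingleKnotGraph H 1 0}
    (hG : G.IsRegular ℓ) (h : IsShooting p H ℓ U V) {u : H1Function G} (hu : IsBoundState p u) :
    (1 / 2 - 1 / p) * (2 * solitonMass p 0) ≤ action p u ∨
      ∃ a, 0 ≤ a ∧ V a ℓ = 0 ∧ action p u = (1 / 2 - 1 / p) *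
        (((1 : ℕ) + 2 * (0 : ℕ)) * (∫ x in (0 : ℝ)..ℓ, |U a x| ^ p) + H * solitonMass p a) ∧
        IsSymmetric ℓ u := by
  have hκ := one_half_sub_inv_pos hp
  obtain ⟨v, hv⟩ := hu.exists_isClassical hp
  obtain ⟨c, hc, -⟩ := u.continuous_vertex
  obtain ⟨htip, hK⟩ := hu.vertex_conditions hp hv
  simp only [Fin.sum_univ_one, Fin.sum_univ_zero, zero_add] at hK
  have hsol : IsSol p (Icc 0 ℓ) (u.toFun (pendant 0)) (v (pendant 0)) := by
    rw [← hG.1 0]; exact (hv (pendant 0)).1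
  have hcore : IsCoreSymmetric ℓ u := by
    rintro (i | j | j) (i' | j' | j')
    · rw [Subsingleton.elim i i']; exact fun x _ => rfl
    all_goals exact (Fin.elim0 ‹Fin 0›)
  -- With zero vertex value the half-lines vanish, and Kirchhoff's condition leaves zero data on the
  -- pendant, contradicting nontriviality.
  by_cases hc0 : c = 0
  · subst hc0
    have hhalf := hv.halfLine_eq_zero hp hc
    simp only [hhalf, Finset.sum_const_zero, add_zero] at hK
    have hz := (hsol.eqOn_Icc hp (IsSol.zero p _) (hc _) hK).1
    obtain ⟨e, x, hx, hne⟩ := hu.1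
    refine absurd ?_ hne
    rcases e with i | j | k
    · rw [Subsingleton.elim i 0] at hx ⊢
      change x ∈ Icc 0 (G.pendantLength 0) at hx
      rw [hG.1 0] at hx
      exact hz hx
    · exact Fin.elim0 j
    · exact (hhalf k).1 hx
  obtain ⟨σ, a, hσ, ha, hca, t, ht, hut, hvt⟩ := hv.exists_shifts hp hc hc0
  have hmass : ∀ k, ∫ x in Ioi 0, |u.toFun (halfLine k) x| ^ p = solitonMass p (t k) :=
    fun k => integral_rpow_eq_solitonMass hσ (hut k)
  have hact := hu.action_eq hp hv
  rw [integral_eq_sum, Fin.sum_univ_one, Fin.sum_univ_zero, zero_add, hG.1] at hact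
  simp only [hmass] at hact
  by_cases hex : ∃ k, t k = -a
  · left
    rw [hact]
    refine mul_le_mul_of_nonneg_left ?_ hκ.le
    have h1 := two_mul_solitonMass_le_sum hp hH ha ht hex
    have h2 : 0 ≤ ∫ x in (0 : ℝ)..ℓ, |u.toFun (pendant 0) x| ^ p :=
      intervalIntegral.integral_nonneg hℓ.le fun x _ => by positivity
    linarith
  · right
    have hta : ∀ k, t k = a := fun k => ((ht k).resolve_right fun hk => hex ⟨k, hk⟩).1
    simp only [hvt, hta, Finset.sum_const, Finset.card_univ, Fintype.card_fin, nsmul_eq_mul] at hK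
    obtain ⟨eU, eV⟩ := h.eqOn_of_sign hp hsol hσ ((hc _).trans hca) (by linear_combination hK)
    refine ⟨a, ha, ?_, ?_, hcore, fun k₁ k₂ x hx => ?_⟩
    · have htip0 := htip 0
      rw [hG.1] at htip0
      rw [eV ⟨hℓ.le, le_rfl⟩]
      simp only [htip0, mul_zero]
    · rw [hact, IsShooting.integral_eq_of_sign hℓ.le hσ eU]
      simp [hta]
    · rw [hut k₁ hx, hut k₂ hx, hta, hta]

lemma IsSol.deriv_nonneg_of_nonneg {b : ℝ} (hb : 0 < b) {u v : ℝ → ℝ} (h : IsSol p (Icc 0 b) u v)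
    (h0 : u 0 = 0) (hu : ∀ x ∈ Icc 0 b, 0 ≤ u x) : 0 ≤ v 0 := by
  have hd := (h 0 ⟨le_rfl, hb.le⟩).1.mono Ioc_subset_Icc_self
  have ht := (hasDerivWithinAt_iff_tendsto_slope' (by simp)).1 hd
  have hne : (𝓝[Ioc 0 b] (0 : ℝ)).NeBot := by
    rw [nhdsWithin_Ioc_eq_nhdsGT hb]; infer_instance
  refine ge_of_tendsto ht ?_
  filter_upwards [self_mem_nhdsWithin] with x hx
  rw [slope_def_field, h0, sub_zero, sub_zero]
  exact div_nonneg (hu x (Ioc_subset_Icc_self hx)) hx.1.le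

/-- A nonnegative function starts from zero with slope `≥ 0` and returns to zero with slope `≤ 0`.
-/
lemma IsSol.deriv_eq_zero_of_nonneg {b : ℝ} (hb : 0 < b) {u v : ℝ → ℝ} (h : IsSol p (Icc 0 b) u v)
    (h0 : u 0 = 0) (hub : u b = 0) (hv : v b = v 0) (hu : ∀ x ∈ Icc 0 b, 0 ≤ u x) : v 0 = 0 := by
  have h1 := h.deriv_nonneg_of_nonneg hb h0 hu
  have h2 := h.reflect.deriv_nonneg_of_nonneg hb (by simpa using hub)
    fun x hx => hu _ ⟨by linarith [hx.2], by linarith [hx.1]⟩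
  rw [sub_zero, hv] at h2
  linarith

/-- Two sign-definite arcs of a loop carry at least the action of two solitons. -/
lemma IsSol.four_mul_solitonMass_le (hp : 2 < p) {b : ℝ} (hb : 0 < b) {u v : ℝ → ℝ}
    (h : IsSol p (Icc 0 b) u v) (h0 : u 0 = 0) (hub : u b = 0) (hv : v b = v 0) (hv0 : v 0 ≠ 0) :
    4 * solitonMass p 0 ≤ ∫ x in (0 : ℝ)..b, |u x| ^ p := by
  have hκ := one_half_sub_inv_pos hp
  have key : ∀ {z : ℝ} {u v : ℝ → ℝ}, 0 < z → IsSol p (Icc 0 z) u v → u 0 = 0 → u z = 0 →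
      v 0 ≠ 0 → 2 * solitonMass p 0 ≤ ∫ x in (0 : ℝ)..z, |u x| ^ p := by
    intro z u v hz h h0 h1 hv
    have hne : ∃ x ∈ Icc 0 z, u x ≠ 0 := by
      by_contra hcon
      push Not at hcon
      refine hv ?_
      have hd := (h 0 ⟨le_rfl, hz.le⟩).1
      have hd' : HasDerivWithinAt u 0 (Icc 0 z) 0 :=
        (hasDerivWithinAt_const (0 : ℝ) (Icc 0 z) (0 : ℝ)).congr_of_mem hcon ⟨le_rfl, hz.le⟩
      exact (uniqueDiffOn_Icc hz 0 ⟨le_rfl, hz.le⟩).eq_deriv _ hd hd'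
    have := h.two_mul_profileInt_le hp hz h0 h1 hne
    rw [← solitonMass_zero_eq hp] at this
    nlinarith
  -- Equal nonzero slopes at the two ends exclude a constant sign, so `u` has an interior zero and
  -- splits into two nontrivial arcs.
  have hz : ∃ z ∈ Ioo 0 b, u z = 0 := by
    by_contra hcon
    push Not at hcon
    by_cases hpos : ∀ x ∈ Icc 0 b, 0 ≤ u x
    · exact hv0 (h.deriv_eq_zero_of_nonneg hb h0 hub hv hpos)
    push Not at hpos
    obtain ⟨x, hx, hux⟩ := hpos
    have hmem : ∀ y ∈ Icc 0 b, u y ≠ 0 → y ∈ Ioo 0 b := fun y hy hne =>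
      ⟨lt_of_le_of_ne hy.1 fun he => hne (by rw [← he, h0]),
        lt_of_le_of_ne hy.2 fun he => hne (by rw [he, hub])⟩
    refine hv0 (neg_eq_zero.1 (h.neg.deriv_eq_zero_of_nonneg hb (by simp [h0]) (by simp [hub])
      (by simp [hv]) fun y hy => ?_))
    by_contra hy'
    obtain ⟨z, hz, huz⟩ := isPreconnected_Ioo.intermediate_value (hmem x hx hux.ne)
      (hmem y hy fun he => hy' (by simp [he])) (h.continuousOn.mono Ioo_subset_Icc_self)
      (⟨hux.le, by linarith⟩ : (0 : ℝ) ∈ Icc (u x) (u y))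
    exact hcon z hz huz
  obtain ⟨z, hz, huz⟩ := hz
  have hi := h.intervalIntegrable_rpow hp hb.le
  have hzm : z ∈ uIcc 0 b := by rw [uIcc_of_le hb.le]; exact Ioo_subset_Icc_self hz
  have h1 := key hz.1 (h.mono (Icc_subset_Icc_right hz.2.le)) h0 huz hv0
  have h2 := key (sub_pos.2 hz.2) (h.reflect.mono (Icc_subset_Icc_right (by linarith [hz.1])))
    (by simpa using hub) (by simpa using huz) (by simpa [hv] using hv0)
  rw [intervalIntegral.integral_comp_sub_left (fun x => |u x| ^ p) b] at h2
  simp only [sub_zero, sub_sub_cancel] at h2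
  rw [← intervalIntegral.integral_add_adjacent_intervals
    (hi.mono_set (uIcc_subset_uIcc left_mem_uIcc hzm))
    (hi.mono_set (uIcc_subset_uIcc hzm right_mem_uIcc))]
  linarith

/-- The symmetric competitor itself has action close to a full soliton's, so the weak bound of the
pendant case does not suffice: strictness is needed for `H = 2`, and a gap independent of `ℓ` for `H
≥ 3`. -/
lemma loop_alternative (hp : 2 < p) (hH : 2 ≤ H) (hℓ : 1 ≤ ℓ) {G : SingleKnotGraph H 0 1}
    (hG : G.IsRegular ℓ) (h : IsShooting p (H / 2) ℓ U V) {u : H1Function G}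
    (hu : IsBoundState p u) :
    ((1 / 2 - 1 / p) * (2 * solitonMass p 0) < action p u ∧
      (3 ≤ H → (1 / 2 - 1 / p) * (2 * solitonMass p 0 + min (1 / 2) (solitonMass p 0)) ≤
        action p u)) ∨
      ∃ a, 0 ≤ a ∧ V a ℓ = 0 ∧ action p u = (1 / 2 - 1 / p) *
        (((0 : ℕ) + 2 * (1 : ℕ)) * (∫ x in (0 : ℝ)..ℓ, |U a x| ^ p) + H * solitonMass p a) ∧
        IsSymmetric ℓ u := by
  have hκ := one_half_sub_inv_pos hp
  have hℓ0 : 0 < ℓ := by linarith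
  have h2ℓ : 0 < 2 * ℓ := by linarith
  have hm0 := solitonMass_zero_pos hp
  obtain ⟨v, hv⟩ := hu.exists_isClassical hp
  obtain ⟨c, hc, hcL⟩ := u.continuous_vertex
  obtain ⟨-, hK⟩ := hu.vertex_conditions hp hv
  simp only [Fin.sum_univ_one, Fin.sum_univ_zero, zero_add, hG.2] at hK
  have hcL := hcL 0
  rw [hG.2 0] at hcL
  have hsol : IsSol p (Icc 0 (2 * ℓ)) (u.toFun (loop 0)) (v (loop 0)) := by
    rw [← hG.2 0]; exact (hv (loop 0)).1
  have hact := hu.action_eq hp hv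
  rw [integral_eq_sum, Fin.sum_univ_one, Fin.sum_univ_zero, zero_add, hG.2] at hact
  -- The half-lines vanish and Kirchhoff's condition equates the slopes at the two ends of the loop.
  by_cases hc0 : c = 0
  · left
    subst hc0
    have hhalf := hv.halfLine_eq_zero hp hc
    simp only [hhalf, Finset.sum_const_zero, add_zero] at hK
    have hv0 : v (loop 0) 0 ≠ 0 := by
      intro hv0
      have hz := (hsol.eqOn_Icc hp (IsSol.zero p _) (hc _) hv0).1
      obtain ⟨e, x, hx, hne⟩ := hu.1
      refine absurd ?_ hne
      rcases e with i | j | k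
      · exact Fin.elim0 i
      · rw [Subsingleton.elim j 0] at hx ⊢
        change x ∈ Icc 0 (G.loopLength 0) at hx
        rw [hG.2 0] at hx
        exact hz hx
      · exact (hhalf k).1 hx
    have h4 := hsol.four_mul_solitonMass_le hp h2ℓ (hc _) hcL (by linarith) hv0
    have hn : 0 ≤ ∑ k, ∫ x in Ioi 0, |u.toFun (halfLine k) x| ^ p :=
      Finset.sum_nonneg fun k _ => integral_nonneg fun x => by positivity
    have hmin := min_le_right (1 / 2) (solitonMass p 0)
    rw [hact]
    exact ⟨mul_lt_mul_of_pos_left (by linarith) hκ,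
      fun _ => mul_le_mul_of_nonneg_left (by linarith) hκ.le⟩
  obtain ⟨σ, a, hσ, ha, hca, t, ht, hut, hvt⟩ := hv.exists_shifts hp hc hc0
  have hσ2 : σ * σ = 1 := by rcases hσ with rfl | rfl <;> norm_num
  have hmass : ∀ k, ∫ x in Ioi 0, |u.toFun (halfLine k) x| ^ p = solitonMass p (t k) :=
    fun k => integral_rpow_eq_solitonMass hσ (hut k)
  simp only [hmass] at hact
  simp only [hvt, ← Finset.mul_sum] at hK
  by_cases hex : ∃ k, t k = -a
  · left
    have h1 := two_mul_solitonMass_le_sum hp hH ha ht hex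
    have h2 : 0 < ∫ x in (0 : ℝ)..(2 * ℓ), |u.toFun (loop 0) x| ^ p := by
      refine intervalIntegral.integral_pos h2ℓ
        ((continuous_abs_rpow (by linarith)).comp_continuousOn hsol.continuousOn)
        (fun x _ => by positivity) ⟨0, ⟨le_rfl, h2ℓ.le⟩, ?_⟩
      rw [hc]
      exact Real.rpow_pos_of_pos (abs_pos.2 hc0) _
    rw [hact]
    refine ⟨mul_lt_mul_of_pos_left (by linarith) hκ,
      fun hH3 => mul_le_mul_of_nonneg_left ?_ hκ.le⟩
    obtain ⟨k, hk⟩ := hex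
    -- The gap comes from a second half-line with shift `-a` if there is one. Otherwise the sum of
    -- the half-line slopes makes the loop's boundary term nonpositive, and the loop itself has mass
    -- at least `1/2`.
    by_cases hother : ∃ j, k ≠ j ∧ t j = -a
    · obtain ⟨j, hkj, hj⟩ := hother
      have h3 := three_mul_solitonMass_le_sum hp hH3 ha ht hkj hk hj
      have hmin := min_le_right (1 / 2) (solitonMass p 0)
      linarith
    · have hS := sum_solitonDeriv_nonpos hp hH hk fun j hj =>
        (ht j).resolve_right fun hj' => hother ⟨j, hj.symm, hj'⟩
      have h3 := hsol.one_half_le_integral_rpow hp (by linarith)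
        ⟨0, ⟨le_rfl, h2ℓ.le⟩, by rwa [hc]⟩ (by
          rw [hcL, hc, hca]
          have := mul_nonpos_of_nonneg_of_nonpos (soliton_pos hp a).le hS
          have e : σ * soliton p a * v (loop 0) (2 * ℓ) - σ * soliton p a * v (loop 0) 0 =
              soliton p a * ∑ i, solitonDeriv p (t i) := by
            linear_combination (-(σ * soliton p a)) * hK +
              (soliton p a * ∑ i, solitonDeriv p (t i)) * hσ2
          rwa [e])
      have hmin := min_le_left (1 / 2) (solitonMass p 0)
      linarith
  · right
    have hta : ∀ k, t k = a ∧ 0 < a := fun k => (ht k).resolve_right fun hk => hex ⟨k, hk⟩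
    have ha0 : 0 < a := (hta ⟨0, G.one_le_halfLines⟩).2
    simp only [hta, Finset.sum_const, Finset.card_univ, Fintype.card_fin, nsmul_eq_mul] at hK
    have hd := solitonDeriv_neg_of_pos hp ha0
    have hH0 : (0 : ℝ) < H := by exact_mod_cast (by omega : 0 < H)
    -- Equal heights and energy conservation give equal squares of the slopes. Equal slopes would
    -- cancel in Kirchhoff's condition and leave the nonzero half-line sum.
    have hvv : v (loop 0) (2 * ℓ) = -v (loop 0) 0 := by
      have hE := hsol.energy_eq hp (convex_Icc _ _) ⟨le_rfl, h2ℓ.le⟩ ⟨h2ℓ.le, le_rfl⟩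
      rw [energy, energy, hcL, hc] at hE
      have hsq : v (loop 0) (2 * ℓ) ^ 2 = v (loop 0) 0 ^ 2 := by linarith
      refine (sq_eq_sq_iff_eq_or_eq_neg.1 hsq).resolve_left fun he => ?_
      rw [he, sub_self, zero_add] at hK
      have hσ0 : σ ≠ 0 := by rintro rfl; simp at hσ2
      exact mul_ne_zero hσ0 (mul_ne_zero hH0.ne' hd.ne) hK
    obtain ⟨er, erv⟩ := hsol.reflect.eqOn_Icc hp hsol (by simp [hcL, hc]) (by simp [hvv])
    have hvℓ : v (loop 0) ℓ = 0 := by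
      have := erv (⟨hℓ0.le, by linarith⟩ : ℓ ∈ Icc 0 (2 * ℓ))
      simp only [show 2 * ℓ - ℓ = ℓ by ring] at this
      linarith
    obtain ⟨eU, eV⟩ := h.eqOn_of_sign hp (hsol.mono (Icc_subset_Icc_right (by linarith))) hσ
      ((hc _).trans hca) (by rw [hvv] at hK; linear_combination hK / 2)
    refine ⟨a, ha, ?_, ?_, ?_, fun k₁ k₂ x hx => ?_⟩
    · rw [eV ⟨hℓ0.le, le_rfl⟩]
      simp only [hvℓ, mul_zero]
    · rw [hact, hsol.integral_eq_two_mul hp hℓ0 hvℓ,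
        IsShooting.integral_eq_of_sign hℓ0.le hσ eU]
      simp [hta]
    · have hsymm : ∀ x ∈ Icc 0 ℓ, u.toFun (loop 0) (2 * ℓ - x) = u.toFun (loop 0) x :=
        fun x hx => er ⟨hx.1, by linarith [hx.2]⟩
      rintro (i | j | j) (i' | j' | j') x hx
      all_goals first
        | exact i.elim0
        | exact i'.elim0
        | (rw [Subsingleton.elim j 0, Subsingleton.elim j' 0]
           done)
        | (rw [Subsingleton.elim j 0, Subsingleton.elim j' 0]
           simp [coreRestriction, hsymm x hx])
    · rw [hut k₁ hx, hut k₂ hx, (hta k₁).1, (hta k₂).1]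

end SingleKnotGraph

/-! ### The symmetric competitor against the other bound-states -/

theorem mainTheorem7 (p : ℝ) (hp : 2 < p) (H P L : ℕ) (hH : 2 ≤ H) (hPL : P + L = 1) :
    ∃ ℓ₀ : ℝ, 0 < ℓ₀ ∧ ∀ ℓ : ℝ, ℓ₀ ≤ ℓ →
      ∀ G : SingleKnotGraph H P L, G.IsRegular ℓ →
        (∃ u : G.H1Function, SingleKnotGraph.IsActionGroundState p u) ∧
        ∀ u : G.H1Function, SingleKnotGraph.IsActionGroundState p u →
          SingleKnotGraph.IsSymmetric ℓ u := by
  open SingleKnotGraph in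
  have hκ := one_half_sub_inv_pos hp
  have hm0 := solitonMass_zero_pos hp
  have hHr : (2 : ℝ) ≤ H := by exact_mod_cast hH
  obtain ⟨rfl, rfl⟩ | ⟨rfl, rfl⟩ : (P = 1 ∧ L = 0) ∨ (P = 0 ∧ L = 1) := by omega
  · -- one pendant
    set κ := 1 / 2 - 1 / p with hκdef
    have hden : 0 < 2 * (1 + κ * H) := by positivity
    -- The competitor exceeds half a soliton's action by at most `(1 + κ H) ε`, chosen to be half of
    -- the available gap `κ * solitonMass p 0`.
    have hε : 0 < κ * solitonMass p 0 / (2 * (1 + κ * H)) := by positivity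
    obtain ⟨T, hT0, hT⟩ := IsShooting.exists_small_action hp (by linarith : (1 : ℝ) ≤ H) hε
    refine ⟨T, hT0, fun ℓ hℓ G hG => ?_⟩
    have hℓ0 : 0 < ℓ := hT0.trans_le hℓ
    obtain ⟨U, V, h⟩ := IsShooting.exists_isShooting hp H hℓ0
    obtain ⟨a, ha, hVa, ha1, ha2⟩ := hT hℓ h
    refine h.exists_groundState_and_isSymmetric hp hℓ0 (by linarith) (by simp) hG ha hVa
      fun u hu => (pendant_alternative hp hH hℓ0 hG h hu).imp_left fun hle => lt_of_lt_of_le ?_ hle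
    set ε := κ * solitonMass p 0 / (2 * (1 + κ * H)) with hεdef
    have hε2 : ε * (1 + κ * H) = κ * solitonMass p 0 / 2 := by
      rw [hεdef]; field_simp
    have h3 : κ * H * solitonMass p a ≤ κ * H * ε := by gcongr
    have h4 : 0 < κ * solitonMass p 0 := by positivity
    simp only [Nat.cast_one, Nat.cast_zero, mul_zero, add_zero, one_mul]
    nlinarith
  · rcases hH.eq_or_lt with rfl | hH3
    · -- one loop and two half-lines
      -- The exact soliton competitor exists for every positive length; `1` is the length required
      -- by `loop_alternative`.
      refine ⟨1, one_pos, fun ℓ hℓ G hG => ?_⟩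
      have hℓ0 : 0 < ℓ := one_pos.trans_le hℓ
      obtain ⟨U, V, h⟩ := IsShooting.exists_isShooting hp 1 hℓ0
      obtain ⟨a, ha, hVa, hact⟩ := h.exists_action_of_weight_one hp hℓ0
      refine h.exists_groundState_and_isSymmetric hp hℓ0 le_rfl (by simp) hG ha hVa
        fun u hu => (loop_alternative hp le_rfl hℓ hG (by simpa using h) hu).imp_left
          fun hlt => lt_of_le_of_lt (le_of_eq ?_) hlt.1
      rw [← hact]; simp
    · -- one loop and at least three half-lines
      set κ := 1 / 2 - 1 / p with hκdef
      set μ := min (1 / 2) (solitonMass p 0) with hμ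
      have hμ0 : 0 < μ := lt_min (by norm_num) hm0
      -- The loop counts as two edges, so the excess over a soliton's action is at most `(2 + κ H)
      -- ε`, half of the gap `κ μ`.
      have hε : 0 < κ * μ / (2 * (2 + κ * H)) := by positivity
      have hN1 : (1 : ℝ) ≤ H / 2 := by linarith
      obtain ⟨T, hT0, hT⟩ := IsShooting.exists_small_action hp hN1 hε
      refine ⟨max T 1, lt_max_of_lt_left hT0, fun ℓ hℓ G hG => ?_⟩
      have hℓ1 : 1 ≤ ℓ := (le_max_right _ _).trans hℓ
      have hℓ0 : 0 < ℓ := one_pos.trans_le hℓ1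
      obtain ⟨U, V, h⟩ := IsShooting.exists_isShooting hp (H / 2) hℓ0
      obtain ⟨a, ha, hVa, ha1, ha2⟩ := hT ((le_max_left _ _).trans hℓ) h
      refine h.exists_groundState_and_isSymmetric hp hℓ0 hN1 (by simp) hG ha hVa
        fun u hu => (loop_alternative hp hH hℓ1 hG h hu).imp_left
          fun hlt => lt_of_lt_of_le ?_ (hlt.2 hH3)
      set ε := κ * μ / (2 * (2 + κ * H)) with hεdef
      have hε2 : ε * (2 + κ * H) = κ * μ / 2 := by
        rw [hεdef]; field_simp
      have h3 : κ * H * solitonMass p a ≤ κ * H * ε := by gcongr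
      have h4 : 0 < κ * μ := by positivity
      simp only [Nat.cast_one, Nat.cast_zero, zero_add, mul_one]
      nlinarith
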